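/- Setup. Let $\Gamma$ be a finite group with complex representation ring $R(\Gamma)$; virtual representations are identified with their virtual characters $\Gamma\to\mathbb{C}$. Let $d\ge 0$, let $\rho:\Gamma\to \mathrm{GL}_{d+1}(\mathbb{Z})$ be a representation, let $P\subseteq\mathbb{R}^{d+1}$ be a $d$-dimensional $\Gamma$-invariant lattice polytope (the convex hull of finitely many points of $\mathbb{Z}^{d+1}$), and suppose that the cone $C$ over $P$ is $(d+1)$-dimensional. For a face $F$ of $C$ (including $\{0\}$ and $C$), let $\Gamma_F$ be its stabilizer, $\rho_F$ the representation of $\Gamma_F$ on the linear span of $F$, and $F^*$ the face of the dual cone $\check C\subseteq(\mathbb{R}^{d+1})^*$ consisting of the linear forms that are nonnegative on $C$ and zero on $F$; $\Gamma_F$ acts on it through the contragredient representation. For a real representation $\sigma$ of dimension $n$ put $\det[tI-\sigma]=\sum_{i=0}^n(-1)^{n-i}(\wedge^{n-i}\sigma)t^i$ and $\det[I-\sigma t]=\sum_{i=0}^n(-1)^{i}(\wedge^{i}\sigma)t^i$. The polynomial $G$. For a finite group $\Gamma'$ acting linearly on a finite-dimensional real vector space and a pointed polyhedral $\Gamma'$-invariant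 cone $D$, with $\rho_D$ the representation of $\Gamma'$ on the linear span of $D$, define $G(D,t)\in R(\Gamma')[t]$ recursively: $G(\{0\},t)=1$, and for $D\neq\{0\}$, $G(D,t)$ is the truncation to degrees $\le \frac{\dim D-1}{2}$ of $(1-t)H(D,t)$, where $$H(D,t)=\sum_{[E]\in D/\Gamma',\,E\ne D}\det[tI-\rho_D]\,\mathrm{Ind}_{\Gamma'_E}^{\Gamma'}\frac{G(E,t)}{(t-1)\det[tI-\rho_E]},$$ the sum being over the $\Gamma'$-orbits of faces $E\neq D$ of $D$. The series $\phi_F$ and $\tilde S_\Gamma$. Let $\chi_{F,m}$ be the permutation representation of $\Gamma_F$ on the lattice points of $F\cap mP$, define $\phi_F[t]\in R(\Gamma_F)[[t]]$ by $\sum_{m\ge0}\chi_{F,m}t^m=\phi_F[t]/\det[I-\rho_Ft]$, and define $$\tilde S_\Gamma(C,t)=\sum_{[F]\in C/\Gamma}(-1)^{d+1-\dim F}\,\mathrm{Ind}_{\Gamma_F}^{\Gamma}\bigl(\det(\rho_F)\,\phi_F[t]\,G(F^*,t)\bigr)\in R(\Gamma)[[t]],$$ the sum being over the $\Gamma$-orbits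 of faces of $C$. Lemma. For every $\gamma\in\Gamma$ the power series $\tilde S_\Gamma(C,t)(\gamma)$ of character values is the expansion at $t=0$ of a rational function of $t$, and, as an identity of these rational functions, $$\tilde S_\Gamma(C,t)=t^{d+1}\,\tilde S_\Gamma(C,t^{-1}).$$ -/

import Mathlib

open scoped Pointwise

noncomputable section

namespace EquivariantCone

/-! ## Virtual characters

A virtual representation in the complex representation ring `R(Γ)` is identified with its virtual
character, a function `Γ → ℂ`; thus `R(Γ)` is a subring of `Γ → ℂ` (with pointwise operations), and
`R(Γ)[t]`, `R(Γ)[[t]]` are contained in `Polynomial (Γ → ℂ)`, `PowerSeries (Γ → ℂ)`. -/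

/-- Induction `R(H) → R(Γ)` from a subgroup, on characters (Frobenius' formula). -/
def ind {Γ : Type*} [Group Γ] (H : Subgroup Γ) (f : H → ℂ) : Γ → ℂ :=
  open Classical in
  fun γ => (Nat.card H : ℂ)⁻¹ *
    ∑ᶠ x : Γ, if h : x⁻¹ * γ * x ∈ H then f ⟨x⁻¹ * γ * x, h⟩ else 0

/-- Induction `R(H)[[t]] → R(Γ)[[t]]`, coefficient by coefficient. -/
def indSeries {Γ : Type*} [Group Γ] (H : Subgroup Γ) (f : PowerSeries (H → ℂ)) :
    PowerSeries (Γ → ℂ) :=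
  PowerSeries.mk fun n => ind H (PowerSeries.coeff n f)

/-- The `k`-th exterior power of a representation. -/
def extPow {Γ W : Type*} [Group Γ] [AddCommGroup W] [Module ℝ W]
    (σ : Representation ℝ Γ W) (k : ℕ) : Representation ℝ Γ (⋀[ℝ]^k W) where
  toFun γ := exteriorPower.map k (σ γ)
  map_one' := by
    rw [map_one]
    exact exteriorPower.map_id
  map_mul' a b := by
    rw [map_mul]
    exact exteriorPower.map_comp (σ b) (σ a)

/-- The character of the (complexified) `k`-th exterior power of a real representation. -/
def wedgeChar {Γ W : Type*} [Group Γ] [AddCommGroup W] [Module ℝ W]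
    (σ : Representation ℝ Γ W) (k : ℕ) : Γ → ℂ :=
  fun γ => (((extPow σ k).character γ : ℝ) : ℂ)

/-- The determinant character of a real representation. -/
def detChar {Γ W : Type*} [Group Γ] [AddCommGroup W] [Module ℝ W]
    (σ : Representation ℝ Γ W) : Γ → ℂ :=
  fun γ => ((LinearMap.det (σ γ) : ℝ) : ℂ)

/-- `det[tI - σ] = ∑ i, (-1)^(n - i) (⋀^(n - i) σ) t^i` with `n = dim σ`. -/
def detT {Γ W : Type*} [Group Γ] [AddCommGroup W] [Module ℝ W]
    (σ : Representation ℝ Γ W) : Polynomial (Γ → ℂ) :=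
  ∑ i ∈ Finset.range (Module.finrank ℝ W + 1),
    Polynomial.C ((-1) ^ (Module.finrank ℝ W - i) * wedgeChar σ (Module.finrank ℝ W - i)) *
      Polynomial.X ^ i

/-- `det[I - σ t] = ∑ i, (-1)^i (⋀^i σ) t^i`. -/
def detI {Γ W : Type*} [Group Γ] [AddCommGroup W] [Module ℝ W]
    (σ : Representation ℝ Γ W) : Polynomial (Γ → ℂ) :=
  ∑ i ∈ Finset.range (Module.finrank ℝ W + 1),
    Polynomial.C ((-1) ^ i * wedgeChar σ i) * Polynomial.X ^ i

/-! ## Cones with a group action -/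

/-- The linear span of a cone. -/
abbrev linSpan {V : Type*} [AddCommGroup V] [Module ℝ V] (C : PointedCone ℝ V) : Submodule ℝ V :=
  Submodule.span ℝ (C : Set V)

/-- The dimension of a cone. -/
def dim {V : Type*} [AddCommGroup V] [Module ℝ V] (C : PointedCone ℝ V) : ℕ :=
  Module.finrank ℝ (linSpan C)

/-- A set is invariant under a (group) representation. -/
def IsInvariant {Γ V : Type*} [Group Γ] [AddCommGroup V] [Module ℝ V]
    (ρ : Representation ℝ Γ V) (S : Set V) : Prop :=
  ∀ γ : Γ, ∀ x ∈ S, ρ γ x ∈ S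

/-- The representation `ρ_C` of `Γ` on the linear span of a `Γ`-invariant cone `C`. -/
def spanRep {Γ V : Type*} [Group Γ] [AddCommGroup V] [Module ℝ V]
    (ρ : Representation ℝ Γ V) (C : PointedCone ℝ V) (hC : IsInvariant ρ C) :
    Representation ℝ Γ (linSpan C) :=
  ρ.subrepresentation (linSpan C) fun γ =>
    Submodule.span_le.2 fun x hx => Submodule.subset_span (hC γ x hx)

/-- The stabilizer `Γ_F` of a cone `F`. -/
def stab {Γ V : Type*} [Group Γ] [AddCommGroup V] [Module ℝ V]
    (ρ : Representation ℝ Γ V) (F : PointedCone ℝ V) : Subgroup Γ where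
  carrier := {γ | F.map (ρ γ) = F}
  one_mem' := by
    rw [Set.mem_ofPred_eq, map_one]
    exact PointedCone.map_id F
  mul_mem' {a b} ha hb := by
    rw [Set.mem_ofPred_eq] at *
    rw [map_mul, Module.End.mul_eq_comp, ← PointedCone.map_map, hb, ha]
  inv_mem' {a} ha := by
    rw [Set.mem_ofPred_eq] at *
    conv_lhs => rw [← ha]
    rw [PointedCone.map_map, ← Module.End.mul_eq_comp, ← map_mul, inv_mul_cancel, map_one]
    exact PointedCone.map_id F

/-- The restriction of a representation to the stabilizer of `F`. -/
abbrev stabRep {Γ V : Type*} [Group Γ] [AddCommGroup V] [Module ℝ V]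
    (ρ : Representation ℝ Γ V) (F : PointedCone ℝ V) : Representation ℝ (stab ρ F) V :=
  ρ.comp (stab ρ F).subtype

theorem stab_invariant {Γ V : Type*} [Group Γ] [AddCommGroup V] [Module ℝ V]
    (ρ : Representation ℝ Γ V) (F : PointedCone ℝ V) : IsInvariant (stabRep ρ F) F := by
  intro γ x hx
  have h : F.map (ρ γ) = F := γ.2
  have hx' : ρ γ x ∈ F.map (ρ γ) := PointedCone.mem_map.2 ⟨x, hx, rfl⟩
  rw [h] at hx'
  exact hx'

/-- The representation `ρ_F` of `Γ_F` on the linear span of `F`. -/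
abbrev faceRep {Γ V : Type*} [Group Γ] [AddCommGroup V] [Module ℝ V]
    (ρ : Representation ℝ Γ V) (F : PointedCone ℝ V) : Representation ℝ (stab ρ F) (linSpan F) :=
  spanRep (stabRep ρ F) F (stab_invariant ρ F)

/-- The relation of lying in the same `Γ`-orbit, on a family of cones. -/
def orbitSetoid {Γ V : Type*} [Group Γ] [AddCommGroup V] [Module ℝ V]
    (ρ : Representation ℝ Γ V) (S : Set (PointedCone ℝ V)) : Setoid S where
  r F F' := ∃ γ : Γ, (F : PointedCone ℝ V).map (ρ γ) = F'
  iseqv :=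
    { refl := fun F => ⟨1, by rw [map_one]; exact PointedCone.map_id _⟩
      symm := by
        rintro F F' ⟨γ, h⟩
        refine ⟨γ⁻¹, ?_⟩
        rw [← h, PointedCone.map_map, ← Module.End.mul_eq_comp, ← map_mul, inv_mul_cancel, map_one]
        exact PointedCone.map_id _
      trans := by
        rintro F F' F'' ⟨γ, h⟩ ⟨γ', h'⟩
        refine ⟨γ' * γ, ?_⟩
        rw [map_mul, Module.End.mul_eq_comp, ← PointedCone.map_map, h, h'] }

/-- The sum of `f F` over the `Γ`-orbits `[F]` of a (finite) family of cones, with one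
representative `F` for each orbit. -/
def orbitSum {Γ V A : Type*} [Group Γ] [AddCommGroup V] [Module ℝ V] [AddCommMonoid A]
    (ρ : Representation ℝ Γ V) (S : Set (PointedCone ℝ V)) (f : S → A) : A :=
  ∑ᶠ q : Quotient (orbitSetoid ρ S), f q.out

theorem exists_sub_of_mem_linSpan {V : Type*} [AddCommGroup V] [Module ℝ V]
    (F : PointedCone ℝ V) {x : V} (hx : x ∈ linSpan F) : ∃ a ∈ F, ∃ b ∈ F, x = a - b := by
  induction hx using Submodule.span_induction with
  | mem x h => exact ⟨x, h, 0, F.zero_mem, by simp⟩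
  | zero => exact ⟨0, F.zero_mem, 0, F.zero_mem, by simp⟩
  | add x y _ _ hx hy =>
    obtain ⟨a, ha, b, hb, rfl⟩ := hx
    obtain ⟨a', ha', b', hb', rfl⟩ := hy
    exact ⟨a + a', F.add_mem ha ha', b + b', F.add_mem hb hb', by abel⟩
  | smul r x _ hx =>
    obtain ⟨a, ha, b, hb, rfl⟩ := hx
    rcases le_total 0 r with hr | hr
    · exact ⟨r • a, PointedCone.smul_mem F hr ha, r • b, PointedCone.smul_mem F hr hb,
        smul_sub r a b⟩
    · refine ⟨(-r) • b, PointedCone.smul_mem F (neg_nonneg.2 hr) hb, (-r) • a,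
        PointedCone.smul_mem F (neg_nonneg.2 hr) ha, ?_⟩
      module

/-- A proper face has smaller dimension. -/
theorem dim_lt_of_isFaceOf {V : Type*} [AddCommGroup V] [Module ℝ V] [FiniteDimensional ℝ V]
    {F C : PointedCone ℝ V} (h : F.IsFaceOf C) (hne : F ≠ C) : dim F < dim C := by
  apply Submodule.finrank_lt_finrank_of_lt
  refine lt_of_le_of_ne (Submodule.span_mono h.le) fun heq => hne ?_
  refine le_antisymm h.le fun x hx => ?_
  have hx' : x ∈ linSpan F := by
    rw [heq]
    exact Submodule.subset_span hx
  obtain ⟨a, ha, b, hb, rfl⟩ := exists_sub_of_mem_linSpan F hx'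
  exact h.mem_of_add_mem_left hx (h.le hb) (by simpa using ha)

/-! ## The polynomial `G(C, t)` -/

/-- The proper faces of a cone. -/
abbrev properFaces {V : Type*} [AddCommGroup V] [Module ℝ V] (C : PointedCone ℝ V) :
    Set (PointedCone ℝ V) :=
  {F | F.IsFaceOf C ∧ F ≠ C}

/-- The formula for `H(C, t)`, `C ≠ 0`, in terms of the polynomials `g F = G(F, t)` of the proper
faces `F` of `C`:
`∑ [F], det[tI - ρ_C] Ind_{Γ_F}^Γ (G(F, t) / ((t - 1) det[tI - ρ_F]))`.
The divisor is a unit in the ring of power series, since its constant coefficient is a unit. -/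
def hSum {Γ V : Type*} [Group Γ] [AddCommGroup V] [Module ℝ V]
    (ρ : Representation ℝ Γ V) (C : PointedCone ℝ V) (hC : IsInvariant ρ C)
    (g : ∀ F : properFaces C, Polynomial (stab ρ F.1 → ℂ)) : PowerSeries (Γ → ℂ) :=
  orbitSum ρ (properFaces C) fun F =>
    (detT (spanRep ρ C hC) : PowerSeries (Γ → ℂ)) *
      indSeries (stab ρ F.1)
        ((g F : PowerSeries (stab ρ F.1 → ℂ)) *
          Ring.inverse ((PowerSeries.X - 1) * (detT (faceRep ρ F.1) : PowerSeries _)))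

open Classical in
/-- The polynomial `G(C, t)` of virtual representations of `Γ`, for a `Γ`-invariant cone `C`
(regarded as a full-dimensional cone in its linear span). For `C ≠ 0` it is the truncation of
`(1 - t) H(C, t)` to the terms `t^i` with `i ≤ (dim C - 1) / 2`, that is, `i < (dim C + 1) / 2` with
the quotient rounded down. -/
def gPoly {Γ V : Type*} [Group Γ] [AddCommGroup V] [Module ℝ V] [FiniteDimensional ℝ V]
    (ρ : Representation ℝ Γ V) (C : PointedCone ℝ V) (hC : IsInvariant ρ C) :
    Polynomial (Γ → ℂ) :=
  if C = ⊥ then 1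
  else
    PowerSeries.trunc ((dim C + 1) / 2)
      ((1 - PowerSeries.X) *
        hSum ρ C hC fun F => gPoly (stabRep ρ F.1) F.1 (stab_invariant ρ F.1))
termination_by dim C
decreasing_by exact dim_lt_of_isFaceOf F.2.1 F.2.2

/-! ## Dual faces -/

/-- The face `F^*` of the dual cone of `C` that corresponds to the face `F` of `C`: the linear forms
that are nonnegative on `C` and zero on `F`. -/
def dualFace {V : Type*} [AddCommGroup V] [Module ℝ V] (C F : PointedCone ℝ V) :
    PointedCone ℝ (Module.Dual ℝ V) :=
  PointedCone.dual (Module.Dual.eval ℝ V) (C : Set V) ⊓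
    PointedCone.ofSubmodule (linSpan F).dualAnnihilator

/-- The contragredient representation of `Γ_F` on the dual space. -/
abbrev dualStabRep {Γ V : Type*} [Group Γ] [AddCommGroup V] [Module ℝ V]
    (ρ : Representation ℝ Γ V) (F : PointedCone ℝ V) :
    Representation ℝ (stab ρ F) (Module.Dual ℝ V) :=
  (stabRep ρ F).dual

theorem dualFace_invariant {Γ V : Type*} [Group Γ] [AddCommGroup V] [Module ℝ V]
    (ρ : Representation ℝ Γ V) (C : PointedCone ℝ V) (hC : IsInvariant ρ C)
    (F : PointedCone ℝ V) : IsInvariant (dualStabRep ρ F) (dualFace C F) := by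
  rintro γ u ⟨hu, hu'⟩
  refine ⟨fun x hx => hu (hC _ x hx), ?_⟩
  refine (Submodule.mem_dualAnnihilator _).2 fun x hx => ?_
  refine (Submodule.mem_dualAnnihilator _).1 hu' (ρ (γ⁻¹ : stab ρ F) x) ?_
  exact (spanRep (stabRep ρ F) F (stab_invariant ρ F) γ⁻¹ ⟨x, hx⟩).2

/-! ## Lattice polytopes -/

/-- The inclusion of `ℤ^n` in `ℝ^n`. -/
def intVec {n : ℕ} (z : Fin n → ℤ) : Fin n → ℝ := fun i => (z i : ℝ)

/-- A lattice polytope: the convex hull of finitely many lattice points. -/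
def IsLatticePolytope {n : ℕ} (P : Set (Fin n → ℝ)) : Prop :=
  ∃ S : Finset (Fin n → ℤ), P = convexHull ℝ (intVec '' (S : Set (Fin n → ℤ)))

/-- The real representation of an integral representation. -/
def realRep {Γ : Type*} [Group Γ] {n : ℕ} (ρ : Γ →* Matrix.GeneralLinearGroup (Fin n) ℤ) :
    Representation ℝ Γ (Fin n → ℝ) where
  toFun γ := Matrix.toLin' ((ρ γ : Matrix (Fin n) (Fin n) ℤ).map (Int.cast : ℤ → ℝ))
  map_one' := by
    rw [map_one, Units.val_one, Matrix.map_one _ Int.cast_zero Int.cast_one]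
    exact Matrix.toLin'_one
  map_mul' a b := by
    rw [map_mul, Units.val_mul]
    rw [Module.End.mul_eq_comp, ← Matrix.toLin'_mul]
    congr 1
    exact Matrix.map_mul (f := Int.castRingHom ℝ)

theorem realRep_intVec {Γ : Type*} [Group Γ] {n : ℕ}
    (ρ : Γ →* Matrix.GeneralLinearGroup (Fin n) ℤ) (γ : Γ) (z : Fin n → ℤ) :
    realRep ρ γ (intVec z) = intVec (Matrix.mulVec (ρ γ : Matrix (Fin n) (Fin n) ℤ) z) := by
  ext i
  simp [realRep, intVec, Matrix.toLin'_apply, Matrix.mulVec, dotProduct]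

/-- The cone over `P`. -/
abbrev coneOver {V : Type*} [AddCommGroup V] [Module ℝ V] (P : Set V) : PointedCone ℝ V :=
  PointedCone.hull ℝ P

theorem coneOver_invariant {Γ V : Type*} [Group Γ] [AddCommGroup V] [Module ℝ V]
    (ρ : Representation ℝ Γ V) (P : Set V) (hP : IsInvariant ρ P) :
    IsInvariant ρ (coneOver P) := by
  intro γ x hx
  have h : coneOver P ≤ (coneOver P).comap (ρ γ) :=
    Submodule.span_le.2 fun y hy => Submodule.subset_span (hP γ y hy)
  exact h hx

/-- The lattice points in `F ∩ mP`. -/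
def latticePts {n : ℕ} (P : Set (Fin n → ℝ)) (F : PointedCone ℝ (Fin n → ℝ)) (m : ℕ) :
    Set (Fin n → ℝ) :=
  {x | x ∈ F ∧ x ∈ (m : ℝ) • P ∧ ∃ z : Fin n → ℤ, x = intVec z}

theorem latticePts_invariant {Γ : Type*} [Group Γ] {n : ℕ}
    (ρ : Γ →* Matrix.GeneralLinearGroup (Fin n) ℤ) (P : Set (Fin n → ℝ))
    (hP : IsInvariant (realRep ρ) P) (F : PointedCone ℝ (Fin n → ℝ)) (m : ℕ) :
    IsInvariant (stabRep (realRep ρ) F) (latticePts P F m) := by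
  rintro γ x ⟨hF, ⟨y, hy, hxy⟩, z, hz⟩
  refine ⟨stab_invariant (realRep ρ) F γ x hF, ⟨realRep ρ γ y, hP γ y hy, ?_⟩, ?_⟩
  · rw [← hxy]
    exact (map_smul (realRep ρ γ) (m : ℝ) y).symm
  · exact ⟨_, by rw [hz]; exact realRep_intVec ρ γ z⟩

/-- The action of `Γ` on an invariant set. -/
@[reducible]
def actionOn {Γ V : Type*} [Group Γ] [AddCommGroup V] [Module ℝ V]
    (ρ : Representation ℝ Γ V) (S : Set V) (hS : IsInvariant ρ S) : MulAction Γ S where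
  smul γ x := ⟨ρ γ x, hS γ x x.2⟩
  one_smul x := Subtype.ext (show ρ 1 (x : V) = x by rw [map_one]; rfl)
  mul_smul a b x := Subtype.ext (show ρ (a * b) (x : V) = ρ a (ρ b x) by rw [map_mul]; rfl)

/-- The character of the permutation representation of `Γ` on an invariant (finite) set. -/
def permChar {Γ V : Type*} [Group Γ] [AddCommGroup V] [Module ℝ V]
    (ρ : Representation ℝ Γ V) (S : Set V) (hS : IsInvariant ρ S) : Γ → ℂ :=
  letI := actionOn ρ S hS
  (Representation.ofMulAction ℂ Γ S).character

/-- `φ_F[t] ∈ R(Γ_F)[[t]]`, the power series with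
`∑ m, χ_{F,m} t^m = φ_F[t] / det[I - ρ_F t]`, where `χ_{F,m}` is the permutation representation of
`Γ_F` on the lattice points in `F ∩ mP`. -/
def phi {Γ : Type*} [Group Γ] {n : ℕ}
    (ρ : Γ →* Matrix.GeneralLinearGroup (Fin n) ℤ) (P : Set (Fin n → ℝ))
    (hP : IsInvariant (realRep ρ) P) (F : PointedCone ℝ (Fin n → ℝ)) :
    PowerSeries (stab (realRep ρ) F → ℂ) :=
  (PowerSeries.mk fun m =>
      permChar (stabRep (realRep ρ) F) (latticePts P F m) (latticePts_invariant ρ P hP F m)) *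
    (detI (faceRep (realRep ρ) F) : PowerSeries (stab (realRep ρ) F → ℂ))

/-- The equivariant `S̃`-series of the cone `C` over a `Γ`-invariant lattice polytope `P` in `ℝ^n`:
`∑ [F], (-1)^(n - dim F) Ind_{Γ_F}^Γ (det ρ_F · φ_F[t] · G(F^*, t))`, over the `Γ`-orbits of
(all) faces `F` of `C`. -/
def sTilde {Γ : Type*} [Group Γ] {n : ℕ}
    (ρ : Γ →* Matrix.GeneralLinearGroup (Fin n) ℤ) (P : Set (Fin n → ℝ))
    (hP : IsInvariant (realRep ρ) P) : PowerSeries (Γ → ℂ) :=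
  orbitSum (realRep ρ) {F | F.IsFaceOf (coneOver P)} fun F =>
    (-1) ^ (n - dim F.1) *
      indSeries (stab (realRep ρ) F.1)
        (PowerSeries.C (detChar (faceRep (realRep ρ) F.1)) * phi ρ P hP F.1 *
          (gPoly (dualStabRep (realRep ρ) F.1) (dualFace (coneOver P) F.1)
            (dualFace_invariant (realRep ρ) (coneOver P)
              (coneOver_invariant (realRep ρ) P hP) F.1) : PowerSeries _))

/-- Evaluation of (the characters of) the coefficients of a power series at `γ`. -/
def evalAt {Γ : Type*} (γ : Γ) : PowerSeries (Γ → ℂ) →+* PowerSeries ℂ :=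
  PowerSeries.map (Pi.evalRingHom (fun _ : Γ => ℂ) γ)

/-- The substitution `t ↦ t⁻¹` in a rational function. -/
def invertVar (f : RatFunc ℂ) : RatFunc ℂ :=
  RatFunc.eval RatFunc.C (RatFunc.X)⁻¹ f

/-- The power series `s` is the expansion at `t = 0` of the rational function `f`, that is,
`s = p / q` for the reduced fraction `f = p / q`. -/
def IsExpansionOf (s : PowerSeries ℂ) (f : RatFunc ℂ) : Prop :=
  s * (f.denom : PowerSeries ℂ) = (f.num : PowerSeries ℂ)

end EquivariantCone

end

/-! The identity is checked at one group element `γ` at a time. Put `n = d + 1` and let `g` be the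
action of `γ` on `ℝ^n`. For a face `F` of `C` with `g F = F`, let `p_F` be the characteristic
polynomial of `g` on the span of `F`, let `s_F` be `-1` to the dimension of the space of `g`-fixed
vectors in that span, let `E_F(t)` count the `g`-fixed lattice points of `F` by height, and let
`G_F(t)` be the value at `γ` of `G(F^*, t)`.

Frobenius' formula turns a sum of induced characters over orbits of faces into a sum over the faces
fixed by `g` (`evalAt_orbitSum`). Since `g` has finite order, `t^{dim F} p_F(1/t) = s_F p_F(t)` and
`det(g|F) = (-1)^{dim F} s_F`, so the signs collapse and the value of `S̃` at `γ` is `(-1)^n ∑_F E_F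
p_F G_F` (`evalAt_sTilde`). Its symmetry comes from two dualities that point in opposite directions
along the poset of fixed faces:

(1) `E_M(t) = ∑_{F ≤ M} s_F E_F(1/t)` (`toRat_fixCone_eq_sum`). The fixed points of `M` form a
rational cone whose faces are the fixed parts of the fixed faces `F ≤ M`. This cone is the disjoint
union of the relative interiors of its faces, and by reciprocity the interior belonging to `F` has
generating function `s_F E_F(1/t)`.

(2) `p_F(t) t^{n - dim F} G_F(1/t) = ∑_{M ≥ F} p_M(t) G_M(t)` (`facePoly_mul_reflect_gNum`), a
Kazhdan–Lusztig–Stanley duality.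

Replacing `t` by `1/t` in `∑_F E_F p_F G_F`, multiplying by `t^n`, inserting (2) and exchanging the
two sums leaves the right-hand side of (1) as the coefficient of `p_M G_M`
(`exists_expands_invHom_eq`).

Reciprocity for one cone (`cone_reciprocity`) uses no triangulation. A generic cost selects the
optimal bases among the generators, and a generic interior vector `q` decides which facets each
simplicial cone keeps; replacing `q` by `-q` decomposes the interior with the complementary facets.
A half-open simplicial cone is then handled by the point reflection of its fundamental
parallelepiped.

For (2), the value of `G` at `γ` is minus the lower half of a polynomial `R`, and `R` is
antisymmetric under reversal by Euler's relation `∑ s_M = 0` over the fixed faces between two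
distinct fixed faces (`euler_fixed`). Euler's relation is itself the constant term of reciprocity,
applied to the fixed cone modulo the span of a face. -/

noncomputable section

namespace EquivariantCone

/-! ## Characteristic polynomials -/

section CharpolyLemmas

open Polynomial Module

/-- The trace of an exterior power is, up to sign, a coefficient of the characteristic
polynomial. -/
theorem trace_exteriorPower_map {W : Type*} [AddCommGroup W] [Module ℝ W] [FiniteDimensional ℝ W]
    (f : W →ₗ[ℝ] W) (k : ℕ) (hk : k ≤ finrank ℝ W) :
    LinearMap.trace ℝ _ (exteriorPower.map k f) =
      (-1) ^ k * f.charpoly.coeff (finrank ℝ W - k) := by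
  classical
  set b := finBasis ℝ W
  have hm : f.charpoly = (LinearMap.toMatrix b b f).charpoly :=
    (LinearMap.charpoly_toMatrix f b).symm
  have hc := Matrix.charpoly_coeff_eq_sum_minors (LinearMap.toMatrix b b f) k (by simpa using hk)
  rw [Fintype.card_fin] at hc
  have : Fintype (Set.powersetCard (Fin (finrank ℝ W)) k) := Fintype.ofFinite _
  rw [hm, hc, ← mul_assoc, ← mul_pow]
  -- Both sides are now the sum of the principal `k × k` minors: the diagonal entries of the
  -- exterior power in the induced basis are these minors, indexed by `k`-subsets.
  simp only [mul_neg, mul_one, neg_neg, one_pow, one_mul]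
  rw [LinearMap.trace_eq_matrix_trace ℝ (b.exteriorPower k), Matrix.trace]
  simp only [Matrix.diag_apply, LinearMap.toMatrix_apply, exteriorPower.basis_apply]
  simp only [exteriorPower.basis_repr_apply, exteriorPower.map_apply_ιMulti_family]
  refine (Finset.sum_bij (fun (s : Set.powersetCard (Fin (finrank ℝ W)) k) _ => s.1) ?_ ?_ ?_ ?_)
  · intro s _
    simp
  · intro s _ t _ h
    exact Subtype.ext h
  · intro s hs
    exact ⟨⟨s, (Finset.mem_powersetCard.1 hs).2⟩, Finset.mem_univ _, rfl⟩
  · intro s _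
    rw [exteriorPower.ιMulti_family, exteriorPower.ιMultiDual_apply_ιMulti, ← Matrix.det_transpose]
    rw [← Matrix.det_submatrix_equiv_self (s.1.orderIsoOfFin s.2).toEquiv]
    congr 1
    ext i j
    simp only [Matrix.transpose_apply, Matrix.of_apply, Matrix.submatrix_apply,
      LinearMap.toMatrix_apply, Set.powersetCard.ofFinEmbEquiv_symm_apply]
    rfl

/-- In a basis adapted to `W` the operator `t - f` is block triangular, so its determinant factors
for each real `t`, and there are infinitely many such `t`. -/
theorem charpoly_eq_mul {V : Type*} [AddCommGroup V] [Module ℝ V] [FiniteDimensional ℝ V]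
    (W : Submodule ℝ V) (f : V →ₗ[ℝ] V) (hf : W ≤ W.comap f) :
    f.charpoly = (f.restrict hf).charpoly * (W.mapQ W f hf).charpoly := by
  refine Polynomial.funext fun t => ?_
  rw [eval_mul, LinearMap.eval_charpoly, LinearMap.eval_charpoly, LinearMap.eval_charpoly]
  have h : W ≤ W.comap (algebraMap ℝ (Module.End ℝ V) t - f) := fun x hx => by
    simp only [Submodule.mem_comap, LinearMap.sub_apply, Module.algebraMap_end_apply]
    exact W.sub_mem (W.smul_mem _ hx) (hf hx)
  rw [LinearMap.det_eq_det_mul_det W _ h]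
  congr 2
  ext x
  simp

/-- The averaged form `B = ∑ (A^i)ᵀ A^i` satisfies `Aᵀ B A = B`. Hence the inverse of `A` is similar
to `Aᵀ`, which has the same characteristic polynomial as `A`. -/
theorem charpoly_of_mul_eq_one {W : Type*} [AddCommGroup W] [Module ℝ W] [FiniteDimensional ℝ W]
    {f f' : Module.End ℝ W} (h : f * f' = 1) {N : ℕ} (hN : 0 < N) (hf : f ^ N = 1) :
    f'.charpoly = f.charpoly := by
  classical
  set b := finBasis ℝ W
  set A := LinearMap.toMatrix b b f with hA
  set A' := LinearMap.toMatrix b b f' with hA'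
  have hAA' : A * A' = 1 := by
    rw [hA, hA', ← LinearMap.toMatrix_mul, h, LinearMap.toMatrix_one]
  have hAN : A ^ N = 1 := by
    rw [hA, LinearMap.toMatrix_pow, hf, LinearMap.toMatrix_one]
  rw [← LinearMap.charpoly_toMatrix f b, ← LinearMap.charpoly_toMatrix f' b, ← hA, ← hA']
  set B := ∑ i ∈ Finset.range N, (A ^ i).conjTranspose * A ^ i with hB
  have hpos : B.PosDef := by
    obtain ⟨M, rfl⟩ : ∃ M, N = M + 1 := ⟨N - 1, by omega⟩
    -- The term `i = 0` is the identity matrix, which makes the semidefinite sum definite.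
    rw [hB, Finset.sum_range_succ']
    refine Matrix.PosDef.posSemidef_add (Matrix.posSemidef_sum _ fun i _ =>
      Matrix.posSemidef_conjTranspose_mul_self _) ?_
    simpa using Matrix.PosDef.one
  have hinv : A.conjTranspose * B * A = B := by
    have h1 : A.conjTranspose * B * A =
        ∑ i ∈ Finset.range N, (A ^ (i + 1)).conjTranspose * A ^ (i + 1) := by
      rw [hB, Finset.mul_sum, Finset.sum_mul]
      refine Finset.sum_congr rfl fun i _ => ?_
      rw [pow_succ, Matrix.conjTranspose_mul]
      simp only [Matrix.mul_assoc]
    have h2 := Finset.sum_range_succ (fun i => (A ^ i).conjTranspose * A ^ i) N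
    rw [Finset.sum_range_succ', hAN, pow_zero, add_left_inj] at h2
    rw [h1, h2]
  obtain ⟨U, hU⟩ := hpos.isUnit
  have hBA : B * A' = A.conjTranspose * B := by
    conv_lhs => rw [← hinv]
    rw [Matrix.mul_assoc, hAA', Matrix.mul_one]
  have hconj : A.conjTranspose = U.val * A' * U⁻¹.val := by
    rw [hU, hBA, ← hU, Matrix.mul_assoc, Units.mul_inv, Matrix.mul_one]
  have := Matrix.charpoly_units_conj U A'
  rw [← Matrix.coe_units_inv] at this
  rw [← this, ← hconj, Matrix.conjTranspose_eq_transpose_of_trivial, Matrix.charpoly_transpose]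

/-- Up to the factor `(-1)^n det f`, the reversed characteristic polynomial of `f` is the
characteristic polynomial of `f⁻¹ = f^(N-1)`, which equals that of `f` by `charpoly_of_mul_eq_one`.
-/
theorem charpoly_reflect_eq_det {W : Type*} [AddCommGroup W] [Module ℝ W] [FiniteDimensional ℝ W]
    {f : Module.End ℝ W} {N : ℕ} (hN : 0 < N) (hf : f ^ N = 1) :
    f.charpoly.reflect (finrank ℝ W) =
      C ((-1) ^ finrank ℝ W * LinearMap.det f) * f.charpoly := by
  classical
  set b := finBasis ℝ W
  have hff' : f * f ^ (N - 1) = 1 := by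
    rw [← pow_succ', Nat.sub_add_cancel hN, hf]
  have hdet : LinearMap.det f ≠ 0 := by
    intro h
    have := congrArg LinearMap.det hff'
    simp [h] at this
  have hff'' : f ^ (N - 1) * f = 1 := by
    rw [← pow_succ, Nat.sub_add_cancel hN, hf]
  have h1 := charpoly_of_mul_eq_one hff' hN hf
  rw [← LinearMap.charpoly_toMatrix f b, ← LinearMap.charpoly_toMatrix _ b] at h1
  have hA' : LinearMap.toMatrix b b (f ^ (N - 1)) = (LinearMap.toMatrix b b f)⁻¹ := by
    symm
    apply Matrix.inv_eq_right_inv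
    rw [← LinearMap.toMatrix_mul, hff', LinearMap.toMatrix_one]
  have hu : IsUnit (LinearMap.toMatrix b b f) := by
    rw [Matrix.isUnit_iff_isUnit_det, LinearMap.det_toMatrix]
    exact hdet.isUnit
  rw [hA', Matrix.charpoly_inv _ hu, LinearMap.det_toMatrix] at h1
  have hrev : f.charpoly.reflect (finrank ℝ W) = (LinearMap.toMatrix b b f).charpolyRev := by
    rw [← Matrix.reverse_charpoly, LinearMap.charpoly_toMatrix, Polynomial.reverse,
      LinearMap.charpoly_natDegree]
  rw [hrev, ← LinearMap.charpoly_toMatrix f b, ← h1]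
  simp only [Fintype.card_fin, Ring.inverse_eq_inv']
  rw [map_mul, map_pow, map_neg, map_one]
  have h2 : (C (LinearMap.det f) : ℝ[X]) * C (LinearMap.det f)⁻¹ = 1 := by
    rw [← map_mul, mul_inv_cancel₀ hdet, map_one]
  calc _ = ((-1 : ℝ[X]) ^ finrank ℝ W * (-1) ^ finrank ℝ W) *
        ((C (LinearMap.det f) : ℝ[X]) * C (LinearMap.det f)⁻¹) *
        (LinearMap.toMatrix b b f).charpolyRev := by
        rw [h2, ← mul_pow]; simp
    _ = _ := by ring

/-- For a real operator of finite order, `(-1)^n det f = (-1)^{dim ker (f - 1)}`. -/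
theorem neg_one_pow_mul_det {W : Type*} [AddCommGroup W] [Module ℝ W] [FiniteDimensional ℝ W]
    {f : Module.End ℝ W} {N : ℕ} (hN : 0 < N) (hf : f ^ N = 1) :
    (-1) ^ finrank ℝ W * LinearMap.det f = (-1) ^ finrank ℝ (LinearMap.ker (f - 1)) := by
  set U := LinearMap.ker (f - 1) with hU
  have hmem : ∀ x, x ∈ U ↔ f x = x := fun x => by
    rw [hU, LinearMap.mem_ker, LinearMap.sub_apply, sub_eq_zero]; rfl
  have hUf : U ≤ U.comap f := fun x hx => by
    rw [Submodule.mem_comap, (hmem x).1 hx]; exact hx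
  have h1 : f.restrict hUf = LinearMap.id := by
    ext x
    simpa using (hmem x).1 x.2
  set q := U.mapQ U f hUf with hq
  have hqN : q ^ N = 1 := by
    have : ∀ k, ∀ x : W, (q ^ k) (U.mkQ x) = U.mkQ ((f ^ k) x) := by
      intro k
      induction k with
      | zero => intro x; rfl
      | succ k ih =>
        intro x
        rw [pow_succ, pow_succ, Module.End.mul_apply, Module.End.mul_apply, ← ih]
        rfl
    refine LinearMap.ext fun y => ?_
    obtain ⟨x, rfl⟩ := U.mkQ_surjective y
    rw [this, hf]; rfl
  -- The quotient by the fixed space has no fixed vectors: otherwise `f^k x = x + k (f x - x)` with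
  -- `f x - x` fixed, and `f^N = 1` forces `f x = x`.
  have hker : ∀ y, q y = y → y = 0 := by
    intro y hy
    obtain ⟨x, rfl⟩ := U.mkQ_surjective y
    have h2 : f x - x ∈ U := by
      rw [← Submodule.ker_mkQ U, LinearMap.mem_ker, map_sub, sub_eq_zero]
      exact hy
    have h3 : ∀ k : ℕ, (f ^ k) x = x + (k : ℝ) • (f x - x) := by
      intro k
      induction k with
      | zero => simp
      | succ k ih =>
        rw [pow_succ', Module.End.mul_apply, ih, map_add, map_smul, (hmem _).1 h2]
        push_cast
        module
    have h4 := h3 N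
    rw [hf, Module.End.one_apply] at h4
    have h5 : (N : ℝ) • (f x - x) = 0 := by simpa using h4
    rw [smul_eq_zero] at h5
    rcases h5 with h5 | h5
    · exact absurd h5 (by positivity)
    · rw [← LinearMap.mem_ker, Submodule.ker_mkQ, hmem]
      exact sub_eq_zero.1 h5
  have h6 := charpoly_reflect_eq_det hN hqN
  have h7 : q.charpoly.eval 1 ≠ 0 := by
    rw [LinearMap.eval_charpoly]
    intro h0
    have := LinearMap.bot_lt_ker_of_det_eq_zero h0
    obtain ⟨y, hy, hy0⟩ := (Submodule.ne_bot_iff _).1 this.ne'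
    refine hy0 (hker y ?_)
    rw [LinearMap.mem_ker] at hy
    rw [map_one, LinearMap.sub_apply, sub_eq_zero] at hy
    exact hy.symm
  -- Reversal does not change the value at `t = 1`, and this value is nonzero on the quotient, so
  -- the factor in the functional equation of `q` is `1`.
  have h8 := congrArg (eval (1 : ℝ)) h6
  rw [eval_mul, eval_C] at h8
  have h9 : (q.charpoly.reflect (finrank ℝ (W ⧸ U))).eval 1 = q.charpoly.eval 1 := by
    let _ : Invertible (1 : ℝ) := invertibleOne
    have := eval₂_reflect_mul_pow (RingHom.id ℝ) (1 : ℝ) (finrank ℝ (W ⧸ U)) q.charpoly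
      (LinearMap.charpoly_natDegree q).le
    simpa using this
  rw [h9] at h8
  have h10 : (-1) ^ finrank ℝ (W ⧸ U) * LinearMap.det q = 1 := by
    have := mul_right_cancel₀ h7 ((one_mul _).trans h8)
    exact this.symm
  rw [LinearMap.det_eq_det_mul_det U f hUf, h1, LinearMap.det_id, one_mul, ← hq,
    ← Submodule.finrank_quotient_add_finrank U, pow_add]
  linear_combination (-1) ^ finrank ℝ U * h10

end CharpolyLemmas

/-! ### Characteristic polynomials on invariant subspaces and their functional equation -/

section FacePoly

open Polynomial Module

variable {V : Type*} [AddCommGroup V] [Module ℝ V] [FiniteDimensional ℝ V]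

open Classical in
/-- The characteristic polynomial of `g` on an invariant subspace. -/
def facePoly (g : Module.End ℝ V) (W : Submodule ℝ V) : ℂ[X] :=
  -- The default `1` keeps the polynomial monic for every subspace, so division by it needs no
  -- invariance hypothesis.
  if h : W ≤ W.comap g then (g.restrict h).charpoly.map (algebraMap ℝ ℂ) else 1

theorem facePoly_eq {g : Module.End ℝ V} {W : Submodule ℝ V} (h : W ≤ W.comap g) :
    facePoly g W = (g.restrict h).charpoly.map (algebraMap ℝ ℂ) :=
  dif_pos h

theorem facePoly_monic (g : Module.End ℝ V) (W : Submodule ℝ V) : (facePoly g W).Monic := by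
  unfold facePoly
  split_ifs
  · exact (LinearMap.charpoly_monic _).map _
  · exact monic_one

theorem natDegree_facePoly {g : Module.End ℝ V} {W : Submodule ℝ V} (h : W ≤ W.comap g) :
    (facePoly g W).natDegree = finrank ℝ W := by
  rw [facePoly_eq h, (LinearMap.charpoly_monic _).natDegree_map, LinearMap.charpoly_natDegree]

theorem charpoly_restrict_dvd {g : Module.End ℝ V} {W U : Submodule ℝ V} (hW : W ≤ W.comap g)
    (hU : U ≤ U.comap g) (hWU : W ≤ U) :
    (g.restrict hW).charpoly ∣ (g.restrict hU).charpoly := by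
  set W' : Submodule ℝ U := W.comap U.subtype with hW'
  have h' : W' ≤ W'.comap (g.restrict hU) := fun x hx => hW hx
  rw [charpoly_eq_mul W' (g.restrict hU) h']
  have : (g.restrict hW) = (Submodule.comapSubtypeEquivOfLe hWU).conj
      ((g.restrict hU).restrict h') := by
    ext x
    rfl
  rw [this, LinearEquiv.charpoly_conj]
  exact Dvd.intro _ rfl

theorem facePoly_dvd {g : Module.End ℝ V} {W U : Submodule ℝ V} (hW : W ≤ W.comap g)
    (hU : U ≤ U.comap g) (hWU : W ≤ U) : facePoly g W ∣ facePoly g U := by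
  rw [facePoly_eq hW, facePoly_eq hU]
  exact Polynomial.map_dvd _ (charpoly_restrict_dvd hW hU hWU)

omit [FiniteDimensional ℝ V] in
theorem restrict_pow_eq_one {g : Module.End ℝ V} {W : Submodule ℝ V} (hW : W ≤ W.comap g)
    {N : ℕ} (hg : g ^ N = 1) : (g.restrict hW) ^ N = 1 := by
  rw [Module.End.pow_restrict]
  ext x
  simp [hg]

omit [FiniteDimensional ℝ V] in
theorem finrank_ker_restrict_sub_one {g : Module.End ℝ V} {W : Submodule ℝ V}
    (hW : W ≤ W.comap g) : finrank ℝ (LinearMap.ker (g.restrict hW - 1)) =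
      finrank ℝ (W ⊓ LinearMap.ker (g - 1) : Submodule ℝ V) := by
  have : (LinearMap.ker (g.restrict hW - 1)).map W.subtype = W ⊓ LinearMap.ker (g - 1) := by
    ext x
    simp only [Submodule.mem_map, LinearMap.mem_ker, LinearMap.sub_apply, sub_eq_zero,
      Module.End.one_apply, Submodule.mem_inf, Submodule.subtype_apply]
    constructor
    · rintro ⟨y, hy, rfl⟩
      exact ⟨y.2, congrArg Subtype.val hy⟩
    · rintro ⟨hx, hgx⟩
      exact ⟨⟨x, hx⟩, Subtype.ext hgx, rfl⟩
  rw [← this]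
  exact (LinearEquiv.finrank_eq (Submodule.equivMapOfInjective _ W.subtype_injective _))

/-- The sign `(-1)^{dim W^g}`. -/
def fixSign (g : Module.End ℝ V) (W : Submodule ℝ V) : ℂ :=
  (-1) ^ finrank ℝ (W ⊓ LinearMap.ker (g - 1) : Submodule ℝ V)

omit [FiniteDimensional ℝ V] in
theorem fixSign_mul_self (g : Module.End ℝ V) (W : Submodule ℝ V) :
    fixSign g W * fixSign g W = 1 := by
  rw [fixSign, ← mul_pow]
  simp

omit [FiniteDimensional ℝ V] in
theorem fixSign_ne_zero (g : Module.End ℝ V) (W : Submodule ℝ V) : fixSign g W ≠ 0 :=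
  left_ne_zero_of_mul_eq_one (fixSign_mul_self g W)

theorem fixSign_eq {g : Module.End ℝ V} {W : Submodule ℝ V} (hW : W ≤ W.comap g) {N : ℕ}
    (hN : 0 < N) (hg : g ^ N = 1) :
    fixSign g W = (-1) ^ finrank ℝ W * ((LinearMap.det (g.restrict hW) : ℝ) : ℂ) := by
  have := neg_one_pow_mul_det hN (restrict_pow_eq_one hW hg)
  rw [finrank_ker_restrict_sub_one] at this
  rw [fixSign]
  exact_mod_cast this.symm

theorem reflect_map {R S : Type*} [Semiring R] [Semiring S] (f : R →+* S) (n : ℕ) (p : R[X]) :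
    (p.map f).reflect n = (p.reflect n).map f := by
  ext i
  simp [coeff_reflect, coeff_map]

theorem reflect_facePoly {g : Module.End ℝ V} {W : Submodule ℝ V} (hW : W ≤ W.comap g) {N : ℕ}
    (hN : 0 < N) (hg : g ^ N = 1) :
    (facePoly g W).reflect (finrank ℝ W) = C (fixSign g W) * facePoly g W := by
  rw [facePoly_eq hW, reflect_map, charpoly_reflect_eq_det hN (restrict_pow_eq_one hW hg),
    fixSign_eq hW hN hg, Polynomial.map_mul, Polynomial.map_C]
  simp

theorem charpoly_dualMap {W : Type*} [AddCommGroup W] [Module ℝ W] [FiniteDimensional ℝ W]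
    (f : W →ₗ[ℝ] W) : f.dualMap.charpoly = f.charpoly := by
  classical
  set b := finBasis ℝ W
  rw [← LinearMap.charpoly_toMatrix f b, ← LinearMap.charpoly_toMatrix f.dualMap b.dualBasis,
    LinearMap.dualMap_def, LinearMap.toMatrix_transpose, Matrix.charpoly_transpose]

/-- The map `g` is injective, so `g W ⊆ W` is an equality by dimension, and the inverse of `g`
preserves `W` as well. -/
theorem le_comap_of_mul_eq_one {g g' : Module.End ℝ V} {W : Submodule ℝ V}
    (hW : W ≤ W.comap g) (h : g * g' = 1) : W ≤ W.comap g' := by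
  have hinj : Function.Injective g := by
    have : Function.Surjective g := fun x => ⟨g' x, LinearMap.congr_fun h x⟩
    exact LinearMap.injective_iff_surjective.2 this
  have hmap : W.map g = W :=
    Submodule.eq_of_le_of_finrank_eq (Submodule.map_le_iff_le_comap.2 hW)
      (LinearEquiv.finrank_eq (Submodule.equivMapOfInjective g hinj W)).symm
  intro x hx
  rw [← hmap] at hx
  obtain ⟨y, hy, rfl⟩ := hx
  have h2 : g (g' (g y)) = g y := LinearMap.congr_fun h (g y)
  rw [Submodule.mem_comap, hinj h2]
  exact hy

/-- The annihilator of `W` is the dual of `V / W`. The contragredient action on it has the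
characteristic polynomial of the inverse of `g` on `V / W`, which by finite order is that of `g` on
`V / W`, the cofactor of `facePoly g W`. -/
theorem facePoly_dualAnnihilator {g g' : Module.End ℝ V} {W : Submodule ℝ V}
    (hW : W ≤ W.comap g) (h : g * g' = 1) {N : ℕ} (hN : 0 < N) (hg : g ^ N = 1) :
    facePoly (g'.dualMap) W.dualAnnihilator * facePoly g W = facePoly g ⊤ := by
  have hW' := le_comap_of_mul_eq_one hW h
  have hA : W.dualAnnihilator ≤ W.dualAnnihilator.comap g'.dualMap := fun u hu => by
    rw [Submodule.mem_comap, Submodule.mem_dualAnnihilator]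
    intro w hw
    exact (Submodule.mem_dualAnnihilator _).1 hu _ (hW' hw)
  have hT : (⊤ : Submodule ℝ V) ≤ Submodule.comap g ⊤ := fun _ _ => trivial
  rw [facePoly_eq hA, facePoly_eq hW, facePoly_eq hT, ← Polynomial.map_mul]
  congr 1
  have h1 : (g.restrict hT) = (LinearEquiv.symm Submodule.topEquiv).conj g := by
    ext x
    rfl
  have h2 : (g'.dualMap.restrict hA) =
      (W.dualQuotEquivDualAnnihilator).conj (W.mapQ W g' hW').dualMap := by
    refine LinearMap.ext fun u => ?_
    obtain ⟨v, rfl⟩ := W.dualQuotEquivDualAnnihilator.surjective u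
    rw [LinearEquiv.conj_apply_apply, LinearEquiv.symm_apply_apply]
    ext x
    rfl
  have h3 : W.mapQ W g hW * W.mapQ W g' hW' = 1 := by
    refine LinearMap.ext fun y => ?_
    obtain ⟨x, rfl⟩ := W.mkQ_surjective y
    have : g (g' x) = x := LinearMap.congr_fun h x
    simp [this]
  have h4 : (W.mapQ W g hW) ^ N = 1 := by
    have : ∀ k, ∀ x : V, ((W.mapQ W g hW) ^ k) (W.mkQ x) = W.mkQ ((g ^ k) x) := by
      intro k
      induction k with
      | zero => intro x; rfl
      | succ k ih =>
        intro x
        rw [pow_succ, pow_succ, Module.End.mul_apply, Module.End.mul_apply, ← ih]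
        rfl
    refine LinearMap.ext fun y => ?_
    obtain ⟨x, rfl⟩ := W.mkQ_surjective y
    rw [this, hg]; rfl
  have hfree : Free ℝ W.dualAnnihilator :=
    Free.of_equiv W.dualQuotEquivDualAnnihilator
  have hfin : Module.Finite ℝ W.dualAnnihilator := 
    Module.Finite.equiv W.dualQuotEquivDualAnnihilator
  rw [h1, h2, LinearEquiv.charpoly_conj, LinearEquiv.charpoly_conj, charpoly_dualMap,
    charpoly_of_mul_eq_one h3 hN h4, charpoly_eq_mul W g hW, mul_comm]

end FacePoly

end EquivariantCone

namespace EquivariantCone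

/-! ## Expansions of rational functions -/

section Expansions

open Polynomial

/-- The embedding of the rational functions into the Laurent series. -/
def toLaurentSeries : RatFunc ℂ →+* LaurentSeries ℂ :=
  RatFunc.liftRingHom ((HahnSeries.ofPowerSeries ℤ ℂ).comp Polynomial.coeToPowerSeries.ringHom)
    fun p hp => by
      rw [Submonoid.mem_comap, mem_nonZeroDivisors_iff_ne_zero]
      intro h
      have h1 : (p : PowerSeries ℂ) = 0 :=
        HahnSeries.ofPowerSeries_injective (h.trans (map_zero _).symm)
      exact nonZeroDivisors.ne_zero hp (Polynomial.coe_eq_zero_iff.1 h1)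

/-- The power series `s` is the expansion of the rational function `f`, as an identity of Laurent
series. -/
def Expands (s : PowerSeries ℂ) (f : RatFunc ℂ) : Prop :=
  toLaurentSeries f = HahnSeries.ofPowerSeries ℤ ℂ s

theorem ofPowerSeries_coe (p : ℂ[X]) :
    HahnSeries.ofPowerSeries ℤ ℂ (p : PowerSeries ℂ) =
      toLaurentSeries (algebraMap ℂ[X] (RatFunc ℂ) p) := by
  rw [toLaurentSeries, RatFunc.liftRingHom_algebraMap]
  rfl

theorem Expands.of_polynomial (p : ℂ[X]) :
    Expands (p : PowerSeries ℂ) (algebraMap ℂ[X] (RatFunc ℂ) p) :=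
  (ofPowerSeries_coe p).symm

theorem Expands.mul {s s' : PowerSeries ℂ} {f f' : RatFunc ℂ} (h : Expands s f)
    (h' : Expands s' f') : Expands (s * s') (f * f') := by
  rw [Expands, map_mul, map_mul, h, h']

theorem Expands.sum {ι : Type*} (T : Finset ι) {s : ι → PowerSeries ℂ} {f : ι → RatFunc ℂ}
    (h : ∀ i ∈ T, Expands (s i) (f i)) : Expands (∑ i ∈ T, s i) (∑ i ∈ T, f i) := by
  rw [Expands, map_sum, map_sum]
  exact Finset.sum_congr rfl h

theorem Expands.unique {s : PowerSeries ℂ} {f f' : RatFunc ℂ} (h : Expands s f)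
    (h' : Expands s f') : f = f' :=
  toLaurentSeries.injective (h.trans h'.symm)

theorem Expands.series_unique {s s' : PowerSeries ℂ} {f : RatFunc ℂ} (h : Expands s f)
    (h' : Expands s' f) : s = s' :=
  HahnSeries.ofPowerSeries_injective (h.symm.trans h')

theorem Expands.of_mul_eq {s : PowerSeries ℂ} {p q : ℂ[X]} (hq : q ≠ 0)
    (h : s * (q : PowerSeries ℂ) = p) :
    Expands s (algebraMap ℂ[X] (RatFunc ℂ) p / algebraMap ℂ[X] (RatFunc ℂ) q) := by
  have h1 := congrArg (HahnSeries.ofPowerSeries ℤ ℂ) h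
  rw [map_mul, ofPowerSeries_coe, ofPowerSeries_coe] at h1
  rw [Expands, map_div₀, ← h1, mul_div_assoc, div_self, mul_one]
  rw [Ne, map_eq_zero]
  exact RatFunc.algebraMap_ne_zero hq

theorem Expands.isExpansionOf {s : PowerSeries ℂ} {f : RatFunc ℂ} (h : Expands s f) :
    IsExpansionOf s f := by
  apply HahnSeries.ofPowerSeries_injective (Γ := ℤ)
  rw [map_mul, ofPowerSeries_coe, ofPowerSeries_coe, ← h, ← map_mul]
  congr 1
  have h1 := RatFunc.algebraMap_ne_zero (RatFunc.denom_ne_zero f)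
  exact (eq_div_iff h1).1 (RatFunc.num_div_denom f).symm

/-- Any `n ≥ natDegree` is allowed, so that polynomials of different degrees can be reflected with a
common exponent. -/
theorem eval₂_X_inv (p : ℂ[X]) (n : ℕ) (hp : p.natDegree ≤ n) :
    p.eval₂ RatFunc.C (RatFunc.X)⁻¹ =
      algebraMap ℂ[X] (RatFunc ℂ) (p.reflect n) * ((RatFunc.X)⁻¹) ^ n := by
  let _ : Invertible ((RatFunc.X : RatFunc ℂ)⁻¹) :=
    invertibleOfNonzero (inv_ne_zero RatFunc.X_ne_zero)
  rw [← eval₂_reflect_mul_pow RatFunc.C ((RatFunc.X : RatFunc ℂ)⁻¹) n p hp]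
  congr 1
  rw [invOf_eq_inv, inv_inv]
  conv_rhs => rw [← eval₂_C_X (p := p.reflect n), Polynomial.hom_eval₂]
  rw [RatFunc.algebraMap_X]
  rfl

theorem eval₂_X_inv_ne_zero {p : ℂ[X]} (hp : p ≠ 0) :
    p.eval₂ RatFunc.C (RatFunc.X : RatFunc ℂ)⁻¹ ≠ 0 := by
  rw [eval₂_X_inv p p.natDegree le_rfl]
  refine mul_ne_zero (RatFunc.algebraMap_ne_zero ?_)
    (pow_ne_zero _ (inv_ne_zero RatFunc.X_ne_zero))
  rwa [Ne, reflect_eq_zero_iff]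

/-- The substitution `t ↦ t⁻¹` as a ring homomorphism. -/
def invHom : RatFunc ℂ →+* RatFunc ℂ :=
  RatFunc.liftRingHom (Polynomial.eval₂RingHom RatFunc.C (RatFunc.X)⁻¹) fun p hp => by
    rw [Submonoid.mem_comap, mem_nonZeroDivisors_iff_ne_zero]
    exact eval₂_X_inv_ne_zero (nonZeroDivisors.ne_zero hp)

theorem invertVar_eq (f : RatFunc ℂ) : invertVar f = invHom f := by
  conv_rhs => rw [← RatFunc.num_div_denom f]
  rw [invHom, RatFunc.liftRingHom_apply_div]
  rfl

theorem invHom_algebraMap (p : ℂ[X]) (n : ℕ) (hp : p.natDegree ≤ n) :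
    invHom (algebraMap ℂ[X] (RatFunc ℂ) p) =
      algebraMap ℂ[X] (RatFunc ℂ) (p.reflect n) * ((RatFunc.X)⁻¹) ^ n := by
  rw [← eval₂_X_inv p n hp, invHom, RatFunc.liftRingHom_algebraMap]
  rfl

theorem X_pow_mul_invHom (p : ℂ[X]) (n : ℕ) (hp : p.natDegree ≤ n) :
    RatFunc.X ^ n * invHom (algebraMap ℂ[X] (RatFunc ℂ) p) =
      algebraMap ℂ[X] (RatFunc ℂ) (p.reflect n) := by
  have h : (RatFunc.X : RatFunc ℂ) ^ n ≠ 0 := pow_ne_zero _ RatFunc.X_ne_zero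
  rw [invHom_algebraMap p n hp, inv_pow, mul_comm, mul_assoc, inv_mul_cancel₀ h, mul_one]

end Expansions

end EquivariantCone

namespace EquivariantCone

/-! ## Generic decomposition of a cone into simplicial cones -/

/-- A positive vector that avoids finitely many hyperplanes. -/
theorem exists_pos_generic {I J : Type*} [Fintype I] [Finite J] (a : J → I → ℝ)
    (ha : ∀ j, a j ≠ 0) : ∃ w : I → ℝ, (∀ i, 0 < w i) ∧ ∀ j, ∑ i, a j i * w i ≠ 0 := by
  classical
  have := Fintype.ofFinite J
  let e := Fintype.equivFin I
  -- The vector is sought on the moment curve `w_i = τ^i`: each hyperplane excludes only the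
  -- finitely many roots of one nonzero polynomial in `τ`.
  let p : J → Polynomial ℝ := fun j => ∑ i, Polynomial.C (a j i) * Polynomial.X ^ (e i : ℕ)
  have hp : ∀ j, p j ≠ 0 := by
    intro j h
    refine ha j (funext fun i => ?_)
    have h1 := congrArg (fun q : Polynomial ℝ => q.coeff (e i : ℕ)) h
    simp only [p, Polynomial.finsetSum_coeff, Polynomial.coeff_C_mul, Polynomial.coeff_X_pow,
      Polynomial.coeff_zero] at h1
    rw [Finset.sum_eq_single i] at h1
    · simpa using h1
    · intro k _ hk
      rw [if_neg, mul_zero]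
      intro h2
      exact hk (e.injective (Fin.ext h2)).symm
    · simp
  have hfin : (⋃ j, {x | (p j).IsRoot x}).Finite :=
    Set.finite_iUnion fun j => Polynomial.finite_setOfPred_isRoot (hp j)
  obtain ⟨τ, hτ, hτ'⟩ := ((Set.Ioi_infinite (0 : ℝ)).sdiff hfin).nonempty
  refine ⟨fun i => τ ^ (e i : ℕ), fun i => pow_pos hτ _, fun j h => hτ' ?_⟩
  refine Set.mem_iUnion.2 ⟨j, ?_⟩
  simpa [p, Polynomial.IsRoot.def, Polynomial.eval_finsetSum] using h

open Classical in
theorem sum_apply_ite {I A : Type*} [Fintype I] [AddCommMonoid A] (F : I → ℝ → A)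
    (hF : ∀ i, F i 0 = 0) {B : Finset I} {j : I} (hj : j ∉ B) (a : I → ℝ) (δ : ℝ) :
    ∑ i, F i (if i ∈ B then a i else if i = j then δ else 0) = ∑ i ∈ B, F i (a i) + F j δ := by
  rw [← Finset.sum_subset (Finset.subset_univ (insert j B)), Finset.sum_insert hj, add_comm]
  · congr 1
    · exact Finset.sum_congr rfl fun i hi => by rw [if_pos hi]
    · rw [if_neg hj, if_pos rfl]
  · intro i _ hi
    rw [Finset.mem_insert, not_or] at hi
    rw [if_neg hi.2, if_neg hi.1, hF]

/-! ### Bases of a vector configuration that are optimal for a generic cost -/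

section LinearProgramming

variable {V I : Type*} [AddCommGroup V] [Module ℝ V] [Fintype I]

theorem mem_hull_range_iff (u : I → V) (y : V) :
    y ∈ PointedCone.hull ℝ (Set.range u) ↔ ∃ l : I → ℝ, (∀ i, 0 ≤ l i) ∧ ∑ i, l i • u i = y := by
  rw [Submodule.mem_span_range_iff_exists_fun]
  constructor
  · rintro ⟨c, hc⟩
    exact ⟨fun i => c i, fun i => (c i).2, hc⟩
  · rintro ⟨l, hl, h⟩
    exact ⟨fun i => ⟨l i, hl i⟩, h⟩

theorem smul_mem_hull_range {u : I → V} (i : I) {r : ℝ} (hr : 0 ≤ r) :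
    r • u i ∈ PointedCone.hull ℝ (Set.range u) :=
  PointedCone.smul_mem _ hr (Submodule.subset_span ⟨i, rfl⟩)

/-- A representation of `y` as a nonnegative combination can be replaced by one with linearly
independent support without increasing a linear cost. -/
theorem exists_linearIndepOn_support {u : I → V} {h : V →ₗ[ℝ] ℝ} (hpos : ∀ i, 0 < h (u i))
    (w : I → ℝ) (l : I → ℝ) (hl : ∀ i, 0 ≤ l i) :
    ∃ l' : I → ℝ, (∀ i, 0 ≤ l' i) ∧ ∑ i, l' i • u i = ∑ i, l i • u i ∧
      ∑ i, l' i * w i ≤ ∑ i, l i * w i ∧ LinearIndepOn ℝ u {i | l' i ≠ 0} := by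
  classical
  induction hn : (Finset.univ.filter fun i => l i ≠ 0).card using Nat.strong_induction_on
    generalizing l with
  | _ n ih =>
  by_cases hli : LinearIndepOn ℝ u {i | l i ≠ 0}
  · exact ⟨l, hl, rfl, le_rfl, hli⟩
  have hrel : ∃ μ : I → ℝ, (∑ i, μ i • u i = 0) ∧ (∀ i, l i = 0 → μ i = 0) ∧ μ ≠ 0 := by
    have h1 : ¬ LinearIndepOn ℝ u ((Finset.univ.filter fun i => l i ≠ 0 : Finset I) : Set I) := by
      simpa using hli
    rw [linearIndepOn_finset_iff] at h1
    push Not at h1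
    obtain ⟨μ, h2, i, hi, hμi⟩ := h1
    refine ⟨fun j => if l j ≠ 0 then μ j else 0, ?_, ?_, ?_⟩
    · rw [← h2, Finset.sum_filter]
      refine Finset.sum_congr rfl fun j _ => ?_
      by_cases hj : l j = 0 <;> simp [hj]
    · intro j hj
      simp [hj]
    · intro h3
      have := congrFun h3 i
      simp only [Finset.mem_filter, Finset.mem_univ, true_and] at hi
      simp [hi, hμi] at this
  -- The sign of the relation is chosen so that moving along it does not raise the cost.
  have hrel' : ∃ μ : I → ℝ, (∑ i, μ i • u i = 0) ∧ (∀ i, l i = 0 → μ i = 0) ∧ μ ≠ 0 ∧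
      ∑ i, μ i * w i ≤ 0 := by
    obtain ⟨μ, h1, h2, h3⟩ := hrel
    rcases le_total (∑ i, μ i * w i) 0 with h4 | h4
    · exact ⟨μ, h1, h2, h3, h4⟩
    · refine ⟨-μ, ?_, fun i hi => ?_, neg_ne_zero.2 h3, ?_⟩
      · simp [h1]
      · simp [h2 i hi]
      · simpa using h4
  obtain ⟨μ, hμ0, hμl, hμ, hμw⟩ := hrel'
  -- A nonzero relation with `μ ≥ 0` would contradict the positivity of `h`. Hence the ratio test
  -- below has a candidate, and its minimizer `i₀` leaves the support.
  have hneg : ∃ i, μ i < 0 := by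
    by_contra! hcon
    refine hμ (funext fun i => ?_)
    have h1 := congrArg h hμ0
    simp only [map_sum, map_smul, smul_eq_mul, map_zero] at h1
    have h2 := (Finset.sum_eq_zero_iff_of_nonneg fun i _ =>
      mul_nonneg (hcon i) (hpos i).le).1 h1 i (Finset.mem_univ i)
    exact (mul_eq_zero.1 h2).resolve_right (hpos i).ne'
  obtain ⟨i₀, hi₀, hmin⟩ := Finset.exists_min_image (Finset.univ.filter fun i => μ i < 0)
    (fun i => l i / (-μ i)) (by
      obtain ⟨i, hi⟩ := hneg
      exact ⟨i, by simpa using hi⟩)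
  simp only [Finset.mem_filter, Finset.mem_univ, true_and] at hi₀ hmin
  set δ := l i₀ / (-μ i₀) with hδ
  have hδ0 : 0 ≤ δ := div_nonneg (hl i₀) (by linarith)
  set l₁ : I → ℝ := fun i => l i + δ * μ i with hl₁
  have hl₁0 : ∀ i, 0 ≤ l₁ i := by
    intro i
    rcases lt_or_ge (μ i) 0 with h1 | h1
    · have h2 := hmin i h1
      rw [le_div_iff₀ (by linarith)] at h2
      simp only [hl₁]
      linarith
    · exact add_nonneg (hl i) (mul_nonneg hδ0 h1)
  have hl₁i₀ : l₁ i₀ = 0 := by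
    have h1 : δ * (-μ i₀) = l i₀ := div_mul_cancel₀ _ (by linarith)
    simp only [hl₁]
    linarith
  have hsum : ∑ i, l₁ i • u i = ∑ i, l i • u i := by
    simp only [hl₁, add_smul, Finset.sum_add_distrib, mul_smul, ← Finset.smul_sum, hμ0,
      smul_zero, add_zero]
  have hcost : ∑ i, l₁ i * w i ≤ ∑ i, l i * w i := by
    simp only [hl₁, add_mul, Finset.sum_add_distrib, mul_assoc, ← Finset.mul_sum]
    have := mul_nonneg hδ0 (neg_nonneg.2 hμw)
    linarith
  have hcard : (Finset.univ.filter fun i => l₁ i ≠ 0).card < n := by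
    rw [← hn]
    apply Finset.card_lt_card
    refine ⟨fun i => ?_, fun hsub => ?_⟩
    · simp only [Finset.mem_filter, Finset.mem_univ, true_and]
      intro h1 h2
      exact h1 (by simp [hl₁, h2, hμl i h2])
    · have h1 : l i₀ ≠ 0 := fun h2 => hi₀.ne (hμl i₀ h2)
      have h2 := hsub (Finset.mem_filter.2 ⟨Finset.mem_univ i₀, h1⟩)
      exact (Finset.mem_filter.1 h2).2 hl₁i₀
  obtain ⟨l', h1, h2, h3, h4⟩ := ih _ hcard l₁ hl₁0 rfl
  exact ⟨l', h1, h2.trans hsum, h3.trans hcost, h4⟩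

/-- The subsets of a family of vectors that are bases of its span. -/
def IsSpanBasis (u : I → V) (B : Finset I) : Prop :=
  LinearIndepOn ℝ u (B : Set I) ∧ Submodule.span ℝ (u '' (B : Set I)) = Submodule.span ℝ (Set.range u)

/-- Coordinate functions with respect to all the bases of the span contained in a family. -/
def IsCoordSystem (u : I → V) (c : Finset I → I → Module.Dual ℝ V) : Prop :=
  ∀ B, IsSpanBasis u B → (∀ i ∈ B, c B i (u i) = 1) ∧ (∀ i ∈ B, ∀ j ∈ B, i ≠ j → c B i (u j) = 0)

theorem exists_coordSystem (u : I → V) : ∃ c, IsCoordSystem u c := by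
  classical
  have h1 : ∀ B : Finset I, ∃ c : I → Module.Dual ℝ V, IsSpanBasis u B →
      (∀ i ∈ B, c i (u i) = 1) ∧ (∀ i ∈ B, ∀ j ∈ B, i ≠ j → c i (u j) = 0) := by
    intro B
    by_cases hB : IsSpanBasis u B
    · have hli : LinearIndependent ℝ (fun i : (B : Set I) => u i) := hB.1
      let b := Module.Basis.extend hli.linearIndepOn_id
      have hb : ∀ i ∈ B, ∃ k, b k = u i := fun i hi =>
        ⟨⟨u i, Module.Basis.subset_extend hli.linearIndepOn_id ⟨⟨i, hi⟩, rfl⟩⟩,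
          Module.Basis.extend_apply_self _ _⟩
      choose k hk using hb
      refine ⟨fun i => if hi : i ∈ B then b.coord (k i hi) else 0, fun _ => ⟨?_, ?_⟩⟩
      · intro i hi
        simp only [dif_pos hi, ← hk i hi, Module.Basis.coord_apply, Module.Basis.repr_self,
          Finsupp.single_eq_same]
      · intro i hi j hj hij
        simp only [dif_pos hi, ← hk j hj, Module.Basis.coord_apply, Module.Basis.repr_self]
        refine Finsupp.single_eq_of_ne fun h2 => hij ?_
        have h3 : u i = u j := by rw [← hk i hi, ← hk j hj, h2]
        exact congrArg Subtype.val (hli.injective (a₁ := ⟨i, hi⟩) (a₂ := ⟨j, hj⟩) h3)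
    · exact ⟨fun _ => 0, fun h => absurd h hB⟩
  choose c hc using h1
  exact ⟨c, hc⟩

theorem IsCoordSystem.sum_eq {u : I → V} {c : Finset I → I → Module.Dual ℝ V}
    (hc : IsCoordSystem u c) {B : Finset I} (hB : IsSpanBasis u B) {x : V}
    (hx : x ∈ Submodule.span ℝ (Set.range u)) : ∑ i ∈ B, c B i x • u i = x := by
  classical
  rw [← hB.2] at hx
  induction hx using Submodule.span_induction with
  | mem x hx =>
    obtain ⟨j, hj, rfl⟩ := hx
    rw [Finset.sum_eq_single j]
    · rw [(hc B hB).1 j hj, one_smul]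
    · intro i hi hij
      rw [(hc B hB).2 i hi j hj hij, zero_smul]
    · intro h
      exact absurd hj h
  | zero => simp
  | add x y _ _ hx hy => simp only [map_add, add_smul, Finset.sum_add_distrib, hx, hy]
  | smul r x _ hx => simp only [map_smul, smul_assoc, ← Finset.smul_sum, hx]

theorem IsCoordSystem.coord_sum {u : I → V} {c : Finset I → I → Module.Dual ℝ V}
    (hc : IsCoordSystem u c) {B : Finset I} (hB : IsSpanBasis u B) {i : I} (hi : i ∈ B)
    (l : I → ℝ) : c B i (∑ j ∈ B, l j • u j) = l i := by
  classical
  rw [map_sum, Finset.sum_eq_single i]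
  · rw [map_smul, (hc B hB).1 i hi, smul_eq_mul, mul_one]
  · intro j hj hji
    rw [map_smul, (hc B hB).2 i hi j hj hji.symm, smul_zero]
  · intro h
    exact absurd hi h

theorem exists_isSpanBasis_superset {u : I → V} {s : Set I} (hs : LinearIndepOn ℝ u s) :
    ∃ B : Finset I, s ⊆ B ∧ IsSpanBasis u B := by
  classical
  refine ⟨(hs.extend (Set.subset_univ s)).toFinset, ?_, ?_, ?_⟩
  · simpa using hs.subset_extend (Set.subset_univ s)
  · simpa using hs.linearIndepOn_extend (Set.subset_univ s)
  · have := hs.span_image_extend_eq_span_image (Set.subset_univ s)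
    simpa using this

/-- The bases that are optimal for the generic cost `w`. -/
def IsOptimalBasis (u : I → V) (c : Finset I → I → Module.Dual ℝ V) (w : I → ℝ)
    (B : Finset I) : Prop :=
  IsSpanBasis u B ∧ ∀ j ∉ B, ∑ i ∈ B, c B i (u j) * w i < w j

/-- A cost is generic if no basis determines the cost of another vector. -/
def IsGenericCost (u : I → V) (c : Finset I → I → Module.Dual ℝ V) (w : I → ℝ) : Prop :=
  ∀ B, IsSpanBasis u B → ∀ j ∉ B, ∑ i ∈ B, c B i (u j) * w i ≠ w j

/-- Each equality to be avoided is a linear equation in `w` in which `w j` has coefficient `-1`, so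
it defines a proper hyperplane. -/
theorem exists_genericCost (u : I → V) (c : Finset I → I → Module.Dual ℝ V) :
    ∃ w : I → ℝ, IsGenericCost u c w := by
  classical
  obtain ⟨w, -, hw⟩ := exists_pos_generic
    (J := {p : Finset I × I // p.2 ∉ p.1})
    (fun p i => (if i ∈ p.1.1 then c p.1.1 i (u p.1.2) else 0) - if i = p.1.2 then 1 else 0)
    (fun p h => by
      have := congrFun h p.1.2
      simp [p.2] at this)
  refine ⟨w, fun B _ j hj h => hw ⟨(B, j), hj⟩ ?_⟩
  simp only [sub_mul, Finset.sum_sub_distrib, ite_mul, one_mul, zero_mul, Finset.sum_ite_eq',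
    Finset.sum_ite_mem, Finset.univ_inter, Finset.mem_univ, if_true]
  rw [h, sub_self]

/-- A vector is generic if all its coordinates with respect to all bases are nonzero. -/
def IsGenericVec (u : I → V) (c : Finset I → I → Module.Dual ℝ V) (y : V) : Prop :=
  ∀ B, IsSpanBasis u B → ∀ i ∈ B, c B i y ≠ 0

/-- The equations to be avoided are nontrivial because `c B i (u i) = 1`. Positive weights are
required so that the vector lies in the relative interior of the cone (`sum_smul_mem_relInt`). -/
theorem exists_genericVec {u : I → V} {c : Finset I → I → Module.Dual ℝ V}
    (hc : IsCoordSystem u c) :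
    ∃ w : I → ℝ, (∀ i, 0 < w i) ∧ IsGenericVec u c (∑ i, w i • u i) := by
  classical
  obtain ⟨w, hw, hw'⟩ := exists_pos_generic
    (J := {p : Finset I × I // IsSpanBasis u p.1 ∧ p.2 ∈ p.1})
    (fun p i => c p.1.1 p.1.2 (u i))
    (fun p h => by
      have := congrFun h p.1.2
      simp only [Pi.zero_apply] at this
      rw [(hc _ p.2.1).1 _ p.2.2] at this
      exact one_ne_zero this)
  refine ⟨w, hw, fun B hB i hi h => hw' ⟨(B, i), hB, hi⟩ ?_⟩
  rw [← h, map_sum]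
  refine Finset.sum_congr rfl fun j _ => ?_
  rw [map_smul, smul_eq_mul, mul_comm]

/-- This is the optimality criterion of the simplex method. Take the cheapest basis whose cone
contains `y`. If some `j` violated the strict inequality, shifting a little weight onto `u j` would
lower the cost, and `exists_linearIndepOn_support` would turn the result into a cheaper basis. -/
theorem exists_optimalBasis {u : I → V} {h : V →ₗ[ℝ] ℝ} (hpos : ∀ i, 0 < h (u i))
    {c : Finset I → I → Module.Dual ℝ V} (hc : IsCoordSystem u c) {w : I → ℝ}
    (hw : IsGenericCost u c w) {y : V} (hy : IsGenericVec u c y)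
    (hyK : y ∈ PointedCone.hull ℝ (Set.range u)) :
    ∃ B, IsOptimalBasis u c w B ∧ ∀ i ∈ B, 0 < c B i y := by
  classical
  have key : ∀ l : I → ℝ, (∀ i, 0 ≤ l i) → ∑ i, l i • u i = y →
      ∃ B, IsSpanBasis u B ∧ (∀ i ∈ B, 0 ≤ c B i y) ∧
        ∑ i ∈ B, c B i y * w i ≤ ∑ i, l i * w i := by
    intro l hl hly
    obtain ⟨l', h1, h2, h3, h4⟩ := exists_linearIndepOn_support hpos w l hl
    obtain ⟨B, hsB, hB⟩ := exists_isSpanBasis_superset h4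
    have h5 : ∀ i, i ∉ B → l' i = 0 := by
      intro i hi
      by_contra h6
      exact hi (hsB h6)
    have h6 : ∑ i ∈ B, l' i • u i = y := by
      rw [← hly, ← h2]
      exact Finset.sum_subset (Finset.subset_univ B) fun i _ hi => by rw [h5 i hi, zero_smul]
    have h7 : ∀ i ∈ B, c B i y = l' i := fun i hi => by
      rw [← h6, hc.coord_sum hB hi]
    refine ⟨B, hB, fun i hi => by rw [h7 i hi]; exact h1 i, ?_⟩
    refine le_trans (le_of_eq ?_) h3
    rw [Finset.sum_congr rfl fun i hi => by rw [h7 i hi]]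
    exact Finset.sum_subset (Finset.subset_univ B) fun i _ hi => by rw [h5 i hi, zero_mul]
  obtain ⟨l₀, hl₀, hly₀⟩ := (mem_hull_range_iff u y).1 hyK
  obtain ⟨B₀, hB₀⟩ := key l₀ hl₀ hly₀
  obtain ⟨B, hB, hmin⟩ := Finset.exists_min_image
    (Finset.univ.filter fun B => IsSpanBasis u B ∧ ∀ i ∈ B, 0 ≤ c B i y)
    (fun B => ∑ i ∈ B, c B i y * w i)
    ⟨B₀, Finset.mem_filter.2 ⟨Finset.mem_univ _, hB₀.1, hB₀.2.1⟩⟩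
  simp only [Finset.mem_filter, Finset.mem_univ, true_and] at hB hmin
  have hpos' : ∀ i ∈ B, 0 < c B i y := fun i hi =>
    lt_of_le_of_ne (hB.2 i hi) (hy B hB.1 i hi).symm
  refine ⟨B, ⟨hB.1, fun j hj => ?_⟩, hpos'⟩
  by_contra! hcon
  have hcon' := lt_of_le_of_ne hcon (hw B hB.1 j hj).symm
  -- Genericity makes all coordinates of `y` strictly positive, which leaves room for a positive
  -- `δ`.
  obtain ⟨δ, hδ, hδB⟩ : ∃ δ : ℝ, 0 < δ ∧ ∀ i ∈ B, 0 ≤ c B i y - δ * c B i (u j) := by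
    have : ∀ᶠ δ in nhdsWithin (0 : ℝ) (Set.Ioi 0), ∀ i ∈ B, 0 ≤ c B i y - δ * c B i (u j) := by
      rw [Filter.eventually_all_finset]
      intro i hi
      have h1 : Filter.Tendsto (fun δ : ℝ => c B i y - δ * c B i (u j))
          (nhdsWithin (0 : ℝ) (Set.Ioi 0)) (nhds (c B i y - 0 * c B i (u j))) :=
        Filter.Tendsto.mono_left (Continuous.tendsto (by fun_prop) _) nhdsWithin_le_nhds
      rw [zero_mul, sub_zero] at h1
      exact (h1.eventually (lt_mem_nhds (hpos' i hi))).mono fun _ h => h.le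
    obtain ⟨δ, h1, h2⟩ := (this.and self_mem_nhdsWithin).exists
    exact ⟨δ, h2, h1⟩
  have hxy : y ∈ Submodule.span ℝ (Set.range u) := by
    rw [← hly₀]
    exact Submodule.sum_mem _ fun i _ => Submodule.smul_mem _ _ (Submodule.subset_span ⟨i, rfl⟩)
  set l : I → ℝ := fun i => if i ∈ B then c B i y - δ * c B i (u j) else if i = j then δ else 0
    with hl
  obtain ⟨B', hB', hB'0, hB'w⟩ := key l (fun i => by
      simp only [hl]
      split_ifs with h1 h2
      · exact hδB i h1
      · exact hδ.le
      · exact le_rfl) (by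
      rw [sum_apply_ite (fun i r => r • u i) (fun _ => zero_smul _ _) hj]
      simp only [sub_smul, mul_smul, Finset.sum_sub_distrib, ← Finset.smul_sum]
      rw [hc.sum_eq hB.1 hxy, hc.sum_eq hB.1 (Submodule.subset_span ⟨j, rfl⟩)]
      abel)
  have h1 := hmin B' ⟨hB', hB'0⟩
  rw [sum_apply_ite (fun i r => r * w i) (fun _ => zero_mul _) hj] at hB'w
  simp only [sub_mul, mul_assoc, Finset.sum_sub_distrib, ← Finset.mul_sum] at hB'w
  have h2 := mul_pos hδ (sub_pos.2 hcon')
  rw [mul_sub] at h2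
  linarith

/-- Linear programming duality: the functional `x ↦ ∑ c B i x * w i` is at most `w j` at every `u
j`, strictly for `j ∉ B`. Evaluated at `y` expanded in `B'`, it shows that `B` costs no more than
`B'`, and strictly less unless `B' ⊆ B`; then the roles are exchanged. -/
theorem optimalBasis_unique {u : I → V} {c : Finset I → I → Module.Dual ℝ V}
    (hc : IsCoordSystem u c) {w : I → ℝ} {y : V} (hy : y ∈ Submodule.span ℝ (Set.range u))
    {B B' : Finset I} (hB : IsOptimalBasis u c w B) (hB' : IsOptimalBasis u c w B')
    (hyB : ∀ i ∈ B, 0 < c B i y) (hyB' : ∀ i ∈ B', 0 < c B' i y) : B = B' := by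
  classical
  have h0 : ∀ B, IsOptimalBasis u c w B → ∀ j, ∑ i ∈ B, c B i (u j) * w i ≤ w j := by
    intro B hB j
    by_cases hj : j ∈ B
    · rw [Finset.sum_eq_single j]
      · rw [(hc B hB.1).1 j hj, one_mul]
      · intro i hi hij
        rw [(hc B hB.1).2 i hi j hj hij, zero_mul]
      · intro h
        exact absurd hj h
    · exact (hB.2 j hj).le
  have h1 : ∀ B B', IsOptimalBasis u c w B → IsOptimalBasis u c w B' →
      ∑ i ∈ B, c B i y * w i = ∑ j ∈ B', c B' j y * ∑ i ∈ B, c B i (u j) * w i := by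
    intro B B' hB hB'
    have h2 : ∀ i, c B i y = ∑ j ∈ B', c B' j y * c B i (u j) := by
      intro i
      conv_lhs => rw [← hc.sum_eq hB'.1 hy]
      rw [map_sum]
      exact Finset.sum_congr rfl fun j _ => by rw [map_smul, smul_eq_mul]
    simp only [h2, Finset.sum_mul, Finset.mul_sum]
    rw [Finset.sum_comm]
    exact Finset.sum_congr rfl fun j _ => Finset.sum_congr rfl fun i _ => mul_assoc _ _ _
  have h3 : ∀ B B', IsOptimalBasis u c w B → IsOptimalBasis u c w B' →
      (∀ i ∈ B', 0 < c B' i y) → ∑ i ∈ B, c B i y * w i ≤ ∑ i ∈ B', c B' i y * w i := by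
    intro B B' hB hB' hyB'
    rw [h1 B B' hB hB']
    exact Finset.sum_le_sum fun j hj => mul_le_mul_of_nonneg_left (h0 B hB j) (hyB' j hj).le
  have h4 : ∀ B B', IsOptimalBasis u c w B → IsOptimalBasis u c w B' →
      (∀ i ∈ B, 0 < c B i y) → (∀ i ∈ B', 0 < c B' i y) → B' ⊆ B := by
    intro B B' hB hB' hyB hyB' j hj
    by_contra hjB
    have h5 : ∑ i ∈ B, c B i y * w i < ∑ i ∈ B', c B' i y * w i := by
      rw [h1 B B' hB hB']
      exact Finset.sum_lt_sum
        (fun j hj => mul_le_mul_of_nonneg_left (h0 B hB j) (hyB' j hj).le)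
        ⟨j, hj, mul_lt_mul_of_pos_left (hB.2 j hjB) (hyB' j hj)⟩
    exact absurd (h3 B' B hB' hB hyB) (not_le.2 h5)
  exact Finset.Subset.antisymm (h4 B' B hB' hB hyB' hyB) (h4 B B' hB hB' hyB hyB')

end LinearProgramming

end EquivariantCone

namespace EquivariantCone

/-! ## Reciprocity for the lattice points of a cone -/

section Reciprocity

variable {V : Type*} [AddCommGroup V] [Module ℝ V]

/-- The relative interior of a cone. -/
def relInt (K : PointedCone ℝ V) : Set V :=
  {x | x ∈ K ∧ ∀ y ∈ K, ∃ δ : ℝ, 0 < δ ∧ x - δ • y ∈ K}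

/-- The generating function of the points of `A` of integral heights. -/
def genFun (h : V →ₗ[ℝ] ℝ) (A : Set V) : PowerSeries ℂ :=
  PowerSeries.mk fun m => ((A ∩ {x | h x = m}).ncard : ℂ)

theorem coeff_genFun (h : V →ₗ[ℝ] ℝ) (A : Set V) (m : ℕ) :
    PowerSeries.coeff m (genFun h A) = ((A ∩ {x | h x = m}).ncard : ℂ) :=
  PowerSeries.coeff_mk _ _

theorem mem_span_of_mem_hull {S : Set V} {x : V} (h : x ∈ PointedCone.hull ℝ S) :
    x ∈ Submodule.span ℝ S :=
  PointedCone.hull_le_span ℝ S h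

theorem linSpan_hull (S : Set V) : linSpan (PointedCone.hull ℝ S) = Submodule.span ℝ S := by
  apply le_antisymm
  · exact Submodule.span_le.2 (PointedCone.hull_le_span ℝ S)
  · exact Submodule.span_mono Submodule.subset_span

theorem ncard_add_of_disjoint_union {A A₁ A₂ : Set V} (hA : A.Finite) (h : A = A₁ ∪ A₂)
    (hd : Disjoint A₁ A₂) : A.ncard = A₁.ncard + A₂.ncard := by
  subst h
  exact Set.ncard_union_eq hd (hA.subset Set.subset_union_left) (hA.subset Set.subset_union_right)

/-- The set `A` contains its translate `A + v`, and the factor `1 - t^e` subtracts the generating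
function of this translate. Nonnegative heights ensure that the translate has no points below height
`e`. -/
theorem genFun_mul_one_sub {h : V →ₗ[ℝ] ℝ} {A A' : Set V} {v : V} {e : ℕ} (hv : h v = e)
    (hnonneg : ∀ x ∈ A, 0 ≤ h x) (hfin : ∀ m : ℕ, (A ∩ {x | h x = m}).Finite)
    (hadd : ∀ x ∈ A, x + v ∈ A) (hA' : ∀ x, x ∈ A' ↔ x ∈ A ∧ x - v ∉ A) :
    genFun h A * (1 - PowerSeries.X ^ e) = genFun h A' := by
  ext m
  rw [mul_sub, mul_one, map_sub, PowerSeries.coeff_mul_X_pow', coeff_genFun, coeff_genFun]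
  have h1 : (A ∩ {x | h x = m}).ncard = (A' ∩ {x | h x = m}).ncard +
      ({x | x - v ∈ A} ∩ {x | h x = m}).ncard := by
    apply ncard_add_of_disjoint_union (hfin m)
    · ext x
      simp only [Set.mem_inter_iff, Set.mem_union, hA', Set.mem_ofPred_eq]
      constructor
      · rintro ⟨h1, h2⟩
        by_cases h3 : x - v ∈ A
        · exact Or.inr ⟨h3, h2⟩
        · exact Or.inl ⟨⟨h1, h3⟩, h2⟩
      · rintro (⟨⟨h1, -⟩, h2⟩ | ⟨h1, h2⟩)
        · exact ⟨h1, h2⟩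
        · have := hadd _ h1
          rw [sub_add_cancel] at this
          exact ⟨this, h2⟩
    · rw [Set.disjoint_left]
      rintro x ⟨h1, -⟩ ⟨h2, -⟩
      exact ((hA' x).1 h1).2 h2
  split_ifs with hm
  · rw [coeff_genFun]
    have h2 : ({x | x - v ∈ A} ∩ {x | h x = m}).ncard = (A ∩ {x | h x = ((m - e : ℕ) : ℝ)}).ncard := by
      rw [← Set.ncard_image_of_injective (A ∩ {x | h x = ((m - e : ℕ) : ℝ)})
        (add_left_injective v)]
      congr 1
      ext x
      simp only [Set.mem_inter_iff, Set.mem_image, Set.mem_ofPred_eq]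
      constructor
      · rintro ⟨h1, h2⟩
        exact ⟨x - v, ⟨h1, by rw [map_sub, h2, hv, Nat.cast_sub hm]⟩, sub_add_cancel x v⟩
      · rintro ⟨y, ⟨h1, h2⟩, rfl⟩
        refine ⟨by rwa [add_sub_cancel_right], ?_⟩
        rw [map_add, h2, hv, Nat.cast_sub hm, sub_add_cancel]
    rw [h1, h2]
    push_cast
    ring
  · have h2 : ({x | x - v ∈ A} ∩ {x | h x = m}) = ∅ := by
      ext x
      simp only [Set.mem_inter_iff, Set.mem_ofPred_eq, Set.mem_empty_iff_false, iff_false, not_and]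
      intro h3 h4
      have h5 := hnonneg _ h3
      rw [map_sub, h4, hv] at h5
      have h6 : (e : ℝ) ≤ m := by linarith
      exact hm (by exact_mod_cast h6)
    rw [h1, h2, coeff_genFun]
    simp

variable {I : Type*} [Fintype I]

/-- The half-open simplicial cone over a basis `B`, with the facets `i ∈ B` with `σ i` included. -/
def halfOpenCone (u : I → V) (c : Finset I → I → Module.Dual ℝ V) (B : Finset I) (σ : I → Prop) :
    Set V :=
  {x | x ∈ Submodule.span ℝ (Set.range u) ∧ ∀ i ∈ B, 0 < c B i x ∨ (c B i x = 0 ∧ σ i)}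

/-- For small `ε > 0` the sign of a coordinate of `x + ε q` is decided first by `x` and, in case of
a tie, by `q`. There are only finitely many bases and coordinates, so one `ε` serves them all. -/
theorem eventually_coord_pos_iff {u : I → V} {c : Finset I → I → Module.Dual ℝ V} {q : V}
    (hq : IsGenericVec u c q) (x : V) :
    ∀ᶠ ε in nhdsWithin (0 : ℝ) (Set.Ioi 0), ∀ B, IsSpanBasis u B → ∀ i ∈ B,
      c B i (x + ε • q) ≠ 0 ∧
        (0 < c B i (x + ε • q) ↔ 0 < c B i x ∨ (c B i x = 0 ∧ 0 < c B i q)) := by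
  rw [Filter.eventually_all]
  intro B
  by_cases hB : IsSpanBasis u B
  swap
  · exact Filter.Eventually.of_forall fun _ h => absurd h hB
  simp only [hB, forall_true_left]
  rw [Filter.eventually_all_finset]
  intro i hi
  have h0 := hq B hB i hi
  simp only [map_add, map_smul, smul_eq_mul]
  have h1 : Filter.Tendsto (fun ε : ℝ => c B i x + ε * c B i q)
      (nhdsWithin (0 : ℝ) (Set.Ioi 0)) (nhds (c B i x + 0 * c B i q)) :=
    Filter.Tendsto.mono_left (Continuous.tendsto (by fun_prop) _) nhdsWithin_le_nhds
  rw [zero_mul, add_zero] at h1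
  rcases lt_trichotomy (c B i x) 0 with h2 | h2 | h2
  · filter_upwards [h1.eventually (gt_mem_nhds h2)] with ε hε
    exact ⟨hε.ne, ⟨fun h => absurd h hε.not_gt, fun h => by
      rcases h with h | h
      · exact absurd h h2.not_gt
      · exact absurd h.1 h2.ne⟩⟩
  · filter_upwards [self_mem_nhdsWithin] with ε hε
    rw [h2, zero_add]
    refine ⟨mul_ne_zero (ne_of_gt hε) h0, ?_⟩
    rw [mul_pos_iff_of_pos_left hε]
    simp
  · filter_upwards [h1.eventually (lt_mem_nhds h2)] with ε hε
    exact ⟨hε.ne', ⟨fun _ => Or.inl h2, fun _ => hε⟩⟩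

theorem mem_hull_of_coord_nonneg {u : I → V} {c : Finset I → I → Module.Dual ℝ V}
    (hc : IsCoordSystem u c) {B : Finset I} (hB : IsSpanBasis u B) {x : V}
    (hx : x ∈ Submodule.span ℝ (Set.range u)) (h : ∀ i ∈ B, 0 ≤ c B i x) :
    x ∈ PointedCone.hull ℝ (Set.range u) := by
  rw [← hc.sum_eq hB hx]
  exact Submodule.sum_mem _ fun i hi => smul_mem_hull_range i (h i hi)

/-- The perturbed point `x + ε q` is generic, so if it lies in the cone it lies in the open
simplicial cone of an optimal basis. Reading its coordinates as `ε → 0` gives exactly the half-open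
condition on `x`. -/
theorem eventually_mem_hull_iff {u : I → V} {h : V →ₗ[ℝ] ℝ} (hpos : ∀ i, 0 < h (u i))
    {c : Finset I → I → Module.Dual ℝ V} (hc : IsCoordSystem u c) {w : I → ℝ}
    (hw : IsGenericCost u c w) {q : V} (hq : IsGenericVec u c q)
    (hqW : q ∈ Submodule.span ℝ (Set.range u)) (x : V) :
    (∀ᶠ ε in nhdsWithin (0 : ℝ) (Set.Ioi 0), x + ε • q ∈ PointedCone.hull ℝ (Set.range u)) ↔
      ∃ B, IsOptimalBasis u c w B ∧ x ∈ halfOpenCone u c B fun i => 0 < c B i q := by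
  constructor
  · intro hx
    obtain ⟨ε, h1, h2⟩ := (hx.and (eventually_coord_pos_iff hq x)).exists
    obtain ⟨B, hB, h3⟩ := exists_optimalBasis hpos hc hw (fun B hB i hi => (h2 B hB i hi).1) h1
    refine ⟨B, hB, ?_, fun i hi => (h2 B hB.1 i hi).2.1 (h3 i hi)⟩
    have h4 := Submodule.sub_mem _ (mem_span_of_mem_hull h1) (Submodule.smul_mem _ ε hqW)
    rwa [add_sub_cancel_right] at h4
  · rintro ⟨B, hB, hxW, hx⟩
    filter_upwards [eventually_coord_pos_iff hq x] with ε hε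
    exact mem_hull_of_coord_nonneg hc hB.1
      (Submodule.add_mem _ hxW (Submodule.smul_mem _ ε hqW))
      fun i hi => ((hε B hB.1 i hi).2.2 (hx i hi)).le

theorem halfOpenCone_unique {u : I → V} {c : Finset I → I → Module.Dual ℝ V}
    (hc : IsCoordSystem u c) {w : I → ℝ} {q : V} (hq : IsGenericVec u c q)
    (hqW : q ∈ Submodule.span ℝ (Set.range u)) {x : V} {B B' : Finset I}
    (hB : IsOptimalBasis u c w B) (hB' : IsOptimalBasis u c w B')
    (hx : x ∈ halfOpenCone u c B fun i => 0 < c B i q)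
    (hx' : x ∈ halfOpenCone u c B' fun i => 0 < c B' i q) : B = B' := by
  obtain ⟨ε, hε⟩ := (eventually_coord_pos_iff hq x).exists
  exact optimalBasis_unique hc (Submodule.add_mem _ hx.1 (Submodule.smul_mem _ ε hqW)) hB hB'
    (fun i hi => (hε B hB.1 i hi).2.2 (hx.2 i hi))
    (fun i hi => (hε B' hB'.1 i hi).2.2 (hx'.2 i hi))

/-- A point of the cone stays in the cone when pushed along `q`. Conversely, a point in a half-open
piece has nonnegative coordinates and thus lies in the cone. -/
theorem mem_hull_iff_exists_halfOpenCone {u : I → V} {h : V →ₗ[ℝ] ℝ} (hpos : ∀ i, 0 < h (u i))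
    {c : Finset I → I → Module.Dual ℝ V} (hc : IsCoordSystem u c) {w : I → ℝ}
    (hw : IsGenericCost u c w) {q : V} (hq : IsGenericVec u c q)
    (hqK : q ∈ PointedCone.hull ℝ (Set.range u)) (x : V) :
    x ∈ PointedCone.hull ℝ (Set.range u) ↔
      ∃ B, IsOptimalBasis u c w B ∧ x ∈ halfOpenCone u c B fun i => 0 < c B i q := by
  rw [← eventually_mem_hull_iff hpos hc hw hq (mem_span_of_mem_hull hqK)]
  constructor
  · intro hx
    filter_upwards [self_mem_nhdsWithin] with ε hε
    exact Submodule.add_mem _ hx (PointedCone.smul_mem _ (le_of_lt hε) hqK)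
  · intro hx
    rw [eventually_mem_hull_iff hpos hc hw hq (mem_span_of_mem_hull hqK)] at hx
    obtain ⟨B, hB, hxW, hx⟩ := hx
    refine mem_hull_of_coord_nonneg hc hB.1 hxW fun i hi => ?_
    rcases hx i hi with h1 | h1
    · exact h1.le
    · exact h1.1.ge

/-- Relative interior points are those that can be moved slightly against an interior vector `q`.
This puts the interior into the form to which `eventually_mem_hull_iff` applies, with `-q` for `q`.
-/
theorem mem_relInt_iff_eventually {K : PointedCone ℝ V} {q : V} (hq : q ∈ relInt K) (x : V) :
    x ∈ relInt K ↔ ∀ᶠ ε in nhdsWithin (0 : ℝ) (Set.Ioi 0), x + ε • (-q) ∈ K := by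
  constructor
  · rintro ⟨hx, hx'⟩
    obtain ⟨δ, hδ, hδK⟩ := hx' q hq.1
    filter_upwards [Ioo_mem_nhdsGT hδ] with ε hε
    have h1 : x + ε • (-q) = (1 - ε / δ) • x + (ε / δ) • (x - δ • q) := by
      rw [smul_sub, smul_smul, div_mul_cancel₀ _ hδ.ne']
      module
    rw [h1]
    have h2 : ε / δ ≤ 1 := (div_le_one hδ).2 hε.2.le
    exact K.add_mem (PointedCone.smul_mem _ (by linarith) hx)
      (PointedCone.smul_mem _ (div_nonneg hε.1.le hδ.le) hδK)
  · intro hx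
    obtain ⟨ε, h1, h2⟩ := (hx.and self_mem_nhdsWithin).exists
    have h2 : 0 < ε := h2
    refine ⟨?_, fun y hy => ?_⟩
    · have : x = (x + ε • (-q)) + ε • q := by module
      rw [this]
      exact K.add_mem h1 (PointedCone.smul_mem _ h2.le hq.1)
    · obtain ⟨δ, hδ, hδK⟩ := hq.2 y hy
      refine ⟨ε * δ, mul_pos h2 hδ, ?_⟩
      have : x - (ε * δ) • y = (x + ε • (-q)) + ε • (q - δ • y) := by
        rw [smul_sub, smul_smul]
        module
      rw [this]
      exact K.add_mem h1 (PointedCone.smul_mem _ h2.le hδK)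

theorem mem_relInt_iff_exists_halfOpenCone {u : I → V} {h : V →ₗ[ℝ] ℝ} (hpos : ∀ i, 0 < h (u i))
    {c : Finset I → I → Module.Dual ℝ V} (hc : IsCoordSystem u c) {w : I → ℝ}
    (hw : IsGenericCost u c w) {q : V} (hq : IsGenericVec u c q)
    (hqK : q ∈ relInt (PointedCone.hull ℝ (Set.range u))) (x : V) :
    x ∈ relInt (PointedCone.hull ℝ (Set.range u)) ↔
      ∃ B, IsOptimalBasis u c w B ∧ x ∈ halfOpenCone u c B fun i => 0 < c B i (-q) := by
  rw [mem_relInt_iff_eventually hqK, eventually_mem_hull_iff hpos hc hw (q := -q)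
    (fun B hB i hi => by rw [map_neg]; exact neg_ne_zero.2 (hq B hB i hi))
    (Submodule.neg_mem _ (mem_span_of_mem_hull hqK.1))]

theorem sum_smul_mem_relInt (u : I → V) (w : I → ℝ) (hw : ∀ i, 0 < w i) :
    ∑ i, w i • u i ∈ relInt (PointedCone.hull ℝ (Set.range u)) := by
  refine ⟨(mem_hull_range_iff u _).2 ⟨w, fun i => (hw i).le, rfl⟩, fun y hy => ?_⟩
  obtain ⟨l, hl, rfl⟩ := (mem_hull_range_iff u y).1 hy
  have : ∀ᶠ δ in nhdsWithin (0 : ℝ) (Set.Ioi 0), ∀ i, 0 ≤ w i - δ * l i := by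
    rw [Filter.eventually_all]
    intro i
    have h1 : Filter.Tendsto (fun δ : ℝ => w i - δ * l i)
        (nhdsWithin (0 : ℝ) (Set.Ioi 0)) (nhds (w i - 0 * l i)) :=
      Filter.Tendsto.mono_left (Continuous.tendsto (by fun_prop) _) nhdsWithin_le_nhds
    rw [zero_mul, sub_zero] at h1
    exact (h1.eventually (lt_mem_nhds (hw i))).mono fun _ h => h.le
  obtain ⟨δ, h1, h2⟩ := (this.and self_mem_nhdsWithin).exists
  refine ⟨δ, h2, (mem_hull_range_iff u _).2 ⟨fun i => w i - δ * l i, h1, ?_⟩⟩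
  simp only [sub_smul, Finset.sum_sub_distrib, mul_smul, Finset.smul_sum]

/-- The half-open parallelepiped spanned by a basis, restricted only in the directions of `T`. -/
def halfOpenBox (u : I → V) (c : Finset I → I → Module.Dual ℝ V) (B : Finset I) (σ : I → Prop)
    (T : Finset I) : Set V :=
  {x | x ∈ halfOpenCone u c B σ ∧ ∀ i ∈ T, c B i x < 1 ∨ (c B i x = 1 ∧ ¬ σ i)}

theorem height_eq_sum {u : I → V} {c : Finset I → I → Module.Dual ℝ V}
    (hc : IsCoordSystem u c) {B : Finset I} (hB : IsSpanBasis u B) (h : V →ₗ[ℝ] ℝ) {x : V}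
    (hx : x ∈ Submodule.span ℝ (Set.range u)) : h x = ∑ i ∈ B, c B i x * h (u i) := by
  conv_lhs => rw [← hc.sum_eq hB hx]
  rw [map_sum]
  exact Finset.sum_congr rfl fun i _ => by rw [map_smul, smul_eq_mul]

theorem coord_nonneg_of_mem {u : I → V} {c : Finset I → I → Module.Dual ℝ V} {B : Finset I}
    {σ : I → Prop} {x : V} (hx : x ∈ halfOpenCone u c B σ) {i : I} (hi : i ∈ B) :
    0 ≤ c B i x := by
  rcases hx.2 i hi with h | h
  · exact h.le
  · exact h.1.ge

/-- Each factor `1 - t^{e j}` cuts the `j`-th coordinate down to a half-open unit interval by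
`genFun_mul_one_sub`. After all of `B`, only the points of the fundamental parallelepiped remain. -/
theorem genFun_halfOpenCone_mul_prod {u : I → V} {h : V →ₗ[ℝ] ℝ} {e : I → ℕ}
    (he : ∀ i, h (u i) = e i) {c : Finset I → I → Module.Dual ℝ V} (hc : IsCoordSystem u c)
    {B : Finset I} (hB : IsSpanBasis u B) (σ : I → Prop) (Λ : AddSubgroup V)
    (huΛ : ∀ i, u i ∈ Λ)
    (hfin : ∀ m : ℕ, ((PointedCone.hull ℝ (Set.range u) : Set V) ∩ Λ ∩ {x | h x = m}).Finite)
    (T : Finset I) (hT : T ⊆ B) :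
    genFun h (halfOpenCone u c B σ ∩ Λ) * ∏ i ∈ T, (1 - PowerSeries.X ^ e i) =
      genFun h (halfOpenBox u c B σ T ∩ Λ) := by
  classical
  induction T using Finset.induction_on with
  | empty =>
    rw [Finset.prod_empty, mul_one]
    congr 2
    ext x
    simp [halfOpenBox]
  | insert j T hj ih =>
    have hjB : j ∈ B := hT (Finset.mem_insert_self j T)
    rw [Finset.prod_insert hj, mul_comm (1 - _), ← mul_assoc,
      ih ((Finset.subset_insert j T).trans hT)]
    have hjW : u j ∈ Submodule.span ℝ (Set.range u) := Submodule.subset_span ⟨j, rfl⟩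
    have hne : ∀ i ∈ B, i ≠ j → c B i (u j) = 0 := fun i hi hij => (hc B hB).2 i hi j hjB hij
    have hjj : c B j (u j) = 1 := (hc B hB).1 j hjB
    apply genFun_mul_one_sub (he j)
    · rintro x ⟨⟨hx, -⟩, -⟩
      rw [height_eq_sum hc hB h hx.1]
      exact Finset.sum_nonneg fun i hi => mul_nonneg (coord_nonneg_of_mem hx hi)
        (by rw [he]; positivity)
    · intro m
      refine (hfin m).subset ?_
      rintro x ⟨⟨⟨hx, -⟩, hxΛ⟩, hxm⟩
      exact ⟨⟨mem_hull_of_coord_nonneg hc hB hx.1 fun i hi => coord_nonneg_of_mem hx hi, hxΛ⟩, hxm⟩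
    · rintro x ⟨⟨hx, hxT⟩, hxΛ⟩
      refine ⟨⟨⟨Submodule.add_mem _ hx.1 hjW, fun i hi => ?_⟩, fun i hi => ?_⟩,
        Λ.add_mem hxΛ (huΛ j)⟩
      · rw [map_add]
        by_cases hij : i = j
        · subst hij
          left
          rw [hjj]
          linarith [coord_nonneg_of_mem hx hi]
        · rw [hne i hi hij, add_zero]
          exact hx.2 i hi
      · rw [map_add, hne i (hT (Finset.mem_insert_of_mem hi)) (fun h => hj (h ▸ hi)), add_zero]
        exact hxT i hi
    · intro x
      have h1 : c B j (x - u j) = c B j x - 1 := by rw [map_sub, hjj]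
      have h2 : ∀ i ∈ B, i ≠ j → c B i (x - u j) = c B i x := fun i hi hij => by
        rw [map_sub, hne i hi hij, sub_zero]
      constructor
      · rintro ⟨⟨hx, hxT⟩, hxΛ⟩
        refine ⟨⟨⟨hx, fun i hi => hxT i (Finset.mem_insert_of_mem hi)⟩, hxΛ⟩, ?_⟩
        rintro ⟨⟨hx', -⟩, -⟩
        have h3 := hx'.2 j hjB
        rw [h1] at h3
        rcases hxT j (Finset.mem_insert_self j T) with h4 | h4
        · rcases h3 with h3 | h3
          · linarith
          · linarith [h3.1]
        · rcases h3 with h3 | h3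
          · linarith [h4.1]
          · exact h4.2 h3.2
      · rintro ⟨⟨⟨hx, hxT⟩, hxΛ⟩, hx'⟩
        refine ⟨⟨hx, fun i hi => ?_⟩, hxΛ⟩
        rcases Finset.mem_insert.1 hi with rfl | hi
        · by_contra hcon
          rw [not_or, not_and_not_right, not_lt] at hcon
          refine hx' ⟨⟨⟨Submodule.sub_mem _ hx.1 hjW, fun k hk => ?_⟩, fun k hk => ?_⟩,
            Λ.sub_mem hxΛ (huΛ i)⟩
          · by_cases hki : k = i
            · subst hki
              rw [h1]
              rcases hcon.1.lt_or_eq with h3 | h3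
              · left; linarith
              · right; exact ⟨by linarith, hcon.2 h3.symm⟩
            · rw [h2 k hk hki]
              exact hx.2 k hk
          · rw [h2 k (hT (Finset.mem_insert_of_mem hk)) (fun h => hj (h ▸ hk))]
            exact hxT k hk
        · exact hxT i hi

/-- The generating polynomial of the half-open parallelepiped. -/
def boxPoly (h : V →ₗ[ℝ] ℝ) (A : Set V) (E : ℕ) : Polynomial ℂ :=
  ∑ m ∈ Finset.range (E + 1), Polynomial.C ((A ∩ {x | h x = m}).ncard : ℂ) * Polynomial.X ^ m

theorem coeff_boxPoly (h : V →ₗ[ℝ] ℝ) (A : Set V) (E m : ℕ) :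
    (boxPoly h A E).coeff m = if m ≤ E then ((A ∩ {x | h x = m}).ncard : ℂ) else 0 := by
  simp [boxPoly, Polynomial.coeff_X_pow]

theorem natDegree_boxPoly_le (h : V →ₗ[ℝ] ℝ) (A : Set V) (E : ℕ) :
    (boxPoly h A E).natDegree ≤ E := by
  rw [Polynomial.natDegree_le_iff_coeff_eq_zero]
  intro m hm
  rw [coeff_boxPoly, if_neg (by omega)]

theorem coe_boxPoly {h : V →ₗ[ℝ] ℝ} {A : Set V} {E : ℕ} (hA : ∀ x ∈ A, h x ≤ E) :
    (boxPoly h A E : PowerSeries ℂ) = genFun h A := by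
  ext m
  rw [Polynomial.coeff_coe, coeff_boxPoly, coeff_genFun]
  split_ifs with hm
  · rfl
  · have : A ∩ {x | h x = m} = ∅ := by
      ext x
      simp only [Set.mem_inter_iff, Set.mem_ofPred_eq, Set.mem_empty_iff_false, iff_false, not_and]
      intro h1 h2
      have h3 := hA x h1
      rw [h2] at h3
      exact hm (by exact_mod_cast h3)
    rw [this]
    simp

/-- The point reflection `x ↦ ∑_{i ∈ B} u i - x` preserves `Λ`, sends height `m` to `E - m`, and
interchanges included and excluded facets of the parallelepiped. -/
theorem reflect_boxPoly {u : I → V} {h : V →ₗ[ℝ] ℝ} {e : I → ℕ}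
    (he : ∀ i, h (u i) = e i) {c : Finset I → I → Module.Dual ℝ V} (hc : IsCoordSystem u c)
    {B : Finset I} (hB : IsSpanBasis u B) (σ : I → Prop) (Λ : AddSubgroup V)
    (huΛ : ∀ i, u i ∈ Λ) :
    (boxPoly h (halfOpenBox u c B σ B ∩ Λ) (∑ i ∈ B, e i)).reflect (∑ i ∈ B, e i) =
      boxPoly h (halfOpenBox u c B (fun i => ¬ σ i) B ∩ Λ) (∑ i ∈ B, e i) := by
  classical
  set E := ∑ i ∈ B, e i with hE
  set s : V := ∑ i ∈ B, u i with hs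
  have hcs : ∀ i ∈ B, c B i s = 1 := by
    intro i hi
    have := hc.coord_sum hB hi (fun _ => 1)
    simpa [hs] using this
  have hsW : s ∈ Submodule.span ℝ (Set.range u) :=
    Submodule.sum_mem _ fun i _ => Submodule.subset_span ⟨i, rfl⟩
  have hsΛ : s ∈ Λ := AddSubgroup.sum_mem _ fun i _ => huΛ i
  have hhs : h s = E := by
    rw [hs, map_sum, hE]
    push_cast
    exact Finset.sum_congr rfl fun i _ => he i
  ext m
  rw [Polynomial.coeff_reflect, coeff_boxPoly, coeff_boxPoly]
  by_cases hm : m ≤ E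
  swap
  · rw [if_neg hm, Polynomial.revAt_eq_self_of_lt (by omega), if_neg hm]
  rw [Polynomial.revAt_le hm, if_pos hm, if_pos (Nat.sub_le E m)]
  congr 1
  have hinj : Function.Injective fun x : V => s - x := sub_right_injective
  rw [← Set.ncard_image_of_injective _ hinj]
  congr 1
  have key : ∀ (τ : I → Prop) x, x ∈ halfOpenBox u c B τ B ∩ Λ →
      s - x ∈ halfOpenBox u c B (fun i => ¬ τ i) B ∩ Λ := by
    rintro τ x ⟨⟨hx, hx'⟩, hxΛ⟩
    refine ⟨⟨⟨Submodule.sub_mem _ hsW hx.1, fun i hi => ?_⟩, fun i hi => ?_⟩, Λ.sub_mem hsΛ hxΛ⟩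
    · rw [map_sub, hcs i hi]
      rcases hx' i hi with h1 | h1
      · left; linarith
      · right; exact ⟨by linarith [h1.1], h1.2⟩
    · rw [map_sub, hcs i hi]
      rcases hx.2 i hi with h1 | h1
      · left; linarith
      · right; exact ⟨by linarith [h1.1], not_not.2 h1.2⟩
  ext y
  constructor
  · rintro ⟨x, ⟨hx, hxm⟩, rfl⟩
    refine ⟨key _ _ hx, ?_⟩
    have hxm' : h x = ((E - m : ℕ) : ℝ) := hxm
    simp only [Set.mem_ofPred_eq, map_sub, hhs, hxm', Nat.cast_sub hm]
    ring
  · rintro ⟨hy, hym⟩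
    refine ⟨s - y, ⟨?_, ?_⟩, sub_sub_cancel s y⟩
    · have := key _ _ hy
      simpa only [not_not] using this
    · have hym' : h y = m := hym
      simp only [Set.mem_ofPred_eq, map_sub, hhs, hym', Nat.cast_sub hm]

theorem invHom_X : invHom RatFunc.X = (RatFunc.X)⁻¹ := by
  rw [invHom, RatFunc.liftRingHom_X]
  simp

theorem X_pow_mul_invHom_prod (B : Finset I) (e : I → ℕ) :
    RatFunc.X ^ (∑ i ∈ B, e i) * invHom (∏ i ∈ B, (1 - RatFunc.X ^ e i)) =
      (-1) ^ B.card * ∏ i ∈ B, (1 - (RatFunc.X : RatFunc ℂ) ^ e i) := by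
  rw [map_prod, ← Finset.prod_pow_eq_pow_sum, ← Finset.prod_mul_distrib, ← Finset.prod_const,
    ← Finset.prod_mul_distrib]
  refine Finset.prod_congr rfl fun i _ => ?_
  have h : (RatFunc.X : RatFunc ℂ) ^ e i ≠ 0 := pow_ne_zero _ RatFunc.X_ne_zero
  rw [map_sub, map_one, map_pow, invHom_X, mul_sub, mul_one, inv_pow, mul_inv_cancel₀ h]
  ring

/-- Reciprocity for half-open simplicial cones. -/
theorem halfOpenCone_reciprocity {u : I → V} {h : V →ₗ[ℝ] ℝ} {e : I → ℕ}
    (he : ∀ i, h (u i) = e i) (hpos : ∀ i, 0 < e i) {c : Finset I → I → Module.Dual ℝ V}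
    (hc : IsCoordSystem u c) {B : Finset I} (hB : IsSpanBasis u B) (Λ : AddSubgroup V)
    (huΛ : ∀ i, u i ∈ Λ)
    (hfin : ∀ m : ℕ, ((PointedCone.hull ℝ (Set.range u) : Set V) ∩ Λ ∩ {x | h x = m}).Finite)
    (σ : I → Prop) :
    ∃ f, Expands (genFun h (halfOpenCone u c B σ ∩ Λ)) f ∧
      Expands (genFun h (halfOpenCone u c B (fun i => ¬ σ i) ∩ Λ)) ((-1) ^ B.card * invHom f) := by
  set E := ∑ i ∈ B, e i with hE
  set D : Polynomial ℂ := ∏ i ∈ B, (1 - Polynomial.X ^ e i) with hD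
  have hD0 : D ≠ 0 := by
    rw [hD, Finset.prod_ne_zero_iff]
    intro i _ h0
    have := congrArg (Polynomial.eval 0) h0
    simp [(hpos i).ne'] at this
  have hDcoe : (D : PowerSeries ℂ) = ∏ i ∈ B, (1 - PowerSeries.X ^ e i) := by
    rw [hD, ← Polynomial.coeToPowerSeries.ringHom_apply, map_prod]
    simp
  have hbox : ∀ τ : I → Prop, ∀ x ∈ halfOpenBox u c B τ B ∩ Λ, h x ≤ E := by
    rintro τ x ⟨⟨hx, hx'⟩, -⟩
    rw [height_eq_sum hc hB h hx.1, hE]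
    push_cast
    refine Finset.sum_le_sum fun i hi => ?_
    rw [he]
    refine mul_le_of_le_one_left (by positivity) ?_
    rcases hx' i hi with h1 | h1
    · exact h1.le
    · exact h1.1.le
  have hexp : ∀ τ : I → Prop, Expands (genFun h (halfOpenCone u c B τ ∩ Λ))
      (algebraMap _ (RatFunc ℂ) (boxPoly h (halfOpenBox u c B τ B ∩ Λ) E) /
        algebraMap _ (RatFunc ℂ) D) := by
    intro τ
    apply Expands.of_mul_eq hD0
    rw [hDcoe, genFun_halfOpenCone_mul_prod he hc hB τ Λ huΛ hfin B subset_rfl,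
      coe_boxPoly (hbox τ)]
  refine ⟨_, hexp σ, ?_⟩
  have hDmap : algebraMap _ (RatFunc ℂ) D = ∏ i ∈ B, (1 - (RatFunc.X : RatFunc ℂ) ^ e i) := by
    rw [hD, map_prod]
    simp
  have h1 := X_pow_mul_invHom _ E (natDegree_boxPoly_le h (halfOpenBox u c B σ B ∩ Λ) E)
  rw [reflect_boxPoly he hc hB σ Λ huΛ] at h1
  have h2 := X_pow_mul_invHom_prod B e
  rw [← hDmap] at h2
  have hX : (RatFunc.X : RatFunc ℂ) ^ E ≠ 0 := pow_ne_zero _ RatFunc.X_ne_zero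
  -- Inversion reflects the numerator, which flips `σ`, and multiplies the denominator by
  -- `(-1)^|B|`; the powers of `t` cancel.
  have h3 : (-1) ^ B.card * invHom (algebraMap _ (RatFunc ℂ)
      (boxPoly h (halfOpenBox u c B σ B ∩ Λ) E) / algebraMap _ (RatFunc ℂ) D) =
      algebraMap _ (RatFunc ℂ) (boxPoly h (halfOpenBox u c B (fun i => ¬ σ i) B ∩ Λ) E) /
        algebraMap _ (RatFunc ℂ) D := by
    rw [map_div₀, ← mul_div_mul_left (invHom _) (invHom (algebraMap _ (RatFunc ℂ) D)) hX, h1, h2,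
      mul_div_assoc', mul_div_mul_left _ _ (pow_ne_zero _ (neg_ne_zero.2 one_ne_zero))]
  rw [h3]
  exact hexp _

theorem card_isSpanBasis {u : I → V} {B : Finset I} (hB : IsSpanBasis u B) :
    B.card = dim (PointedCone.hull ℝ (Set.range u)) := by
  rw [dim, linSpan_hull, ← hB.2]
  have hli : LinearIndependent ℝ (fun i : (B : Set I) => u i) := hB.1
  have := finrank_span_eq_card hli
  rw [show Set.range (fun i : (B : Set I) => u i) = u '' (B : Set I) by
    ext; simp] at this
  rw [this]
  simp

theorem genFun_eq_sum {J : Type*} (T : Finset J) {h : V →ₗ[ℝ] ℝ} {A : Set V}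
    (H : J → Set V) (hA : ∀ x, x ∈ A ↔ ∃ j ∈ T, x ∈ H j)
    (hfin : ∀ m : ℕ, (A ∩ {x | h x = m}).Finite)
    (hu : ∀ i ∈ T, ∀ j ∈ T, ∀ x, x ∈ H i → x ∈ H j → i = j) :
    genFun h A = ∑ j ∈ T, genFun h (H j) := by
  classical
  ext m
  rw [map_sum]
  simp only [coeff_genFun]
  rw [← Nat.cast_sum]
  congr 1
  have hfin' : ∀ j ∈ T, (H j ∩ {x | h x = m}).Finite := fun j hj =>
    (hfin m).subset fun x hx => ⟨(hA x).2 ⟨j, hj, hx.1⟩, hx.2⟩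
  have h1 : A ∩ {x | h x = m} = ⋃ j ∈ T, (H j ∩ {x | h x = m}) := by
    ext x
    simp only [Set.mem_inter_iff, Set.mem_iUnion, hA, exists_prop]
    constructor
    · rintro ⟨⟨j, hj, hx⟩, hm⟩
      exact ⟨j, hj, hx, hm⟩
    · rintro ⟨j, hj, hx, hm⟩
      exact ⟨⟨j, hj, hx⟩, hm⟩
  rw [h1]
  clear hA h1 hfin
  induction T using Finset.induction_on with
  | empty => simp
  | insert j T hj ih =>
    rw [Finset.set_biUnion_insert, Finset.sum_insert hj, Set.ncard_union_eq (t := ⋃ i ∈ T, H i ∩ {x | h x = m}) ?_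
      (hfin' j (Finset.mem_insert_self j T))
      (Set.Finite.biUnion (Finset.finite_toSet T) fun i hi => hfin' i (Finset.mem_insert_of_mem hi)), ih]
    · exact fun i hi k hk => hu i (Finset.mem_insert_of_mem hi) k (Finset.mem_insert_of_mem hk)
    · exact fun i hi => hfin' i (Finset.mem_insert_of_mem hi)
    · rw [Set.disjoint_left]
      rintro x hx hx'
      simp only [Set.mem_iUnion, exists_prop] at hx'
      obtain ⟨i, hi, hx'⟩ := hx'
      have := hu j (Finset.mem_insert_self j T) i (Finset.mem_insert_of_mem hi) x hx.1 hx'.1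
      exact hj (this ▸ hi)

/-- Reciprocity for the lattice points of a finitely generated cone. -/
theorem cone_reciprocity {u : I → V} {h : V →ₗ[ℝ] ℝ} {e : I → ℕ}
    (he : ∀ i, h (u i) = e i) (hpos : ∀ i, 0 < e i) (Λ : AddSubgroup V) (huΛ : ∀ i, u i ∈ Λ)
    (hfin : ∀ m : ℕ, ((PointedCone.hull ℝ (Set.range u) : Set V) ∩ Λ ∩ {x | h x = m}).Finite) :
    ∃ f, Expands (genFun h ((PointedCone.hull ℝ (Set.range u) : Set V) ∩ Λ)) f ∧
      Expands (genFun h (relInt (PointedCone.hull ℝ (Set.range u)) ∩ Λ))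
        ((-1) ^ dim (PointedCone.hull ℝ (Set.range u)) * invHom f) := by
  classical
  obtain ⟨c, hc⟩ := exists_coordSystem u
  obtain ⟨w, hw⟩ := exists_genericCost u c
  obtain ⟨v, hv, hq⟩ := exists_genericVec hc
  set q := ∑ i, v i • u i with hqdef
  have hqK : q ∈ relInt (PointedCone.hull ℝ (Set.range u)) := sum_smul_mem_relInt u v hv
  have hqW := mem_span_of_mem_hull hqK.1
  have hpos' : ∀ i, 0 < h (u i) := fun i => by rw [he]; exact_mod_cast hpos i
  set T : Finset (Finset I) := Finset.univ.filter (IsOptimalBasis u c w) with hT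
  have hTmem : ∀ B, B ∈ T ↔ IsOptimalBasis u c w B := fun B => by simp [hT]
  have hrec : ∀ B, IsOptimalBasis u c w B → ∃ f,
      Expands (genFun h (halfOpenCone u c B (fun i => 0 < c B i q) ∩ Λ)) f ∧
      Expands (genFun h (halfOpenCone u c B (fun i => 0 < c B i (-q)) ∩ Λ))
        ((-1) ^ dim (PointedCone.hull ℝ (Set.range u)) * invHom f) := by
    intro B hB
    obtain ⟨f, h1, h2⟩ := halfOpenCone_reciprocity he hpos hc hB.1 Λ huΛ hfin
      (fun i => 0 < c B i q)
    refine ⟨f, h1, ?_⟩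
    rw [card_isSpanBasis hB.1] at h2
    -- As no coordinate of `q` vanishes, the facets with `c B i (-q) > 0` are exactly those without
    -- `c B i q > 0`. The same optimal bases therefore serve the cone and its interior.
    convert h2 using 3
    ext x
    refine and_congr Iff.rfl (forall₂_congr fun i hi => or_congr Iff.rfl (and_congr Iff.rfl ?_))
    simp only [map_neg, neg_pos, not_lt]
    exact ⟨fun h => h.le, fun h => lt_of_le_of_ne h (hq B hB.1 i hi)⟩
  choose! f hf hf' using hrec
  refine ⟨∑ B ∈ T, f B, ?_, ?_⟩
  · rw [genFun_eq_sum T (fun B => halfOpenCone u c B (fun i => 0 < c B i q) ∩ Λ)]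
    · exact Expands.sum T fun B hB => hf B ((hTmem B).1 hB)
    · intro x
      rw [Set.mem_inter_iff, SetLike.mem_coe,
        mem_hull_iff_exists_halfOpenCone hpos' hc hw hq hqK.1]
      constructor
      · rintro ⟨⟨B, hB, hx⟩, hxΛ⟩
        exact ⟨B, (hTmem B).2 hB, hx, hxΛ⟩
      · rintro ⟨B, hB, hx, hxΛ⟩
        exact ⟨⟨B, (hTmem B).1 hB, hx⟩, hxΛ⟩
    · exact hfin
    · intro B hB B' hB' x hx hx'
      exact halfOpenCone_unique hc hq hqW ((hTmem B).1 hB) ((hTmem B').1 hB') hx.1 hx'.1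
  · rw [map_sum, Finset.mul_sum, genFun_eq_sum T (fun B => halfOpenCone u c B (fun i => 0 < c B i (-q)) ∩ Λ)]
    · exact Expands.sum T fun B hB => hf' B ((hTmem B).1 hB)
    · intro x
      rw [Set.mem_inter_iff, mem_relInt_iff_exists_halfOpenCone hpos' hc hw hq hqK]
      constructor
      · rintro ⟨⟨B, hB, hx⟩, hxΛ⟩
        exact ⟨B, (hTmem B).2 hB, hx, hxΛ⟩
      · rintro ⟨B, hB, hx, hxΛ⟩
        exact ⟨⟨B, (hTmem B).1 hB, hx⟩, hxΛ⟩
    · exact fun m => (hfin m).subset fun x hx => ⟨⟨hx.1.1.1, hx.1.2⟩, hx.2⟩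
    · intro B hB B' hB' x hx hx'
      exact halfOpenCone_unique hc (q := -q)
        (fun B hB i hi => by rw [map_neg]; exact neg_ne_zero.2 (hq B hB i hi))
        (Submodule.neg_mem _ hqW) ((hTmem B).1 hB) ((hTmem B').1 hB') hx.1 hx'.1

end Reciprocity

end EquivariantCone

namespace EquivariantCone

/-! ## Faces -/

section Faces

variable {V : Type*} [AddCommGroup V] [Module ℝ V]

/-- The smallest face containing a point. -/
def minFace (K : PointedCone ℝ V) (x : V) (hx : x ∈ K) : PointedCone ℝ V where
  carrier := {y | y ∈ K ∧ ∃ δ : ℝ, 0 < δ ∧ x - δ • y ∈ K}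
  add_mem' := by
    rintro a b ⟨ha, δ, hδ, h1⟩ ⟨hb, δ', hδ', h2⟩
    -- With this constant the new point is a convex combination of `x - δ a` and `x - δ' b`.
    refine ⟨K.add_mem ha hb, δ * δ' / (δ + δ'), by positivity, ?_⟩
    have h0 : δ + δ' ≠ 0 := by positivity
    have : x - (δ * δ' / (δ + δ')) • (a + b) =
        (δ' / (δ + δ')) • (x - δ • a) + (δ / (δ + δ')) • (x - δ' • b) := by
      match_scalars <;> field_simp
      ring
    rw [this]
    exact K.add_mem (PointedCone.smul_mem _ (by positivity) h1)
      (PointedCone.smul_mem _ (by positivity) h2)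
  zero_mem' := ⟨K.zero_mem, 1, one_pos, by simpa using hx⟩
  smul_mem' := by
    rintro ⟨r, hr⟩ a ⟨ha, δ, hδ, h1⟩
    -- Dividing by `r + 1` instead of `r` covers the case `r = 0`.
    refine ⟨PointedCone.smul_mem _ hr ha, δ / (r + 1), by positivity, ?_⟩
    have h0 : r + 1 ≠ 0 := by positivity
    have : x - (δ / (r + 1)) • (r • a) = (r / (r + 1)) • (x - δ • a) + (1 / (r + 1)) • x := by
      match_scalars <;> field_simp
    change x - (δ / (r + 1)) • (r • a) ∈ K
    rw [this]
    exact K.add_mem (PointedCone.smul_mem _ (by positivity) h1)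
      (PointedCone.smul_mem _ (by positivity) hx)

theorem self_mem_minFace {K : PointedCone ℝ V} {x : V} (hx : x ∈ K) : x ∈ minFace K x hx :=
  ⟨hx, 1, one_pos, by simp⟩

theorem minFace_isFaceOf {K : PointedCone ℝ V} {x : V} (hx : x ∈ K) :
    (minFace K x hx).IsFaceOf K := by
  refine PointedCone.IsFaceOf.of_mem_of_add_mem_left (fun y hy => hy.1) ?_
  rintro a b ha hb ⟨-, δ, hδ, h⟩
  refine ⟨ha, δ, hδ, ?_⟩
  have : x - δ • a = (x - δ • (a + b)) + δ • b := by module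
  rw [this]
  exact K.add_mem h (PointedCone.smul_mem _ hδ.le hb)

theorem minFace_le {K F : PointedCone ℝ V} (hF : F.IsFaceOf K) {x : V} (hx : x ∈ K) (hxF : x ∈ F) :
    minFace K x hx ≤ F := by
  rintro y ⟨hy, δ, hδ, h⟩
  refine hF.mem_of_smul_add_mem hy h hδ ?_
  rwa [add_sub_cancel]

/-- Being in the relative interior of `F` means having `F` as minimal face. Hence the relative
interiors of the faces partition the cone. -/
theorem minFace_eq_iff {K F : PointedCone ℝ V} (hF : F.IsFaceOf K) {x : V} (hx : x ∈ K) :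
    minFace K x hx = F ↔ x ∈ relInt F := by
  constructor
  · rintro rfl
    refine ⟨self_mem_minFace hx, ?_⟩
    rintro y ⟨hy, δ, hδ, h⟩
    refine ⟨δ, hδ, (minFace_isFaceOf hx).mem_of_add_mem_left h
      (PointedCone.smul_mem _ hδ.le hy) ?_⟩
    rw [sub_add_cancel]
    exact self_mem_minFace hx
  · rintro ⟨hxF, h⟩
    refine le_antisymm (minFace_le hF hx hxF) fun y hy => ?_
    obtain ⟨δ, hδ, h'⟩ := h y hy
    exact ⟨hF.le hy, δ, hδ, hF.le h'⟩

theorem mem_iff_exists_relInt {K : PointedCone ℝ V} (x : V) :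
    x ∈ K ↔ ∃ F : PointedCone ℝ V, F.IsFaceOf K ∧ x ∈ relInt F := by
  constructor
  · intro hx
    exact ⟨_, minFace_isFaceOf hx, (minFace_eq_iff (minFace_isFaceOf hx) hx).1 rfl⟩
  · rintro ⟨F, hF, hx⟩
    exact hF.le hx.1

theorem face_eq_of_relInt {K F F' : PointedCone ℝ V} (hF : F.IsFaceOf K) (hF' : F'.IsFaceOf K)
    {x : V} (hx : x ∈ relInt F) (hx' : x ∈ relInt F') : F = F' := by
  rw [← (minFace_eq_iff hF (hF.le hx.1)).2 hx, ← (minFace_eq_iff hF' (hF.le hx.1)).2 hx']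

/-- A face of a cone spanned by a set is spanned by a subset. -/
theorem face_eq_hull {S : Set V} {F : PointedCone ℝ V} (hF : F.IsFaceOf (PointedCone.hull ℝ S)) :
    F = PointedCone.hull ℝ (S ∩ F) := by
  apply le_antisymm
  · intro x hx
    have hx' := hF.le hx
    obtain ⟨T, hTS, hxT⟩ := Submodule.mem_span_finite_of_mem_span hx'
    rw [← Subtype.range_coe (s := (T : Set V)), mem_hull_range_iff] at hxT
    obtain ⟨l, hl, rfl⟩ := hxT
    refine Submodule.sum_mem _ fun i _ => ?_
    rcases (hl i).eq_or_lt with h0 | h0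
    · rw [← h0, zero_smul]
      exact Submodule.zero_mem _
    · refine PointedCone.smul_mem _ (hl i) (Submodule.subset_span ⟨hTS i.2, ?_⟩)
      exact hF.mem_of_sum_smul_mem (f := fun i : T => (i : V))
        (fun i => Submodule.subset_span (hTS i.2)) hl hx i h0
  · exact Submodule.span_le.2 fun x hx => hx.2

/-- By `face_eq_hull` a face is determined by the generators it contains. -/
theorem finite_faces {S : Set V} (hS : S.Finite) :
    {F : PointedCone ℝ V | F.IsFaceOf (PointedCone.hull ℝ S)}.Finite := by
  refine Set.Finite.of_finite_image (f := fun F : PointedCone ℝ V => S ∩ (F : Set V)) ?_ ?_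
  · exact hS.finite_subsets.subset (by rintro _ ⟨F, -, rfl⟩; exact Set.inter_subset_left)
  · intro F hF F' hF' h
    rw [face_eq_hull hF, face_eq_hull hF']
    exact congrArg _ h

/-- A cone spanned by finitely many points of `Λ` of positive integral heights, with finitely many
points of `Λ` of each height. -/
def IsGraded (h : V →ₗ[ℝ] ℝ) (Λ : AddSubgroup V) (K : PointedCone ℝ V) : Prop :=
  (∃ S : Finset V, (∀ s ∈ S, s ∈ Λ) ∧ (∀ s ∈ S, ∃ e : ℕ, 0 < e ∧ h s = e) ∧
    K = PointedCone.hull ℝ (S : Set V)) ∧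
  ∀ m : ℕ, ((K : Set V) ∩ Λ ∩ {x | h x = m}).Finite

theorem IsGraded.face {h : V →ₗ[ℝ] ℝ} {Λ : AddSubgroup V} {K F : PointedCone ℝ V}
    (hK : IsGraded h Λ K) (hF : F.IsFaceOf K) : IsGraded h Λ F := by
  classical
  obtain ⟨⟨S, hS, he, rfl⟩, hfin⟩ := hK
  refine ⟨⟨S.filter (· ∈ F), fun s hs => hS s (Finset.mem_filter.1 hs).1,
    fun s hs => he s (Finset.mem_filter.1 hs).1, ?_⟩, fun m => (hfin m).subset
      fun x hx => ⟨⟨hF.le hx.1.1, hx.1.2⟩, hx.2⟩⟩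
  conv_lhs => rw [face_eq_hull hF]
  congr 1
  ext x
  simp

theorem IsGraded.exists_reciprocity {h : V →ₗ[ℝ] ℝ} {Λ : AddSubgroup V} {K : PointedCone ℝ V}
    (hK : IsGraded h Λ K) : ∃ f, Expands (genFun h ((K : Set V) ∩ Λ)) f ∧
      Expands (genFun h (relInt K ∩ Λ)) ((-1) ^ dim K * invHom f) := by
  obtain ⟨⟨S, hS, he, rfl⟩, hfin⟩ := hK
  choose! e he0 he using he
  have hr : Set.range (fun s : S => (s : V)) = (S : Set V) := by simp
  rw [← hr] at hfin ⊢
  exact cone_reciprocity (u := fun s : S => (s : V)) (e := fun s => e s) (fun s => he s s.2)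
    (fun s => he0 s s.2) Λ (fun s => hS s s.2) hfin

/-- The rational function with a given expansion. -/
def toRat (s : PowerSeries ℂ) : RatFunc ℂ :=
  open Classical in if h : ∃ f, Expands s f then h.choose else 0

theorem expands_toRat {s : PowerSeries ℂ} {f : RatFunc ℂ} (h : Expands s f) :
    Expands s (toRat s) := by
  have h' : ∃ f, Expands s f := ⟨f, h⟩
  rw [toRat, dif_pos h']
  exact h'.choose_spec

theorem IsGraded.expands {h : V →ₗ[ℝ] ℝ} {Λ : AddSubgroup V} {K : PointedCone ℝ V}
    (hK : IsGraded h Λ K) :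
    Expands (genFun h ((K : Set V) ∩ Λ)) (toRat (genFun h ((K : Set V) ∩ Λ))) := by
  obtain ⟨f, h1, -⟩ := hK.exists_reciprocity
  exact expands_toRat h1

theorem IsGraded.expands_relInt {h : V →ₗ[ℝ] ℝ} {Λ : AddSubgroup V} {K : PointedCone ℝ V}
    (hK : IsGraded h Λ K) : Expands (genFun h (relInt K ∩ Λ))
      ((-1) ^ dim K * invHom (toRat (genFun h ((K : Set V) ∩ Λ)))) := by
  obtain ⟨f, h1, h2⟩ := hK.exists_reciprocity
  rwa [← h1.unique (expands_toRat h1)]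

theorem IsGraded.genFun_eq_sum {h : V →ₗ[ℝ] ℝ} {Λ : AddSubgroup V} {K : PointedCone ℝ V}
    (hK : IsGraded h Λ K) (T : Finset (PointedCone ℝ V)) (hT : ∀ F, F ∈ T ↔ F.IsFaceOf K) :
    genFun h ((K : Set V) ∩ Λ) = ∑ F ∈ T, genFun h (relInt F ∩ Λ) := by
  apply EquivariantCone.genFun_eq_sum
  · intro x
    rw [Set.mem_inter_iff, SetLike.mem_coe, mem_iff_exists_relInt]
    constructor
    · rintro ⟨⟨F, hF, hx⟩, hxΛ⟩
      exact ⟨F, (hT F).2 hF, hx, hxΛ⟩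
    · rintro ⟨F, hF, hx, hxΛ⟩
      exact ⟨⟨F, (hT F).1 hF, hx⟩, hxΛ⟩
  · exact hK.2
  · intro F hF F' hF' x hx hx'
    exact face_eq_of_relInt ((hT F).1 hF) ((hT F').1 hF') hx.1 hx'.1

/-- Reciprocity, summed over the faces of a cone. -/
theorem IsGraded.toRat_eq_sum {h : V →ₗ[ℝ] ℝ} {Λ : AddSubgroup V} {K : PointedCone ℝ V}
    (hK : IsGraded h Λ K) (T : Finset (PointedCone ℝ V)) (hT : ∀ F, F ∈ T ↔ F.IsFaceOf K) :
    toRat (genFun h ((K : Set V) ∩ Λ)) =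
      ∑ F ∈ T, (-1) ^ dim F * invHom (toRat (genFun h ((F : Set V) ∩ Λ))) := by
  apply hK.expands.unique
  rw [hK.genFun_eq_sum T hT]
  exact Expands.sum T fun F hF => (hK.face ((hT F).1 hF)).expands_relInt

theorem invHom_invHom (f : RatFunc ℂ) : invHom (invHom f) = f := by
  have h : ∀ p : Polynomial ℂ, invHom (invHom (algebraMap _ (RatFunc ℂ) p)) =
      algebraMap _ (RatFunc ℂ) p := by
    intro p
    have : (invHom.comp invHom).comp (algebraMap (Polynomial ℂ) (RatFunc ℂ)) =
        algebraMap (Polynomial ℂ) (RatFunc ℂ) := by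
      refine Polynomial.ringHom_ext (fun a => ?_) ?_
      · have h1 : invHom (RatFunc.C a) = RatFunc.C a := by
          rw [invHom, RatFunc.liftRingHom_C]
          simp
        simp only [RingHom.comp_apply, RatFunc.algebraMap_C, h1]
      · simp only [RingHom.comp_apply, RatFunc.algebraMap_X, invHom_X, map_inv₀, inv_inv]
    exact RingHom.congr_fun this p
  rw [← RatFunc.num_div_denom f, map_div₀, map_div₀, h, h]

theorem IsGraded.height_nonneg {h : V →ₗ[ℝ] ℝ} {Λ : AddSubgroup V} {K : PointedCone ℝ V}
    (hK : IsGraded h Λ K) {x : V} (hx : x ∈ K) : 0 ≤ h x ∧ (h x = 0 → x = 0) := by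
  obtain ⟨⟨S, -, he, rfl⟩, -⟩ := hK
  have hr : Set.range (fun s : S => (s : V)) = (S : Set V) := by simp
  rw [← hr, mem_hull_range_iff] at hx
  obtain ⟨l, hl, rfl⟩ := hx
  have hpos : ∀ s : S, 0 < h s := fun s => by
    obtain ⟨e, he0, he⟩ := he s s.2
    rw [he]
    exact_mod_cast he0
  simp only [map_sum, map_smul, smul_eq_mul]
  refine ⟨Finset.sum_nonneg fun s _ => mul_nonneg (hl s) (hpos s).le, fun h0 => ?_⟩
  rw [Finset.sum_eq_zero_iff_of_nonneg fun s _ => mul_nonneg (hl s) (hpos s).le] at h0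
  refine Finset.sum_eq_zero fun s hs => ?_
  rw [(mul_eq_zero.1 (h0 s hs)).resolve_right (hpos s).ne', zero_smul]

/-- Euler's relation for a nonzero graded cone. -/
theorem IsGraded.euler {h : V →ₗ[ℝ] ℝ} {Λ : AddSubgroup V} {K : PointedCone ℝ V}
    (hK : IsGraded h Λ K) (hK0 : K ≠ ⊥) (T : Finset (PointedCone ℝ V))
    (hT : ∀ F, F ∈ T ↔ F.IsFaceOf K) : ∑ F ∈ T, (-1 : ℂ) ^ dim F = 0 := by
  have h1 := congrArg invHom (hK.toRat_eq_sum T hT)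
  rw [map_sum] at h1
  simp only [map_mul, map_pow, map_neg, map_one, invHom_invHom] at h1
  have hsign : ∀ k : ℕ, Expands ((((-1 : Polynomial ℂ) ^ k : Polynomial ℂ)) : PowerSeries ℂ)
      ((-1) ^ k) := by
    intro k
    simpa using Expands.of_polynomial ((-1) ^ k)
  have h2 : Expands (∑ F ∈ T, (((-1 : Polynomial ℂ) ^ dim F : Polynomial ℂ) : PowerSeries ℂ) *
      genFun h ((F : Set V) ∩ Λ)) (invHom (toRat (genFun h ((K : Set V) ∩ Λ)))) := by
    rw [h1]
    exact Expands.sum T fun F hF => (hsign _).mul (hK.face ((hT F).1 hF)).expands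
  -- Up to the sign `(-1)^{dim K}`, the sum of `(-1)^{dim F}` times the generating functions of the
  -- faces is the generating function of the relative interior. The relation is its coefficient at
  -- height `0`.
  have h3 := ((hsign (dim K)).mul h2).series_unique hK.expands_relInt
  have h4 := congrArg (PowerSeries.coeff 0) h3
  have hz : ∀ F ∈ T, ((F : Set V) ∩ Λ ∩ {x | h x = ((0 : ℕ) : ℝ)}) = {0} := by
    intro F hF
    ext x
    simp only [Set.mem_inter_iff, SetLike.mem_coe, Set.mem_ofPred_eq, Nat.cast_zero,
      Set.mem_singleton_iff]
    constructor
    · rintro ⟨⟨hx, -⟩, hx0⟩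
      exact ((hK.face ((hT F).1 hF)).height_nonneg hx).2 hx0
    · rintro rfl
      exact ⟨⟨F.zero_mem, Λ.zero_mem⟩, map_zero h⟩
  -- If `0` were a relative interior point, each `y ∈ K` would have a negative multiple in `K`, and
  -- nonnegativity of heights would give `h y = 0`, so `y = 0`.
  have hz' : (relInt K ∩ Λ ∩ {x | h x = ((0 : ℕ) : ℝ)}) = ∅ := by
    ext x
    simp only [Set.mem_inter_iff, SetLike.mem_coe, Set.mem_ofPred_eq, Nat.cast_zero,
      Set.mem_empty_iff_false, iff_false, not_and]
    rintro ⟨hx, -⟩ hx0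
    have hx0 := (hK.height_nonneg hx.1).2 hx0
    subst hx0
    refine hK0 (eq_bot_iff.2 fun y hy => ?_)
    obtain ⟨δ, hδ, hy'⟩ := hx.2 y hy
    have h5 := (hK.height_nonneg hy').1
    rw [zero_sub, map_neg, map_smul, smul_eq_mul] at h5
    have h6 := hK.height_nonneg hy
    have h7 : h y = 0 := by
      have := mul_nonneg hδ.le h6.1
      have h8 : δ * h y = 0 := by linarith
      exact (mul_eq_zero.1 h8).resolve_left hδ.ne'
    exact h6.2 h7
  simp only [PowerSeries.coeff_zero_eq_constantCoeff, map_mul, map_sum] at h4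
  simp only [← PowerSeries.coeff_zero_eq_constantCoeff_apply, coeff_genFun, hz',
    Polynomial.coeff_coe, Set.ncard_empty] at h4
  rw [Finset.sum_congr rfl fun F hF => by rw [hz F hF, Set.ncard_singleton]] at h4
  have h5 : ∀ k : ℕ, ((-1 : Polynomial ℂ) ^ k).coeff 0 = (-1) ^ k := by
    intro k
    rw [Polynomial.coeff_zero_eq_eval_zero]
    simp
  simp only [h5, Nat.cast_one, mul_one, Nat.cast_zero] at h4
  exact (mul_eq_zero.1 h4).resolve_left (pow_ne_zero _ (neg_ne_zero.2 one_ne_zero))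

end Faces

end EquivariantCone

namespace EquivariantCone

/-! ## Separation and Euler's relation for intervals of faces -/

section Separation

/-- Gordan's alternative: the hypothesis says that `0` is outside the closed convex hull of the
vectors, and Hahn–Banach separates it strictly. -/
theorem exists_pos_functional_pi {n : ℕ} {I : Type*} [Finite I] (v : I → Fin n → ℝ)
    (hv : ∀ l : I → ℝ, (∀ i, 0 ≤ l i) → ∑ᶠ i, l i • v i = 0 → l = 0) :
    ∃ a : Fin n → ℝ, ∀ i, 0 < ∑ j, a j * v i j := by
  classical
  have := Fintype.ofFinite I
  have h0 : (0 : Fin n → ℝ) ∉ convexHull ℝ (Set.range v) := by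
    intro h0
    rw [convexHull_range_eq_exists_affineCombination] at h0
    obtain ⟨s, w, hw, hw1, hs⟩ := h0
    rw [Finset.affineCombination_eq_linear_combination _ _ _ hw1] at hs
    have h1 := hv (fun i => if i ∈ s then w i else 0)
      (fun i => by split_ifs with hi; exacts [hw i hi, le_rfl]) (by
        rw [finsum_eq_sum_of_fintype, ← hs]
        simp [ite_smul, Finset.sum_ite_mem])
    have h2 : ∑ i ∈ s, w i = 0 := by
      refine Finset.sum_eq_zero fun i hi => ?_
      have := congrFun h1 i
      simpa [hi] using this
    rw [hw1] at h2
    exact one_ne_zero h2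
  have hclosed : IsClosed (convexHull ℝ (Set.range v)) :=
    (Set.finite_range v).isClosed_convexHull ℝ
  obtain ⟨f, r, hf0, hf⟩ := geometric_hahn_banach_point_closed (convex_convexHull ℝ _) hclosed h0
  rw [map_zero] at hf0
  refine ⟨fun j => f (Pi.single j 1), fun i => ?_⟩
  have h1 := hf (v i) (subset_convexHull ℝ _ ⟨i, rfl⟩)
  have h2 : f (v i) = ∑ j, f (Pi.single j 1) * v i j := by
    conv_lhs => rw [pi_eq_sum_univ' (v i)]
    rw [map_sum]
    refine Finset.sum_congr rfl fun j _ => ?_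
    rw [map_smul, smul_eq_mul, mul_comm]
  rw [← h2]
  exact hf0.trans h1

theorem exists_pos_functional {V : Type*} [AddCommGroup V] [Module ℝ V] [FiniteDimensional ℝ V]
    {I : Type*} [Finite I] (v : I → V)
    (hv : ∀ l : I → ℝ, (∀ i, 0 ≤ l i) → ∑ᶠ i, l i • v i = 0 → l = 0) :
    ∃ f : Module.Dual ℝ V, ∀ i, 0 < f (v i) := by
  have := Fintype.ofFinite I
  set b := Module.finBasis ℝ V
  obtain ⟨a, ha⟩ := exists_pos_functional_pi (fun i => b.equivFun (v i)) fun l hl h => by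
    refine hv l hl (b.equivFun.injective ?_)
    rw [finsum_eq_sum_of_fintype] at h ⊢
    simpa using h
  refine ⟨∑ j, a j • b.coord j, fun i => ?_⟩
  have := ha i
  simpa using this

/-- Positivity on finitely many vectors is an open condition, so a rational functional satisfies it;
multiplying by the product of the denominators makes it integral. -/
theorem exists_pos_int_functional {n : ℕ} {I : Type*} [Finite I] (z : I → Fin n → ℤ)
    (hz : ∀ l : I → ℝ, (∀ i, 0 ≤ l i) → ∑ᶠ i, l i • intVec (z i) = 0 → l = 0) :
    ∃ (f : (Fin n → ℝ) →ₗ[ℝ] ℝ) (e : I → ℕ), ∀ i, 0 < e i ∧ f (intVec (z i)) = e i := by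
  obtain ⟨a, ha⟩ := exists_pos_functional_pi (fun i => intVec (z i)) hz
  have hopen : IsOpen {a : Fin n → ℝ | ∀ i, 0 < ∑ j, a j * intVec (z i) j} := by
    rw [Set.ofPred_forall]
    refine isOpen_iInter_of_finite fun i => isOpen_lt continuous_const (by fun_prop)
  have hdense : DenseRange (fun (q : Fin n → ℚ) (j : Fin n) => (q j : ℝ)) :=
    DenseRange.piMap fun _ => Rat.denseRange_cast
  obtain ⟨q, hq⟩ := hdense.exists_mem_open hopen ⟨a, ha⟩
  set N : ℕ := ∏ j, (q j).den with hN
  have hN0 : 0 < N := Finset.prod_pos fun j _ => (q j).pos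
  have hint : ∀ j, ∃ c : ℤ, (c : ℝ) = N * q j := by
    intro j
    obtain ⟨M, hM⟩ : (q j).den ∣ N := Finset.dvd_prod_of_mem _ (Finset.mem_univ j)
    refine ⟨M * (q j).num, ?_⟩
    have h1 : ((q j).num : ℚ) = q j * (q j).den := (Rat.mul_den_eq_num (q j)).symm
    have h2 : ((q j).num : ℝ) = q j * (q j).den := by exact_mod_cast h1
    rw [hM]
    push_cast
    rw [h2]
    ring
  choose c hc using hint
  have hpos : ∀ i, 0 < ∑ j, c j * z i j := by
    intro i
    have h1 : ((∑ j, c j * z i j : ℤ) : ℝ) = N * ∑ j, (q j : ℝ) * intVec (z i) j := by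
      push_cast
      rw [Finset.mul_sum]
      refine Finset.sum_congr rfl fun j _ => ?_
      rw [hc, intVec]
      ring
    have h2 : (0 : ℝ) < ((∑ j, c j * z i j : ℤ) : ℝ) := by
      rw [h1]
      exact mul_pos (by exact_mod_cast hN0) (hq i)
    exact_mod_cast h2
  refine ⟨∑ j, (c j : ℝ) • LinearMap.proj j, fun i => (∑ j, c j * z i j).toNat, fun i => ⟨?_, ?_⟩⟩
  · exact Int.lt_toNat.2 (by simpa using hpos i)
  · have h1 : (((∑ j, c j * z i j).toNat : ℤ) : ℝ) = ((∑ j, c j * z i j : ℤ) : ℝ) := by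
      rw [Int.toNat_of_nonneg (hpos i).le]
    rw [Int.cast_natCast] at h1
    rw [h1]
    push_cast
    simp [intVec]

variable {V : Type*} [AddCommGroup V] [Module ℝ V]

/-- The generators of a cone outside a face satisfy no nonnegative relation modulo the span of the
face. -/
theorem eq_zero_of_sum_mem_linSpan {K A : PointedCone ℝ V} (hA : A.IsFaceOf K) {I : Type*}
    [Fintype I] (u : I → V) (huK : ∀ i, u i ∈ K) (huA : ∀ i, u i ∉ A) (l : I → ℝ)
    (hl : ∀ i, 0 ≤ l i) (h : ∑ i, l i • u i ∈ linSpan A) : l = 0 := by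
  obtain ⟨a, ha, b, hb, hab⟩ := exists_sub_of_mem_linSpan A h
  have hsum : ∑ i, l i • u i ∈ A := by
    refine hA.mem_of_add_mem_left (y := b)
      (Submodule.sum_mem _ fun i _ => PointedCone.smul_mem _ (hl i) (huK i)) (hA.le hb) ?_
    rw [hab, sub_add_cancel]
    exact ha
  funext i
  by_contra hi
  exact huA i (hA.mem_of_sum_smul_mem huK hl hsum i (lt_of_le_of_ne (hl i) (Ne.symm hi)))

/-- A face of a finitely generated cone is exposed. -/
theorem exists_exposing [FiniteDimensional ℝ V] {S : Set V} (hS : S.Finite) {A : PointedCone ℝ V}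
    (hA : A.IsFaceOf (PointedCone.hull ℝ S)) :
    ∃ f : Module.Dual ℝ V, (∀ x ∈ A, f x = 0) ∧ ∀ s ∈ S, s ∉ A → 0 < f s := by
  have : Finite {s : V | s ∈ S ∧ s ∉ A} := (hS.subset fun s hs => hs.1).to_subtype
  have := Fintype.ofFinite {s : V | s ∈ S ∧ s ∉ A}
  obtain ⟨f, hf⟩ := exists_pos_functional
    (fun s : {s : V | s ∈ S ∧ s ∉ A} => (linSpan A).mkQ s.1) (fun l hl h => by
      rw [finsum_eq_sum_of_fintype] at h
      refine eq_zero_of_sum_mem_linSpan hA (fun s : {s : V | s ∈ S ∧ s ∉ A} => s.1)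
        (fun s => Submodule.subset_span s.2.1) (fun s => s.2.2) l hl ?_
      rw [← Submodule.ker_mkQ (linSpan A), LinearMap.mem_ker, map_sum]
      simpa only [map_smul] using h)
  refine ⟨f.comp (linSpan A).mkQ, fun x hx => ?_, fun s hs hsA => hf ⟨s, hs, hsA⟩⟩
  have : (linSpan A).mkQ x = 0 := by
    rw [← LinearMap.mem_ker, Submodule.ker_mkQ]
    exact Submodule.subset_span hx
  rw [LinearMap.comp_apply, this, map_zero]

end Separation

/-! ### Lattice points of bounded height and rational subspaces -/

section Lattice

/-- The lattice `ℤ^n` in `ℝ^n`. -/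
def intLattice (n : ℕ) : AddSubgroup (Fin n → ℝ) where
  carrier := Set.range intVec
  add_mem' := by
    rintro _ _ ⟨a, rfl⟩ ⟨b, rfl⟩
    exact ⟨a + b, by ext; simp [intVec]⟩
  zero_mem' := ⟨0, by ext; simp [intVec]⟩
  neg_mem' := by
    rintro _ ⟨a, rfl⟩
    exact ⟨-a, by ext; simp [intVec]⟩

/-- A nonnegative combination of the generators has coordinates bounded by a constant times its
height, and a box contains finitely many integer vectors. -/
theorem finite_intLattice_height {n : ℕ} {S : Set (Fin n → ℝ)} (hS : S.Finite)
    {h : (Fin n → ℝ) →ₗ[ℝ] ℝ} (hpos : ∀ s ∈ S, 0 < h s) (r : ℝ) :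
    ((PointedCone.hull ℝ S : Set (Fin n → ℝ)) ∩ intLattice n ∩ {x | h x = r}).Finite := by
  classical
  have := hS.to_subtype
  have := Fintype.ofFinite S
  obtain ⟨R, hR⟩ : ∃ R : ℝ, ∀ s : S, ∀ j, |(s : Fin n → ℝ) j| / h s ≤ R := by
    obtain ⟨R, hR⟩ := (Set.finite_range fun p : S × Fin n => |(p.1 : Fin n → ℝ) p.2| / h p.1).bddAbove
    exact ⟨R, fun s j => hR ⟨(s, j), rfl⟩⟩
  refine ((Set.finite_Icc (fun _ : Fin n => -⌈R * r⌉) (fun _ : Fin n => ⌈R * r⌉)).image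
    intVec).subset ?_
  rintro x ⟨⟨hx, z, rfl⟩, hxr⟩
  refine ⟨z, ?_, rfl⟩
  have hx : intVec z ∈ PointedCone.hull ℝ S := hx
  rw [← Subtype.range_coe (s := S), mem_hull_range_iff] at hx
  obtain ⟨l, hl, hlz⟩ := hx
  have hxr : h (intVec z) = r := hxr
  have habs : ∀ j, |(z j : ℝ)| ≤ R * r := by
    intro j
    have h1 : (z j : ℝ) = ∑ s : S, l s * (s : Fin n → ℝ) j := by
      have := congrFun hlz j
      simpa [intVec] using this.symm
    rw [h1, ← hxr, ← hlz, map_sum, Finset.mul_sum]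
    refine (Finset.abs_sum_le_sum_abs _ _).trans (Finset.sum_le_sum fun s _ => ?_)
    rw [abs_mul, abs_of_nonneg (hl s), map_smul, smul_eq_mul]
    have h2 := hR s j
    rw [div_le_iff₀ (hpos s s.2)] at h2
    calc l s * |(s : Fin n → ℝ) j| ≤ l s * (R * h s) := mul_le_mul_of_nonneg_left h2 (hl s)
      _ = _ := by ring
  constructor
  · intro j
    have h1 := (abs_le.1 (habs j)).1
    have h2 : -((⌈R * r⌉ : ℤ) : ℝ) ≤ z j := by linarith [Int.le_ceil (R * r)]
    exact_mod_cast h2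
  · intro j
    have h1 := (abs_le.1 (habs j)).2
    have h2 : (z j : ℝ) ≤ ((⌈R * r⌉ : ℤ) : ℝ) := by linarith [Int.le_ceil (R * r)]
    exact_mod_cast h2

/-- A subspace spanned by lattice vectors is the kernel of an integral linear map. -/
theorem exists_int_map_ker {n : ℕ} (A : Set (Fin n → ℝ)) (hA : A ⊆ intLattice n) :
    ∃ T : (Fin n → ℝ) →ₗ[ℝ] (Fin n → ℝ), (∀ z, ∃ z', T (intVec z) = intVec z') ∧
      LinearMap.ker T = Submodule.span ℝ A := by
  classical
  obtain ⟨s, hsA, hspan, hs⟩ := exists_linearIndependent ℝ A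
  have hs' : LinearIndepOn ℝ id s := hs
  have hsub : s ⊆ (intLattice n : Set (Fin n → ℝ)) := hsA.trans hA
  set t := hs'.extend hsub with ht
  have htli : LinearIndepOn ℝ id t := hs'.linearIndepOn_extend hsub
  have htli' : LinearIndependent ℝ (fun x : t => (x : Fin n → ℝ)) := htli
  have htspan : Submodule.span ℝ t = ⊤ := by
    have h1 := hs'.span_extend_eq_span hsub
    rw [ht, h1, eq_top_iff, ← (Pi.basisFun ℝ (Fin n)).span_eq]
    refine Submodule.span_mono ?_
    rintro _ ⟨j, rfl⟩
    refine ⟨Pi.single j 1, ?_⟩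
    ext i
    simp [intVec, Pi.single_apply]
  set b₀ : Module.Basis t ℝ (Fin n → ℝ) := Module.Basis.mk htli'
    (by simp [htspan]) with hb₀
  have hb₀' : ∀ x : t, b₀ x = x := fun x => by rw [hb₀, Module.Basis.mk_apply]
  have : Fintype t := FiniteDimensional.fintypeBasisIndex b₀
  have hcard : Fintype.card t = Fintype.card (Fin n) := by
    rw [← Module.finrank_eq_card_basis b₀]
    simp
  set ε : t ≃ Fin n := Fintype.equivOfCardEq hcard
  set b := b₀.reindex ε with hb
  have htint : ∀ x : t, ∃ z, intVec z = (x : Fin n → ℝ) := fun x => hs'.extend_subset hsub x.2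
  choose ζ hζ using htint
  have hbint : ∀ k, b k = intVec (ζ (ε.symm k)) := fun k => by
    rw [hb, Module.Basis.reindex_apply, hb₀', hζ]
  set M : Matrix (Fin n) (Fin n) ℤ := Matrix.of fun i k => ζ (ε.symm k) i with hM
  -- By Cramer's rule, `det M` clears the denominators of the coordinates of lattice vectors in the
  -- basis `b`.
  have hcramer : ∀ z k, (M.det : ℝ) * b.repr (intVec z) k = ((M.adjugate.mulVec z k : ℤ) : ℝ) := by
    intro z k
    have h1 : (M.map (Int.cast : ℤ → ℝ)).mulVec (b.repr (intVec z)) = intVec z := by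
      ext i
      have h2 := congrFun (b.sum_repr (intVec z)) i
      rw [← h2]
      simp only [Matrix.mulVec, dotProduct, Matrix.map_apply, hM, Matrix.of_apply,
        Finset.sum_apply, Pi.smul_apply, smul_eq_mul, hbint, intVec]
      exact Finset.sum_congr rfl fun k _ => mul_comm _ _
    have h2 := congrArg (M.adjugate.map (Int.cast : ℤ → ℝ)).mulVec h1
    rw [Matrix.mulVec_mulVec] at h2
    have h3 : M.adjugate.map (Int.cast : ℤ → ℝ) * M.map (Int.cast : ℤ → ℝ) =
        (M.det : ℝ) • (1 : Matrix (Fin n) (Fin n) ℝ) := by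
      have h4 := congrArg (Int.castRingHom ℝ).mapMatrix (Matrix.adjugate_mul M)
      rw [map_mul] at h4
      simp only [RingHom.mapMatrix_apply, Int.coe_castRingHom] at h4
      rw [h4]
      ext i j
      simp only [Matrix.map_apply, Matrix.smul_apply, Matrix.one_apply, smul_eq_mul]
      split_ifs <;> simp
    rw [h3, Matrix.smul_mulVec, Matrix.one_mulVec] at h2
    have h5 := congrFun h2 k
    simp only [Pi.smul_apply, smul_eq_mul] at h5
    rw [h5]
    simp [Matrix.mulVec, dotProduct, intVec]
  have hdet : (M.det : ℝ) ≠ 0 := by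
    have h1 : (M.map (Int.cast : ℤ → ℝ)) = (Pi.basisFun ℝ (Fin n)).toMatrix b := by
      ext i k
      simp [Module.Basis.toMatrix_apply, hbint, intVec, hM]
    have h2 : (M.det : ℝ) = ((Pi.basisFun ℝ (Fin n)).toMatrix b).det := by
      rw [← h1]
      exact RingHom.map_det (Int.castRingHom ℝ) M
    rw [h2, ← Module.Basis.det_apply]
    exact (Module.Basis.isUnit_det _ b).ne_zero
  -- The map is `det M` times the projection onto the basis vectors outside `s` along the span of
  -- `s`.
  set J : Finset (Fin n) := Finset.univ.filter fun k => ((ε.symm k : t) : Fin n → ℝ) ∉ s with hJ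
  refine ⟨∑ k ∈ J, (M.det : ℝ) • (b.coord k).smulRight (b k), fun z => ?_, ?_⟩
  · have h1 : (∑ k ∈ J, (M.det : ℝ) • (b.coord k).smulRight (b k)) (intVec z) ∈ intLattice n := by
      rw [LinearMap.sum_apply]
      refine AddSubgroup.sum_mem _ fun k _ => ⟨(M.adjugate.mulVec z k) • ζ (ε.symm k), ?_⟩
      rw [LinearMap.smul_apply, LinearMap.smulRight_apply, smul_smul, Module.Basis.coord_apply,
        hcramer, hbint]
      ext i
      simp [intVec]
    obtain ⟨z', hz'⟩ := h1
    exact ⟨z', hz'.symm⟩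
  · rw [← hspan]
    have hker : ∀ x, x ∈ LinearMap.ker (∑ k ∈ J, (M.det : ℝ) • (b.coord k).smulRight (b k)) ↔
        ∀ k ∈ J, b.repr x k = 0 := by
      intro x
      rw [LinearMap.mem_ker, LinearMap.sum_apply]
      simp only [LinearMap.smul_apply, LinearMap.smulRight_apply, smul_smul,
        Module.Basis.coord_apply]
      constructor
      · intro h k hk
        have h1 := linearIndependent_iff'.1 b.linearIndependent J _ h k hk
        exact (mul_eq_zero.1 h1).resolve_left hdet
      · intro h
        exact Finset.sum_eq_zero fun k hk => by rw [h k hk, mul_zero, zero_smul]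
    ext x
    rw [hker]
    constructor
    · intro h
      rw [← b.sum_repr x]
      refine Submodule.sum_mem _ fun k _ => ?_
      by_cases hk : k ∈ J
      · rw [h k hk, zero_smul]
        exact Submodule.zero_mem _
      · refine Submodule.smul_mem _ _ (Submodule.subset_span ?_)
        have h1 : ((ε.symm k : t) : Fin n → ℝ) ∈ s := by simpa [hJ] using hk
        rwa [hb, Module.Basis.reindex_apply, hb₀']
    · intro hx
      induction hx using Submodule.span_induction with
      | mem x hx =>
        intro k hk
        have hxt : x ∈ t := hs'.subset_extend hsub hx
        have h1 : b (ε ⟨x, hxt⟩) = x := by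
          rw [hb, Module.Basis.reindex_apply, Equiv.symm_apply_apply, hb₀']
        rw [← h1, Module.Basis.repr_self]
        refine Finsupp.single_eq_of_ne fun h2 => ?_
        have h3 : ((ε.symm k : t) : Fin n → ℝ) ∉ s := by simpa [hJ] using hk
        rw [h2, Equiv.symm_apply_apply] at h3
        exact h3 hx
      | zero => simp
      | add x y _ _ hx hy =>
        intro k hk
        rw [map_add, Finsupp.add_apply, hx k hk, hy k hk, add_zero]
      | smul r x _ hx =>
        intro k hk
        rw [map_smul, Finsupp.smul_apply, hx k hk, smul_zero]

end Lattice

end EquivariantCone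

namespace EquivariantCone

/-! ### Faces of a cone modulo the span of a face -/

section QuotientFaces

variable {V V' : Type*} [AddCommGroup V] [Module ℝ V] [AddCommGroup V'] [Module ℝ V']

/-- From `L b = L m` one gets `b + a' = m + a` with `a, a' ∈ A ≤ M`, and the face property gives `b
∈ M`. Thus no information about faces containing `A` is lost under `L`. -/
theorem mem_of_map_mem {A B M : PointedCone ℝ V} {L : V →ₗ[ℝ] V'} (hL : LinearMap.ker L = linSpan A)
    (hAM : A ≤ M) (hM : M.IsFaceOf B) {b : V} (hb : b ∈ B) (hLb : L b ∈ M.map L) : b ∈ M := by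
  obtain ⟨m, hm, hmb⟩ := PointedCone.mem_map.1 hLb
  have h1 : b - m ∈ linSpan A := by
    rw [← hL, LinearMap.mem_ker, map_sub, hmb, sub_self]
  obtain ⟨a, ha, a', ha', h2⟩ := exists_sub_of_mem_linSpan A h1
  refine hM.mem_of_add_mem_left hb (hM.le (hAM ha')) ?_
  have h3 : b + a' = m + a := by
    rw [sub_eq_sub_iff_add_eq_add] at h2
    rw [h2, add_comm]
  rw [h3]
  exact M.add_mem hm (hAM ha)

theorem isFaceOf_map {A B M : PointedCone ℝ V} {L : V →ₗ[ℝ] V'} (hL : LinearMap.ker L = linSpan A)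
    (hAM : A ≤ M) (hM : M.IsFaceOf B) : (M.map L).IsFaceOf (B.map L) := by
  refine PointedCone.IsFaceOf.of_mem_of_add_mem_left (Submodule.map_mono hM.le) ?_
  intro x y hx hy hxy
  obtain ⟨b, hb, rfl⟩ := PointedCone.mem_map.1 hx
  obtain ⟨b', hb', rfl⟩ := PointedCone.mem_map.1 hy
  rw [← map_add] at hxy
  have h1 := mem_of_map_mem hL hAM hM (B.add_mem hb hb') hxy
  exact PointedCone.mem_map.2 ⟨b, hM.mem_of_add_mem_left hb hb' h1, rfl⟩

/-- The part of `B` lying over `N` works; it contains `A` because `L` kills `A`. Together with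
`mem_of_map_mem` this identifies the faces of the image with the faces of `B` that contain `A`. -/
theorem exists_face_of_map {A B : PointedCone ℝ V} {N : PointedCone ℝ V'} {L : V →ₗ[ℝ] V'}
    (hL : LinearMap.ker L = linSpan A) (hA : A ≤ B) (hN : N.IsFaceOf (B.map L)) :
    ∃ M : PointedCone ℝ V, M.IsFaceOf B ∧ A ≤ M ∧ M.map L = N := by
  refine ⟨B ⊓ N.comap L, PointedCone.IsFaceOf.of_mem_of_add_mem_left inf_le_left ?_, ?_, ?_⟩
  · rintro x y hx hy ⟨-, hxy⟩
    refine ⟨hx, hN.mem_of_add_mem_left (y := L y) (PointedCone.mem_map.2 ⟨x, hx, rfl⟩)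
      (PointedCone.mem_map.2 ⟨y, hy, rfl⟩) ?_⟩
    have h1 : L (x + y) ∈ N := hxy
    rwa [map_add] at h1
  · intro a ha
    have h1 : a ∈ LinearMap.ker L := by
      rw [hL]
      exact Submodule.subset_span ha
    refine ⟨hA ha, ?_⟩
    change L a ∈ N
    rw [LinearMap.mem_ker.1 h1]
    exact N.zero_mem
  · apply le_antisymm
    · intro y hy
      obtain ⟨x, hx, rfl⟩ := PointedCone.mem_map.1 hy
      exact hx.2
    · intro y hy
      obtain ⟨x, hx, rfl⟩ := PointedCone.mem_map.1 (hN.le hy)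
      exact PointedCone.mem_map.2 ⟨x, ⟨hx, hy⟩, rfl⟩

theorem linSpan_map (M : PointedCone ℝ V) (L : V →ₗ[ℝ] V') :
    linSpan (M.map L) = (linSpan M).map L := by
  rw [linSpan, linSpan, PointedCone.coe_map, Submodule.map_span]

theorem finrank_map_add_of_ker_le [FiniteDimensional ℝ V] (L : V →ₗ[ℝ] V') {W : Submodule ℝ V}
    (h : LinearMap.ker L ≤ W) :
    Module.finrank ℝ (W.map L) + Module.finrank ℝ (LinearMap.ker L) = Module.finrank ℝ W := by
  have h1 := LinearMap.finrank_range_add_finrank_ker (L.domRestrict W)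
  have h2 : LinearMap.range (L.domRestrict W) = W.map L := LinearMap.range_domRestrict W L
  have h3 : LinearMap.ker (L.domRestrict W) = (LinearMap.ker L).comap W.subtype :=
    LinearMap.ker_domRestrict W L
  rw [h2, h3, (Submodule.comapSubtypeEquivOfLe h).finrank_eq] at h1
  exact h1

end QuotientFaces

/-- Euler's relation for the interval between two faces of a rational cone. -/
theorem euler_interval {n : ℕ} {S : Set (Fin n → ℝ)} (hS : S.Finite) (hSΛ : S ⊆ intLattice n)
    {A B : PointedCone ℝ (Fin n → ℝ)} (hA : A.IsFaceOf (PointedCone.hull ℝ S))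
    (hB : B.IsFaceOf (PointedCone.hull ℝ S)) (hAB : A ≤ B) (hne : A ≠ B)
    (T : Finset (PointedCone ℝ (Fin n → ℝ)))
    (hT : ∀ M, M ∈ T ↔ M.IsFaceOf (PointedCone.hull ℝ S) ∧ A ≤ M ∧ M ≤ B) :
    ∑ M ∈ T, (-1 : ℂ) ^ dim M = 0 := by
  -- The interval from `A` to `B` is the face poset of the image of `B` modulo the span of `A`. The
  -- integral map `L` keeps this image a cone over lattice points, so that `IsGraded.euler` applies.
  classical
  obtain ⟨L, hLint, hLker⟩ := exists_int_map_ker (S ∩ A) (Set.inter_subset_left.trans hSΛ)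
  rw [← linSpan_hull, ← face_eq_hull hA] at hLker
  have hAB' : A.IsFaceOf B := (hA.isFaceOf_iff_le hB).2 hAB
  set I := {s : Fin n → ℝ | s ∈ S ∧ s ∈ B ∧ s ∉ A} with hI
  have hIfin : Finite I := (hS.subset fun s hs => hs.1).to_subtype
  have hIfin' : Fintype I := Fintype.ofFinite I
  have hz : ∀ s : I, ∃ z, L s = intVec z := by
    intro s
    obtain ⟨z, hz⟩ := hSΛ s.2.1
    obtain ⟨z', hz'⟩ := hLint z
    exact ⟨z', by rw [← hz', hz]⟩
  choose z hz using hz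
  have hker0 : ∀ a ∈ A, L a = 0 := fun a ha => by
    rw [← LinearMap.mem_ker, hLker]
    exact Submodule.subset_span ha
  obtain ⟨h, e, he⟩ := exists_pos_int_functional z fun l hl h0 => by
    refine eq_zero_of_sum_mem_linSpan hAB' (fun s : I => (s : Fin n → ℝ)) (fun s => s.2.2.1)
      (fun s => s.2.2.2) l hl ?_
    rw [finsum_eq_sum_of_fintype] at h0
    rw [← hLker, LinearMap.mem_ker, map_sum, ← h0]
    exact Finset.sum_congr rfl fun s _ => by rw [map_smul, hz]
  have hmap : B.map L = PointedCone.hull ℝ (Set.range fun s : I => L s) := by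
    apply le_antisymm
    · intro y hy
      obtain ⟨x, hx, rfl⟩ := PointedCone.mem_map.1 hy
      rw [face_eq_hull hB] at hx
      have : PointedCone.hull ℝ (S ∩ (B : Set (Fin n → ℝ))) ≤
          (PointedCone.hull ℝ (Set.range fun s : I => L s)).comap L := by
        refine Submodule.span_le.2 ?_
        rintro s ⟨hsS, hsB⟩
        change L s ∈ PointedCone.hull ℝ (Set.range fun s : I => L s)
        by_cases hsA : s ∈ A
        · rw [hker0 s hsA]
          exact Submodule.zero_mem _
        · exact Submodule.subset_span ⟨⟨s, hsS, hsB, hsA⟩, rfl⟩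
      exact this hx
    · refine Submodule.span_le.2 ?_
      rintro _ ⟨s, rfl⟩
      exact PointedCone.mem_map.2 ⟨s, s.2.2.1, rfl⟩
  have hpos : ∀ s : I, 0 < h (L s) := fun s => by
    rw [hz, (he s).2]
    exact_mod_cast (he s).1
  have hgr : IsGraded h (intLattice n) (B.map L) := by
    refine ⟨⟨Finset.univ.image fun s : I => L s, ?_, ?_, ?_⟩, ?_⟩
    · intro y hy
      obtain ⟨s, -, rfl⟩ := Finset.mem_image.1 hy
      exact ⟨z s, (hz s).symm⟩
    · intro y hy
      obtain ⟨s, -, rfl⟩ := Finset.mem_image.1 hy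
      exact ⟨e s, (he s).1, by rw [hz, (he s).2]⟩
    · rw [hmap]
      simp
    · intro m
      rw [hmap]
      refine finite_intLattice_height (Set.finite_range _) ?_ _
      rintro _ ⟨s, rfl⟩
      exact hpos s
  have hne0 : B.map L ≠ ⊥ := by
    intro h0
    apply hne
    apply le_antisymm hAB
    rw [face_eq_hull hB]
    refine Submodule.span_le.2 ?_
    rintro s ⟨hsS, hsB⟩
    by_contra hsA
    have h1 : L s ∈ B.map L := PointedCone.mem_map.2 ⟨s, hsB, rfl⟩
    rw [h0, Submodule.mem_bot] at h1
    have h2 := hpos ⟨s, hsS, hsB, hsA⟩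
    rw [h1, map_zero] at h2
    exact lt_irrefl _ h2
  have hTB : ∀ M ∈ T, M.IsFaceOf B ∧ A ≤ M := fun M hM =>
    ⟨(((hT M).1 hM).1.isFaceOf_iff_le hB).2 ((hT M).1 hM).2.2, ((hT M).1 hM).2.1⟩
  have hinj : ∀ M ∈ T, ∀ M' ∈ T, M.map L = M'.map L → M ≤ M' := by
    intro M hM M' hM' h1 x hx
    refine mem_of_map_mem hLker (hTB M' hM').2 (hTB M' hM').1 ((hTB M hM).1.le hx) ?_
    rw [← h1]
    exact PointedCone.mem_map.2 ⟨x, hx, rfl⟩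
  have key := hgr.euler hne0 (T.image fun M => M.map L) fun F => by
    rw [Finset.mem_image]
    constructor
    · rintro ⟨M, hM, rfl⟩
      exact isFaceOf_map hLker (hTB M hM).2 (hTB M hM).1
    · intro hF
      obtain ⟨M, hM, hAM, rfl⟩ := exists_face_of_map hLker hAB hF
      exact ⟨M, (hT M).2 ⟨hM.trans hB, hAM, hM.le⟩, rfl⟩
  rw [Finset.sum_image fun M hM M' hM' h1 =>
    le_antisymm (hinj M hM M' hM' h1) (hinj M' hM' M hM h1.symm)] at key
  have hdim : ∀ M ∈ T, (-1 : ℂ) ^ dim M = (-1) ^ dim (M.map L) * (-1) ^ dim A := by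
    intro M hM
    rw [← pow_add]
    congr 1
    rw [dim, dim, dim, linSpan_map, ← hLker]
    refine (finrank_map_add_of_ker_le L ?_).symm
    rw [hLker]
    exact Submodule.span_mono (hTB M hM).2
  rw [Finset.sum_congr rfl hdim, ← Finset.sum_mul, key, zero_mul]

end EquivariantCone

namespace EquivariantCone

/-! ## Fixed faces and the fixed cone -/

section FixedCone

variable {V : Type*} [AddCommGroup V] [Module ℝ V]

/-- The points of a cone that are fixed by `g`. -/
def fixCone (g : Module.End ℝ V) (F : PointedCone ℝ V) : PointedCone ℝ V :=
  F ⊓ PointedCone.ofSubmodule (LinearMap.ker (g - 1))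

theorem mem_ker_sub_one {g : Module.End ℝ V} {x : V} : x ∈ LinearMap.ker (g - 1) ↔ g x = x := by
  rw [LinearMap.mem_ker, LinearMap.sub_apply, sub_eq_zero]
  rfl

theorem mem_fixCone {g : Module.End ℝ V} {F : PointedCone ℝ V} {x : V} :
    x ∈ fixCone g F ↔ x ∈ F ∧ g x = x :=
  and_congr Iff.rfl mem_ker_sub_one

/-- The sum `x + g x + ⋯ + g^(N-1) x`. -/
def orbSum (g : Module.End ℝ V) (N : ℕ) : V →ₗ[ℝ] V := ∑ i ∈ Finset.range N, g ^ i

theorem orbSum_apply (g : Module.End ℝ V) (N : ℕ) (x : V) :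
    orbSum g N x = ∑ i ∈ Finset.range N, (g ^ i) x := by
  rw [orbSum, LinearMap.sum_apply]

theorem map_orbSum {g : Module.End ℝ V} {N : ℕ} (hg : g ^ N = 1) (x : V) :
    g (orbSum g N x) = orbSum g N x := by
  rw [orbSum_apply, map_sum]
  have h := Finset.sum_range_succ (fun i => (g ^ i) x) N
  rw [Finset.sum_range_succ', hg, pow_zero, add_left_inj] at h
  rw [← h]
  exact Finset.sum_congr rfl fun i _ => by rw [pow_succ', Module.End.mul_apply]

theorem orbSum_of_fixed {g : Module.End ℝ V} {N : ℕ} {x : V} (hx : g x = x) :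
    orbSum g N x = (N : ℝ) • x := by
  have h : ∀ i : ℕ, (g ^ i) x = x := by
    intro i
    induction i with
    | zero => rfl
    | succ i ih => rw [pow_succ', Module.End.mul_apply, ih, hx]
  rw [orbSum_apply]
  simp [h, ← Nat.cast_smul_eq_nsmul ℝ]

theorem map_mem_of_map_eq {g : Module.End ℝ V} {F : PointedCone ℝ V} (hF : F.map g = F) {x : V}
    (hx : x ∈ F) : g x ∈ F := by
  rw [← hF]
  exact PointedCone.mem_map.2 ⟨x, hx, rfl⟩

theorem pow_mem_of_map_eq {g : Module.End ℝ V} {F : PointedCone ℝ V} (hF : F.map g = F) {x : V}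
    (hx : x ∈ F) (i : ℕ) : (g ^ i) x ∈ F := by
  induction i with
  | zero => exact hx
  | succ i ih =>
    rw [pow_succ', Module.End.mul_apply]
    exact map_mem_of_map_eq hF ih

theorem orbSum_mem {g : Module.End ℝ V} {F : PointedCone ℝ V} (hF : F.map g = F) {x : V}
    (hx : x ∈ F) (N : ℕ) : orbSum g N x ∈ F := by
  rw [orbSum_apply]
  exact Submodule.sum_mem _ fun i _ => pow_mem_of_map_eq hF hx i

theorem map_eq_of_map_mem {g : Module.End ℝ V} {N : ℕ} (hN : 0 < N) (hg : g ^ N = 1)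
    {F : PointedCone ℝ V} (hF : ∀ x ∈ F, g x ∈ F) : F.map g = F := by
  have hpow : ∀ i : ℕ, ∀ x ∈ F, (g ^ i) x ∈ F := by
    intro i
    induction i with
    | zero => exact fun x hx => hx
    | succ i ih =>
      intro x hx
      rw [pow_succ', Module.End.mul_apply]
      exact hF _ (ih x hx)
  apply le_antisymm
  · intro y hy
    obtain ⟨x, hx, rfl⟩ := PointedCone.mem_map.1 hy
    exact hF x hx
  · intro x hx
    refine PointedCone.mem_map.2 ⟨(g ^ (N - 1)) x, hpow _ x hx, ?_⟩
    rw [← Module.End.mul_apply, ← pow_succ', Nat.sub_add_cancel hN, hg]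
    rfl

theorem orbSum_mem_fixCone {g : Module.End ℝ V} {N : ℕ} (hg : g ^ N = 1) {F : PointedCone ℝ V}
    (hF : F.map g = F) {x : V} (hx : x ∈ F) : orbSum g N x ∈ fixCone g F :=
  mem_fixCone.2 ⟨orbSum_mem hF hx N, map_orbSum hg x⟩

theorem fixCone_mono {g : Module.End ℝ V} {F F' : PointedCone ℝ V} (h : F ≤ F') :
    fixCone g F ≤ fixCone g F' :=
  inf_le_inf_right _ h

theorem fixCone_isFaceOf {g : Module.End ℝ V} {F C : PointedCone ℝ V} (hF : F.IsFaceOf C) :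
    (fixCone g F).IsFaceOf (fixCone g C) :=
  hF.inf PointedCone.IsFaceOf.rfl

/-- For `x ∈ F` the orbit sum is a fixed point of `F`, hence in `F'`. All its summands lie in `C`,
so the face `F'` contains each of them, in particular `x`. -/
theorem le_of_fixCone_le {g : Module.End ℝ V} {N : ℕ} (hN : 0 < N) (hg : g ^ N = 1)
    {C F F' : PointedCone ℝ V} (hF : F.map g = F) (hFC : F ≤ C) (hF' : F'.IsFaceOf C)
    (h : fixCone g F ≤ fixCone g F') : F ≤ F' := by
  intro x hx
  have h1 : orbSum g N x ∈ F' := (mem_fixCone.1 (h (orbSum_mem_fixCone hg hF hx))).1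
  rw [orbSum_apply, Finset.sum_range] at h1
  exact hF'.mem_of_sum_mem (f := fun i : Fin N => (g ^ (i : ℕ)) x)
    (fun i => hFC (pow_mem_of_map_eq hF hx _)) h1 ⟨0, hN⟩

/-- The witness consists of the points of `C` that can be completed within `C` to a point of `M`. It
is invariant because `M` is fixed pointwise. -/
theorem exists_face_of_fixCone {g : Module.End ℝ V} {N : ℕ} (hN : 0 < N) (hg : g ^ N = 1)
    {C M : PointedCone ℝ V} (hC : C.map g = C) (hM : M.IsFaceOf (fixCone g C)) :
    ∃ F : PointedCone ℝ V, F.IsFaceOf C ∧ F.map g = F ∧ fixCone g F = M := by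
  let F : PointedCone ℝ V :=
    { carrier := {x | x ∈ C ∧ ∃ y ∈ C, x + y ∈ M}
      add_mem' := by
        rintro a b ⟨ha, y, hy, h1⟩ ⟨hb, y', hy', h2⟩
        refine ⟨C.add_mem ha hb, y + y', C.add_mem hy hy', ?_⟩
        have : a + b + (y + y') = (a + y) + (b + y') := by abel
        rw [this]
        exact M.add_mem h1 h2
      zero_mem' := ⟨C.zero_mem, 0, C.zero_mem, by rw [add_zero]; exact M.zero_mem⟩
      smul_mem' := by
        rintro ⟨r, hr⟩ a ⟨ha, y, hy, h1⟩
        refine ⟨PointedCone.smul_mem _ hr ha, r • y, PointedCone.smul_mem _ hr hy, ?_⟩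
        have := PointedCone.smul_mem M hr h1
        rwa [smul_add] at this }
  have hmem : ∀ x, x ∈ F ↔ x ∈ C ∧ ∃ y ∈ C, x + y ∈ M := fun x => Iff.rfl
  have hMfix : ∀ x ∈ M, g x = x := fun x hx => (mem_fixCone.1 (hM.le hx)).2
  refine ⟨F, PointedCone.IsFaceOf.of_mem_of_add_mem_left (fun x hx => hx.1) ?_,
    map_eq_of_map_mem hN hg ?_, ?_⟩
  · rintro a b ha hb ⟨-, y, hy, h⟩
    refine ⟨ha, b + y, C.add_mem hb hy, ?_⟩
    rwa [← add_assoc]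
  · rintro x ⟨hx, y, hy, h⟩
    refine ⟨map_mem_of_map_eq hC hx, g y, map_mem_of_map_eq hC hy, ?_⟩
    rw [← map_add, hMfix _ h]
    exact h
  · apply le_antisymm
    · intro x hx
      obtain ⟨⟨hxC, y, hy, h⟩, hgx⟩ := mem_fixCone.1 hx
      have hgy : g y = y := by
        have := hMfix _ h
        rwa [map_add, hgx, add_right_inj] at this
      exact hM.mem_of_add_mem_left (mem_fixCone.2 ⟨hxC, hgx⟩) (mem_fixCone.2 ⟨hy, hgy⟩) h
    · intro x hx
      refine mem_fixCone.2 ⟨⟨(mem_fixCone.1 (hM.le hx)).1, 0, C.zero_mem, ?_⟩, hMfix x hx⟩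
      rwa [add_zero]

/-- A fixed vector `a - b` with `a, b ∈ F` equals its own average, which is a difference of fixed
points of `F`. This makes the dimension of the fixed cone agree with the exponent in `fixSign`. -/
theorem linSpan_fixCone {g : Module.End ℝ V} {N : ℕ} (hN : 0 < N) (hg : g ^ N = 1)
    {F : PointedCone ℝ V} (hF : F.map g = F) :
    linSpan (fixCone g F) = linSpan F ⊓ LinearMap.ker (g - 1) := by
  apply le_antisymm
  · refine Submodule.span_le.2 fun x hx => ?_
    exact ⟨Submodule.subset_span hx.1, hx.2⟩
  · rintro x ⟨hx, hgx⟩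
    obtain ⟨a, ha, b, hb, rfl⟩ := exists_sub_of_mem_linSpan F hx
    have h1 : (N : ℝ) • (a - b) = orbSum g N a - orbSum g N b := by
      rw [← orbSum_of_fixed (mem_ker_sub_one.1 hgx), map_sub]
    have hN' : (N : ℝ) ≠ 0 := by exact_mod_cast hN.ne'
    have h2 : a - b = (N : ℝ)⁻¹ • (orbSum g N a - orbSum g N b) := by
      rw [← h1, smul_smul, inv_mul_cancel₀ hN', one_smul]
    rw [h2]
    exact Submodule.smul_mem _ _ (Submodule.sub_mem _
      (Submodule.subset_span (orbSum_mem_fixCone hg hF ha))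
      (Submodule.subset_span (orbSum_mem_fixCone hg hF hb)))

theorem neg_one_pow_dim_fixCone {g : Module.End ℝ V} {N : ℕ} (hN : 0 < N) (hg : g ^ N = 1)
    {F : PointedCone ℝ V} (hF : F.map g = F) :
    (-1 : ℂ) ^ dim (fixCone g F) = fixSign g (linSpan F) := by
  rw [fixSign, dim, linSpan_fixCone hN hg hF]

/-- A fixed point is `1 / N` times its orbit sum, and the orbit sum of a nonnegative combination of
generators is a nonnegative combination of their orbit sums. The orbit sums of lattice generators
are lattice points, so the fixed cone is again rational. -/
theorem fixCone_hull {g : Module.End ℝ V} {N : ℕ} (hN : 0 < N) (hg : g ^ N = 1)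
    {S : Set V} (hS : (PointedCone.hull ℝ S).map g = PointedCone.hull ℝ S) :
    fixCone g (PointedCone.hull ℝ S) = PointedCone.hull ℝ (orbSum g N '' S) := by
  apply le_antisymm
  · intro x hx
    obtain ⟨hx, hgx⟩ := mem_fixCone.1 hx
    have h1 : PointedCone.hull ℝ S ≤ (PointedCone.hull ℝ (orbSum g N '' S)).comap (orbSum g N) :=
      Submodule.span_le.2 fun s hs => Submodule.subset_span ⟨s, hs, rfl⟩
    have h2 : orbSum g N x ∈ PointedCone.hull ℝ (orbSum g N '' S) := h1 hx
    rw [orbSum_of_fixed hgx] at h2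
    have hN' : (N : ℝ) ≠ 0 := by exact_mod_cast hN.ne'
    have h3 := PointedCone.smul_mem _ (inv_nonneg.2 (Nat.cast_nonneg N)) h2
    rwa [smul_smul, inv_mul_cancel₀ hN', one_smul] at h3
  · refine Submodule.span_le.2 ?_
    rintro _ ⟨s, hs, rfl⟩
    exact orbSum_mem_fixCone hg hS (Submodule.subset_span hs)

theorem orbSum_mem_of_mem {g : Module.End ℝ V} {Λ : AddSubgroup V} (hgΛ : ∀ x ∈ Λ, g x ∈ Λ) (N : ℕ)
    {x : V} (hx : x ∈ Λ) : orbSum g N x ∈ Λ := by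
  rw [orbSum_apply]
  refine AddSubgroup.sum_mem _ fun i _ => ?_
  induction i with
  | zero => exact hx
  | succ i ih =>
    rw [pow_succ', Module.End.mul_apply]
    exact hgΛ _ (ih (by simp_all; omega))

/-- Euler's relation for the faces fixed by an automorphism of finite order. -/
theorem euler_fixed {n : ℕ} {g : Module.End ℝ (Fin n → ℝ)} {N : ℕ} (hN : 0 < N) (hg : g ^ N = 1)
    (hgΛ : ∀ x ∈ intLattice n, g x ∈ intLattice n) {S : Set (Fin n → ℝ)} (hS : S.Finite)
    (hSΛ : S ⊆ intLattice n) (hSg : (PointedCone.hull ℝ S).map g = PointedCone.hull ℝ S)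
    {A B : PointedCone ℝ (Fin n → ℝ)} (hA : A.IsFaceOf (PointedCone.hull ℝ S)) (hAg : A.map g = A)
    (hB : B.IsFaceOf (PointedCone.hull ℝ S)) (hBg : B.map g = B) (hAB : A ≤ B) (hne : A ≠ B)
    (T : Finset (PointedCone ℝ (Fin n → ℝ)))
    (hT : ∀ M, M ∈ T ↔ (M.IsFaceOf (PointedCone.hull ℝ S) ∧ M.map g = M) ∧ A ≤ M ∧ M ≤ B) :
    ∑ M ∈ T, fixSign g (linSpan M) = 0 := by
  classical
  have hinj : ∀ M M' : PointedCone ℝ (Fin n → ℝ), M.IsFaceOf (PointedCone.hull ℝ S) →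
      M'.IsFaceOf (PointedCone.hull ℝ S) → M.map g = M → M'.map g = M' →
      fixCone g M = fixCone g M' → M = M' := fun M M' h1 h2 h3 h4 h5 =>
    le_antisymm (le_of_fixCone_le hN hg h3 h1.le h2 h5.le)
      (le_of_fixCone_le hN hg h4 h2.le h1 h5.ge)
  have hfix := fixCone_hull hN hg hSg
  -- Fixed faces correspond to faces of the fixed cone, and `s_M` is the dimension sign of the fixed
  -- part of `M`, so the ordinary relation for the fixed cone is the desired one.
  have key := euler_interval (S := orbSum g N '' S) (hS.image _) (by
      rintro _ ⟨s, hs, rfl⟩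
      exact orbSum_mem_of_mem hgΛ N (hSΛ hs)) (A := fixCone g A) (B := fixCone g B)
    (by rw [← hfix]; exact fixCone_isFaceOf hA) (by rw [← hfix]; exact fixCone_isFaceOf hB)
    (fixCone_mono hAB) (fun h => hne (hinj A B hA hB hAg hBg h)) (T.image (fixCone g)) fun M => by
      rw [Finset.mem_image, ← hfix]
      constructor
      · rintro ⟨F, hF, rfl⟩
        have hF := (hT F).1 hF
        exact ⟨fixCone_isFaceOf hF.1.1, fixCone_mono hF.2.1, fixCone_mono hF.2.2⟩
      · rintro ⟨hM, hAM, hMB⟩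
        obtain ⟨F, hF, hFg, rfl⟩ := exists_face_of_fixCone hN hg hSg hM
        exact ⟨F, (hT F).2 ⟨⟨hF, hFg⟩, le_of_fixCone_le hN hg hAg hA.le hF hAM,
          le_of_fixCone_le hN hg hFg hF.le hB hMB⟩, rfl⟩
  rw [Finset.sum_image fun M hM M' hM' h => hinj M M' ((hT M).1 hM).1.1 ((hT M').1 hM').1.1
    ((hT M).1 hM).1.2 ((hT M').1 hM').1.2 h] at key
  rw [← key]
  exact Finset.sum_congr rfl fun M hM => (neg_one_pow_dim_fixCone hN hg ((hT M).1 hM).1.2).symm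

/-- Reciprocity, summed over the fixed faces of a fixed face. -/
theorem toRat_fixCone_eq_sum {g : Module.End ℝ V} {N : ℕ} (hN : 0 < N) (hg : g ^ N = 1)
    {h : V →ₗ[ℝ] ℝ} {Λ : AddSubgroup V} {C F : PointedCone ℝ V} (hgr : IsGraded h Λ (fixCone g C))
    (hF : F.IsFaceOf C) (hFg : F.map g = F) (T : Finset (PointedCone ℝ V))
    (hT : ∀ M, M ∈ T ↔ (M.IsFaceOf C ∧ M.map g = M) ∧ M ≤ F) :
    toRat (genFun h ((fixCone g F : Set V) ∩ Λ)) = ∑ M ∈ T, RatFunc.C (fixSign g (linSpan M)) *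
      invHom (toRat (genFun h ((fixCone g M : Set V) ∩ Λ))) := by
  classical
  rw [(hgr.face (fixCone_isFaceOf hF)).toRat_eq_sum (T.image (fixCone g)) fun M => ?_,
    Finset.sum_image fun M hM M' hM' h => ?_]
  · refine Finset.sum_congr rfl fun M hM => ?_
    rw [← neg_one_pow_dim_fixCone hN hg ((hT M).1 hM).1.2]
    simp
  · have hM := (hT M).1 hM
    have hM' := (hT M').1 hM'
    exact le_antisymm (le_of_fixCone_le hN hg hM.1.2 hM.1.1.le hM'.1.1 h.le)
      (le_of_fixCone_le hN hg hM'.1.2 hM'.1.1.le hM.1.1 h.ge)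
  · rw [Finset.mem_image]
    constructor
    · rintro ⟨M, hM, rfl⟩
      have hM := (hT M).1 hM
      exact fixCone_isFaceOf ((hM.1.1.isFaceOf_iff_le hF).2 hM.2)
    · intro hM
      obtain ⟨M', hM', hMg, rfl⟩ := exists_face_of_fixCone hN hg hFg hM
      exact ⟨M', (hT M').2 ⟨⟨hM'.trans hF, hMg⟩, hM'.le⟩, rfl⟩

end FixedCone

/-! ## Faces of the dual cone -/

section DualFaces

variable {V : Type*} [AddCommGroup V] [Module ℝ V]

theorem mem_dualFace {C F : PointedCone ℝ V} {u : Module.Dual ℝ V} :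
    u ∈ dualFace C F ↔ (∀ x ∈ C, 0 ≤ u x) ∧ ∀ x ∈ F, u x = 0 := by
  constructor
  · rintro ⟨h1, h2⟩
    exact ⟨fun x hx => h1 hx, fun x hx =>
      (Submodule.mem_dualAnnihilator _).1 h2 x (Submodule.subset_span hx)⟩
  · rintro ⟨h1, h2⟩
    refine ⟨fun x hx => h1 x hx, (Submodule.mem_dualAnnihilator _).2 fun x hx => ?_⟩
    have : linSpan F ≤ LinearMap.ker u := Submodule.span_le.2 fun y hy => h2 y hy
    exact this hx

theorem dualFace_anti {C F F' : PointedCone ℝ V} (h : F ≤ F') : dualFace C F' ≤ dualFace C F :=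
  fun _ hu => mem_dualFace.2 ⟨(mem_dualFace.1 hu).1, fun x hx => (mem_dualFace.1 hu).2 x (h hx)⟩

theorem dualFace_isFaceOf {C F F' : PointedCone ℝ V} (hF' : F' ≤ C) (h : F ≤ F') :
    (dualFace C F').IsFaceOf (dualFace C F) := by
  refine PointedCone.IsFaceOf.of_mem_of_add_mem_left (dualFace_anti h) ?_
  intro u v hu hv huv
  rw [mem_dualFace] at *
  refine ⟨hu.1, fun x hx => ?_⟩
  have h1 := huv.2 x hx
  rw [LinearMap.add_apply] at h1
  linarith [hu.1 x (hF' hx), hv.1 x (hF' hx)]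

theorem nonneg_of_nonneg_generators {S : Set V} {u : Module.Dual ℝ V} (h : ∀ s ∈ S, 0 ≤ u s) {x : V}
    (hx : x ∈ PointedCone.hull ℝ S) : 0 ≤ u x := by
  have : PointedCone.hull ℝ S ≤ (PointedCone.positive ℝ ℝ).comap u :=
    Submodule.span_le.2 fun s hs => h s hs
  exact this hx

variable [FiniteDimensional ℝ V]

theorem exists_mem_dualFace {S : Set V} (hS : S.Finite) {F : PointedCone ℝ V}
    (hF : F.IsFaceOf (PointedCone.hull ℝ S)) :
    ∃ u ∈ dualFace (PointedCone.hull ℝ S) F, ∀ s ∈ S, s ∉ F → 0 < u s := by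
  obtain ⟨u, hu0, hu⟩ := exists_exposing hS hF
  refine ⟨u, mem_dualFace.2 ⟨fun x hx => nonneg_of_nonneg_generators (fun s hs => ?_) hx, hu0⟩, hu⟩
  by_cases hsF : s ∈ F
  · rw [hu0 s hsF]
  · exact (hu s hs hsF).le

/-- A form in `F'^*` that is positive on the generators outside `F'` detects any generator of `F`
not in `F'`. -/
theorem dualFace_le_iff {S : Set V} (hS : S.Finite) {F F' : PointedCone ℝ V}
    (hF : F.IsFaceOf (PointedCone.hull ℝ S)) (hF' : F'.IsFaceOf (PointedCone.hull ℝ S)) :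
    dualFace (PointedCone.hull ℝ S) F' ≤ dualFace (PointedCone.hull ℝ S) F ↔ F ≤ F' := by
  refine ⟨fun h => ?_, dualFace_anti⟩
  obtain ⟨u, hu, hpos⟩ := exists_mem_dualFace hS hF'
  rw [face_eq_hull hF]
  refine Submodule.span_le.2 ?_
  rintro s ⟨hs, hsF⟩
  by_contra hsF'
  exact (hpos s hs hsF').ne' ((mem_dualFace.1 (h hu)).2 s hsF)

/-- A functional that is positive on the generators outside a face can absorb any functional that
vanishes on the face. -/
theorem exists_smul_add_mem_dualFace {S : Set V} (hS : S.Finite) {F : PointedCone ℝ V}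
    {u v : Module.Dual ℝ V}
    (hu0 : ∀ x ∈ F, u x = 0) (hu : ∀ s ∈ S, s ∉ F → 0 < u s) (hv : ∀ x ∈ F, v x = 0) :
    ∃ r : ℝ, 0 < r ∧ r • u + v ∈ dualFace (PointedCone.hull ℝ S) F := by
  obtain ⟨M, hM⟩ := (hS.image fun s => -v s / u s).bddAbove
  refine ⟨max M 1, lt_max_of_lt_right one_pos, mem_dualFace.2 ⟨fun x hx =>
    nonneg_of_nonneg_generators (fun s hs => ?_) hx, fun x hx => ?_⟩⟩
  · rw [LinearMap.add_apply, LinearMap.smul_apply, smul_eq_mul]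
    by_cases hsF : s ∈ F
    · rw [hu0 s hsF, hv s hsF]
      simp
    · have h1 : -v s / u s ≤ max M 1 := (hM ⟨s, hs, rfl⟩).trans (le_max_left _ _)
      rw [div_le_iff₀ (hu s hs hsF)] at h1
      linarith
  · rw [LinearMap.add_apply, LinearMap.smul_apply, hu0 x hx, hv x hx, smul_zero, add_zero]

/-- A form vanishing on `F` becomes nonnegative on the cone after adding a large multiple of an
exposing form of `F`, so it is a difference of two elements of `F^*`. -/
theorem linSpan_dualFace {S : Set V} (hS : S.Finite) {F : PointedCone ℝ V}
    (hF : F.IsFaceOf (PointedCone.hull ℝ S)) :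
    linSpan (dualFace (PointedCone.hull ℝ S) F) = (linSpan F).dualAnnihilator := by
  apply le_antisymm
  · exact Submodule.span_le.2 fun u hu => hu.2
  · intro v hv
    obtain ⟨u, hu, hpos⟩ := exists_mem_dualFace hS hF
    obtain ⟨r, -, hr⟩ := exists_smul_add_mem_dualFace hS (mem_dualFace.1 hu).2 hpos
      (fun x hx => (Submodule.mem_dualAnnihilator _).1 hv x (Submodule.subset_span hx))
    have : v = (r • u + v) - r • u := by abel
    rw [this]
    exact Submodule.sub_mem _ (Submodule.subset_span hr)
      (Submodule.smul_mem _ _ (Submodule.subset_span hu))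

/-- Take for `F'` the common zeros of `E` in the cone. A sum of finitely many elements of `E` is
positive on all generators outside `F'`; a large multiple of it is `v` plus another element of
`F^*`, for any `v ∈ F'^*`, and the face property puts `v` into `E`. -/
theorem exists_eq_dualFace {S : Set V} (hS : S.Finite) {F : PointedCone ℝ V}
    (hF : F.IsFaceOf (PointedCone.hull ℝ S)) {E : PointedCone ℝ (Module.Dual ℝ V)}
    (hE : E.IsFaceOf (dualFace (PointedCone.hull ℝ S) F)) :
    ∃ F' : PointedCone ℝ V, F'.IsFaceOf (PointedCone.hull ℝ S) ∧ F ≤ F' ∧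
      E = dualFace (PointedCone.hull ℝ S) F' := by
  classical
  set C := PointedCone.hull ℝ S with hC
  have hE0 : ∀ u ∈ E, ∀ x ∈ C, 0 ≤ u x := fun u hu => (mem_dualFace.1 (hE.le hu)).1
  let F' : PointedCone ℝ V :=
    { carrier := {x | x ∈ C ∧ ∀ u ∈ E, u x = 0}
      add_mem' := by
        rintro a b ⟨ha, ha'⟩ ⟨hb, hb'⟩
        exact ⟨C.add_mem ha hb, fun u hu => by rw [map_add, ha' u hu, hb' u hu, add_zero]⟩
      zero_mem' := ⟨C.zero_mem, fun u _ => map_zero u⟩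
      smul_mem' := by
        rintro ⟨r, hr⟩ a ⟨ha, ha'⟩
        refine ⟨PointedCone.smul_mem _ hr ha, fun u hu => ?_⟩
        have : u (r • a) = 0 := by rw [map_smul, ha' u hu, smul_zero]
        exact this }
  have hF'face : F'.IsFaceOf C := by
    refine PointedCone.IsFaceOf.of_mem_of_add_mem_left (fun x hx => hx.1) ?_
    rintro a b ha hb ⟨-, h⟩
    refine ⟨ha, fun u hu => ?_⟩
    have h1 := h u hu
    rw [map_add] at h1
    linarith [hE0 u hu a ha, hE0 u hu b hb]
  have hFF' : F ≤ F' := fun x hx => ⟨hF.le hx, fun u hu => (mem_dualFace.1 (hE.le hu)).2 x hx⟩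
  have hF'mem : ∀ x, x ∈ F' → ∀ u ∈ E, u x = 0 := fun x hx => And.right hx
  refine ⟨F', hF'face, hFF', le_antisymm (fun u hu => mem_dualFace.2 ⟨hE0 u hu, fun x hx =>
    hF'mem x hx u hu⟩) ?_⟩
  have hex : ∀ s, s ∈ S → s ∉ F' → ∃ u ∈ E, 0 < u s := by
    intro s hs hsF'
    by_contra! hcon
    exact hsF' ⟨Submodule.subset_span hs, fun u hu =>
      le_antisymm (hcon u hu) (hE0 u hu s (Submodule.subset_span hs))⟩
  choose! ψ hψE hψ using hex
  set T := hS.toFinset.filter (· ∉ F') with hT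
  have hTmem : ∀ s, s ∈ T ↔ s ∈ S ∧ s ∉ F' := fun s => by simp [hT]
  set u := ∑ s ∈ T, ψ s with hu
  have huE : u ∈ E := Submodule.sum_mem _ fun s hs => hψE s ((hTmem s).1 hs).1 ((hTmem s).1 hs).2
  have hupos : ∀ s ∈ S, s ∉ F' → 0 < u s := by
    intro s hs hsF'
    rw [hu, LinearMap.sum_apply]
    refine Finset.sum_pos' (fun t ht => hE0 _ (hψE t ((hTmem t).1 ht).1 ((hTmem t).1 ht).2) s
      (Submodule.subset_span hs)) ⟨s, (hTmem s).2 ⟨hs, hsF'⟩, hψ s hs hsF'⟩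
  intro v hv
  obtain ⟨r, hr, hrm⟩ := exists_smul_add_mem_dualFace hS (F := F') (u := u) (v := -v)
    (fun x hx => hF'mem x hx u huE) hupos (fun x hx => by
      rw [LinearMap.neg_apply, (mem_dualFace.1 hv).2 x hx, neg_zero])
  refine hE.mem_of_add_mem_left (dualFace_anti hFF' hv) (dualFace_anti hFF' hrm) ?_
  have : v + (r • u + -v) = r • u := by abel
  rw [this]
  exact PointedCone.smul_mem _ hr.le huE

omit [FiniteDimensional ℝ V] in
theorem dualFace_map {C F : PointedCone ℝ V} {g g' : Module.End ℝ V} (h : g * g' = 1)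
    (h' : g' * g = 1) (hC : C.map g = C) :
    (dualFace C F).map (g'.dualMap) = dualFace C (F.map g) := by
  have hgg' : ∀ x, g (g' x) = x := fun x => LinearMap.congr_fun h x
  have hg'g : ∀ x, g' (g x) = x := fun x => LinearMap.congr_fun h' x
  have hC' : ∀ x ∈ C, g' x ∈ C := by
    intro x hx
    rw [← hC] at hx
    obtain ⟨y, hy, rfl⟩ := PointedCone.mem_map.1 hx
    rwa [hg'g]
  ext u
  rw [PointedCone.mem_map, mem_dualFace]
  constructor
  · rintro ⟨v, hv, rfl⟩
    rw [mem_dualFace] at hv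
    refine ⟨fun x hx => hv.1 _ (hC' x hx), fun x hx => ?_⟩
    obtain ⟨y, hy, rfl⟩ := PointedCone.mem_map.1 hx
    rw [LinearMap.dualMap_apply, hg'g]
    exact hv.2 y hy
  · rintro ⟨h1, h2⟩
    refine ⟨g.dualMap u, mem_dualFace.2 ⟨fun x hx => h1 _ (map_mem_of_map_eq hC hx),
      fun x hx => h2 _ (PointedCone.mem_map.2 ⟨x, hx, rfl⟩)⟩, ?_⟩
    ext x
    rw [LinearMap.dualMap_apply, LinearMap.dualMap_apply, hgg']

theorem isFaceOf_map_of_mul_eq_one {C F : PointedCone ℝ V} {g g' : Module.End ℝ V}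
    (h' : g' * g = 1) (hC : C.map g = C) (hF : F.IsFaceOf C) : (F.map g).IsFaceOf C := by
  have hinj : Function.Injective g := Function.LeftInverse.injective
    (g := g') fun x => LinearMap.congr_fun h' x
  have := hF.map g hinj
  rwa [hC] at this

theorem dualFace_map_eq_iff {S : Set V} (hS : S.Finite) {F : PointedCone ℝ V}
    {g g' : Module.End ℝ V} (h : g * g' = 1) (h' : g' * g = 1)
    (hC : (PointedCone.hull ℝ S).map g = PointedCone.hull ℝ S)
    (hF : F.IsFaceOf (PointedCone.hull ℝ S)) :
    (dualFace (PointedCone.hull ℝ S) F).map (g'.dualMap) = dualFace (PointedCone.hull ℝ S) F ↔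
      F.map g = F := by
  have hFg := isFaceOf_map_of_mul_eq_one h' hC hF
  rw [dualFace_map h h' hC]
  constructor
  · intro h1
    exact le_antisymm ((dualFace_le_iff hS hFg hF).1 h1.ge) ((dualFace_le_iff hS hF hFg).1 h1.le)
  · intro h1
    rw [h1]

end DualFaces

end EquivariantCone

namespace EquivariantCone

open Polynomial Module

/-! ### Kazhdan–Lusztig–Stanley polynomials -/

theorem reflect_sum {R ι : Type*} [Semiring R] (n : ℕ) (T : Finset ι) (f : ι → R[X]) :
    (∑ i ∈ T, f i).reflect n = ∑ i ∈ T, (f i).reflect n := by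
  ext k
  simp [coeff_reflect]

/-- If `R` is antisymmetric, then minus its lower half `G` satisfies `t ^ r * G(1 / t) = G + R`. -/
theorem reflect_neg_trunc {r : ℕ} {R : ℂ[X]} (hdeg : R.natDegree ≤ r)
    (hR : R.reflect r = -R) (G : ℂ[X])
    (hG : ∀ i, G.coeff i = if i < (r + 1) / 2 then -R.coeff i else 0) :
    G.natDegree ≤ r ∧ G.reflect r = G + R := by
  have h1 : ∀ i, r < i → R.coeff i = 0 := fun i hi =>
    coeff_eq_zero_of_natDegree_lt (hdeg.trans_lt hi)
  have h2 : ∀ i, i ≤ r → R.coeff (r - i) = -R.coeff i := fun i hi => by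
    rw [← coeff_neg, ← hR, coeff_reflect, revAt_le hi]
  refine ⟨natDegree_le_iff_coeff_eq_zero.2 fun i hi => ?_, ?_⟩
  · rw [hG, if_neg (by omega)]
  · ext i
    rw [coeff_reflect, coeff_add]
    rcases lt_or_ge r i with hi | hi
    · rw [revAt_eq_self_of_lt hi, h1 i hi, add_zero]
    · rw [revAt_le hi, hG, hG, h2 i hi]
      have h3 := h2 i hi
      split_ifs with ha hb hb
      · omega
      · ring
      · ring
      -- The middle coefficient, for even `r`, lies outside the truncation on both sides;
      -- antisymmetry makes it zero.
      · have : r - i = i := by omega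
        rw [this] at h3
        linear_combination (-1 / 2 : ℂ) * h3

theorem natDegree_div_eq {p q : ℂ[X]} (hq : q.Monic) : (p /ₘ q).natDegree =
    p.natDegree - q.natDegree := natDegree_divByMonic p hq

theorem divByMonic_mul_self {p q : ℂ[X]} (hq : q.Monic) (h : q ∣ p) : (p /ₘ q) * q = p := by
  rw [mul_comm]
  have h1 := modByMonic_add_div p q
  rwa [(modByMonic_eq_zero_iff_dvd hq).2 h, zero_add] at h1

theorem divByMonic_mul_divByMonic {p q u : ℂ[X]} (hq : q.Monic) (hu : u.Monic) (hqp : q ∣ p)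
    (huq : u ∣ q) : (p /ₘ q) * (q /ₘ u) = p /ₘ u := by
  refine mul_right_cancel₀ hu.ne_zero ?_
  rw [mul_assoc, divByMonic_mul_self hu huq, divByMonic_mul_self hq hqp,
    divByMonic_mul_self hu (huq.trans hqp)]

/-- Reversal is multiplicative for matching degrees, so the functional equation of `q` can be
divided out of that of `p`. As `b` is its own inverse, the quotient has sign `a * b`. -/
theorem reflect_divByMonic {p q : ℂ[X]} (hp : p.Monic) (hq : q.Monic) (hqp : q ∣ p) {a b : ℂ}
    (hb : b * b = 1) (hpa : p.reflect p.natDegree = C a * p)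
    (hqb : q.reflect q.natDegree = C b * q) :
    (p /ₘ q).reflect (p.natDegree - q.natDegree) = C (a * b) * (p /ₘ q) := by
  have hle : q.natDegree ≤ p.natDegree := natDegree_le_of_dvd hqp hp.ne_zero
  have h1 : p.reflect p.natDegree =
      (p /ₘ q).reflect (p.natDegree - q.natDegree) * q.reflect q.natDegree := by
    rw [← reflect_mul _ _ (natDegree_div_eq hq).le le_rfl, divByMonic_mul_self hq hqp,
      Nat.sub_add_cancel hle]
  have hb0 : C b * q ≠ 0 := mul_ne_zero (C_ne_zero.2 (left_ne_zero_of_mul_eq_one hb)) hq.ne_zero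
  refine mul_right_cancel₀ hb0 ?_
  rw [← hqb, ← h1, hpa, hqb]
  have h2 : C (a * b) * (p /ₘ q) * (C b * q) = C a * (C b * C b) * ((p /ₘ q) * q) := by
    rw [C_mul]; ring
  rw [h2, ← C_mul, hb, divByMonic_mul_self hq hqp]
  simp

/-- The duality of the Kazhdan–Lusztig–Stanley polynomials of the kernel `p y / p x`. -/
theorem reflect_eq_sum_of_euler {α : Type*} [Fintype α] [PartialOrder α]
    (r : α → ℕ) (p G : α → ℂ[X]) (s : α → ℂ) (hs : ∀ x, s x * s x = 1) (hr : StrictMono r)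
    (hp : ∀ x, (p x).Monic) (hpr : ∀ x, (p x).natDegree = r x)
    (hps : ∀ x, (p x).reflect (r x) = C (s x) * p x) (hdvd : ∀ x y, x ≤ y → p x ∣ p y)
    (hE : ∀ x y (T : Finset α), x < y → (∀ z, z ∈ T ↔ x ≤ z ∧ z ≤ y) → ∑ z ∈ T, s z = 0)
    (hG0 : ∀ x, r x = 0 → G x = 1)
    (hG : ∀ y, 0 < r y → ∀ T : Finset α, (∀ x, x ∈ T ↔ x < y) → ∀ i, (G y).coeff i =
      if i < (r y + 1) / 2 then -(∑ x ∈ T, (p y /ₘ p x) * G x).coeff i else 0) (y : α) :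
    (G y).natDegree ≤ r y ∧ ∀ T : Finset α, (∀ x, x ∈ T ↔ x ≤ y) →
      (G y).reflect (r y) = ∑ x ∈ T, (p y /ₘ p x) * G x := by
  classical
  induction hk : r y using Nat.strong_induction_on generalizing y with
  | _ k ih =>
  subst hk
  have hself : p y /ₘ p y = 1 := by
    refine mul_right_cancel₀ (hp y).ne_zero ?_
    rw [divByMonic_mul_self (hp y) dvd_rfl, one_mul]
  rcases Nat.eq_zero_or_pos (r y) with h0 | hpos
  · rw [h0, hG0 y h0]
    refine ⟨by simp, fun T hT => ?_⟩
    have : T = {y} := by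
      ext x
      rw [hT, Finset.mem_singleton]
      refine ⟨fun h => ?_, fun h => h.le⟩
      by_contra hne
      have := hr (lt_of_le_of_ne h hne)
      omega
    rw [this, Finset.sum_singleton, hself, hG0 y h0]
    simp
  · set T₀ : Finset α := Finset.univ.filter (· < y) with hT₀
    have hT₀m : ∀ x, x ∈ T₀ ↔ x < y := fun x => by simp [hT₀]
    set R := ∑ x ∈ T₀, (p y /ₘ p x) * G x with hR
    have hdegκ : ∀ x, (p y /ₘ p x).natDegree = r y - r x := fun x => by
      rw [natDegree_div_eq (hp x), hpr, hpr]
    have hdeg : R.natDegree ≤ r y := by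
      refine natDegree_sum_le_of_forall_le _ _ fun x hx => ?_
      have hlt := hr ((hT₀m x).1 hx)
      refine natDegree_mul_le.trans ?_
      rw [hdegκ]
      have := (ih _ hlt x rfl).1
      omega
    -- The induction hypothesis expands each reversed `G x`, and the kernels compose as `(p y / p x)
    -- (p x / p z) = p y / p z`. The coefficient of `(p y / p z) G z` is then `s y` times the sum of
    -- `s x` over `z ≤ x < y`, which is `-1` by Euler's relation.
    have hrefl : R.reflect (r y) = -R := by
      have h1 : ∀ x ∈ T₀, ((p y /ₘ p x) * G x).reflect (r y) =
          ∑ z ∈ T₀, if z ≤ x then C (s y * s x) * ((p y /ₘ p z) * G z) else 0 := by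
        intro x hx
        have hxy := (hT₀m x).1 hx
        have hlt := hr hxy
        obtain ⟨hd, he⟩ := ih _ hlt x rfl
        have h2 : r y = (r y - r x) + r x := by omega
        conv_lhs => rw [h2]
        rw [reflect_mul _ _ (hdegκ x).le hd, he (T₀.filter (· ≤ x)) (fun z => by
          rw [Finset.mem_filter, hT₀m]
          exact ⟨fun h => h.2, fun h => ⟨h.trans_lt hxy, h⟩⟩)]
        have h3 := reflect_divByMonic (hp y) (hp x) (hdvd x y hxy.le) (hs x)
          (by rw [hpr]; exact hps y) (by rw [hpr]; exact hps x)
        rw [hpr, hpr] at h3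
        rw [h3, Finset.mul_sum, Finset.sum_filter]
        refine Finset.sum_congr rfl fun z hz => ?_
        split_ifs with hzx
        · rw [← divByMonic_mul_divByMonic (hp x) (hp z) (hdvd x y hxy.le) (hdvd z x hzx)]
          ring
        · rfl
      rw [hR, reflect_sum, Finset.sum_congr rfl h1, Finset.sum_comm, ← Finset.sum_neg_distrib]
      refine Finset.sum_congr rfl fun z hz => ?_
      have hzy := (hT₀m z).1 hz
      have h4 := hE z y (insert y (T₀.filter (z ≤ ·))) hzy (fun x => by
        rw [Finset.mem_insert, Finset.mem_filter, hT₀m]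
        constructor
        · rintro (rfl | h)
          · exact ⟨hzy.le, le_rfl⟩
          · exact ⟨h.2, h.1.le⟩
        · rintro ⟨ha, hb⟩
          rcases hb.eq_or_lt with h | h
          · exact Or.inl h
          · exact Or.inr ⟨h, ha⟩)
      rw [Finset.sum_insert (by simp [hT₀])] at h4
      rw [← Finset.sum_filter, ← Finset.sum_mul, ← map_sum, ← Finset.mul_sum,
        eq_neg_of_add_eq_zero_right h4, mul_neg, hs, map_neg, map_one, neg_one_mul]
    obtain ⟨h5, h6⟩ := reflect_neg_trunc hdeg hrefl (G y) (hG y hpos T₀ hT₀m)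
    refine ⟨h5, fun T hT => ?_⟩
    have : T = insert y T₀ := by
      ext x
      rw [hT, Finset.mem_insert, hT₀m, le_iff_eq_or_lt]
    rw [h6, this, Finset.sum_insert (by simp [hT₀]), hself, one_mul]

/-! ### The numerical `G`-polynomial of a cone with an automorphism -/

section GNum

variable {V : Type*} [AddCommGroup V] [Module ℝ V] [FiniteDimensional ℝ V]

/-- The proper faces that are fixed by a linear map. -/
abbrev fixedProperFaces (g : Module.End ℝ V) (D : PointedCone ℝ V) : Set (PointedCone ℝ V) :=
  {E | E ∈ properFaces D ∧ E.map g = E}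

open Classical in
/-- The value of the polynomial `G(D, t)` at a group element that acts through `g`. -/
def gNum (g : Module.End ℝ V) (D : PointedCone ℝ V) : ℂ[X] :=
  if D = ⊥ then 1
  else
    PowerSeries.trunc ((dim D + 1) / 2)
      -- The minus sign is the quotient of `1 - t` by the divisor `t - 1`.
      (-(((∑ᶠ E : fixedProperFaces g D, (facePoly g (linSpan D) /ₘ facePoly g (linSpan E.1)) *
        gNum g E.1 : ℂ[X])) : PowerSeries ℂ))
termination_by dim D
decreasing_by exact dim_lt_of_isFaceOf E.2.1.1 E.2.1.2

theorem gNum_bot (g : Module.End ℝ V) : gNum g (⊥ : PointedCone ℝ V) = 1 := by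
  rw [gNum, if_pos rfl]

theorem coeff_gNum {g : Module.End ℝ V} {D : PointedCone ℝ V} (hD : D ≠ ⊥)
    (T : Finset (PointedCone ℝ V)) (hT : ∀ E, E ∈ T ↔ E ∈ fixedProperFaces g D) (i : ℕ) :
    (gNum g D).coeff i = if i < (dim D + 1) / 2 then
      -(∑ E ∈ T, (facePoly g (linSpan D) /ₘ facePoly g (linSpan E)) * gNum g E).coeff i else 0 := by
  have h1 : ∑ᶠ E : fixedProperFaces g D, (facePoly g (linSpan D) /ₘ facePoly g (linSpan E.1)) *
        gNum g E.1 = ∑ E ∈ T, (facePoly g (linSpan D) /ₘ facePoly g (linSpan E)) * gNum g E := by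
    have : (T : Set (PointedCone ℝ V)) = fixedProperFaces g D := Set.ext fun E => hT E
    rw [← finsum_mem_coe_finset, this]
    exact finsum_set_coe_eq_finsum_mem (f := fun E =>
      (facePoly g (linSpan D) /ₘ facePoly g (linSpan E)) * gNum g E) _
  rw [gNum, if_neg hD, PowerSeries.coeff_trunc, h1, map_neg, Polynomial.coeff_coe]

theorem facePoly_conj {g g' : Module.End ℝ V} (e : V ≃ₗ[ℝ] V)
    (h : ∀ x, g' (e x) = e (g x)) {W : Submodule ℝ V} (hW : W ≤ W.comap g) :
    facePoly g' (W.map (e : V →ₗ[ℝ] V)) = facePoly g W := by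
  have hW' : W.map (e : V →ₗ[ℝ] V) ≤ (W.map (e : V →ₗ[ℝ] V)).comap g' := by
    rintro _ ⟨x, hx, rfl⟩
    exact ⟨g x, hW hx, (h x).symm⟩
  rw [facePoly_eq hW, facePoly_eq hW']
  have : g'.restrict hW' = (e.submoduleMap W).conj (g.restrict hW) := by
    ext ⟨_, x, hx, rfl⟩
    rw [LinearEquiv.conj_apply_apply]
    have : (e.submoduleMap W).symm ⟨(e : V →ₗ[ℝ] V) x, x, hx, rfl⟩ = ⟨x, hx⟩ := by
      rw [LinearEquiv.symm_apply_eq]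
      rfl
    rw [this]
    exact h x
  rw [this, LinearEquiv.charpoly_conj]

theorem le_comap_of_map_eq {g : Module.End ℝ V} {D : PointedCone ℝ V} (h : D.map g = D) :
    linSpan D ≤ (linSpan D).comap g :=
  Submodule.span_le.2 fun _ hx => Submodule.subset_span (map_mem_of_map_eq h hx)

theorem dim_map_equiv (e : V ≃ₗ[ℝ] V) (D : PointedCone ℝ V) :
    dim (D.map (e : V →ₗ[ℝ] V)) = dim D := by
  rw [dim, dim, linSpan_map]
  exact LinearEquiv.finrank_map_eq e _

theorem map_map_symm (e : V ≃ₗ[ℝ] V) (D : PointedCone ℝ V) :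
    (D.map (e.symm : V →ₗ[ℝ] V)).map (e : V →ₗ[ℝ] V) = D := by
  rw [PointedCone.map_map]
  have : (e : V →ₗ[ℝ] V) ∘ₗ (e.symm : V →ₗ[ℝ] V) = LinearMap.id := by ext; simp
  rw [this]
  exact PointedCone.map_id D

theorem map_symm_map (e : V ≃ₗ[ℝ] V) (D : PointedCone ℝ V) :
    (D.map (e : V →ₗ[ℝ] V)).map (e.symm : V →ₗ[ℝ] V) = D := map_map_symm e.symm D

theorem map_conj_eq_iff {g g' : Module.End ℝ V} (e : V ≃ₗ[ℝ] V)
    (h : ∀ x, g' (e x) = e (g x)) (E : PointedCone ℝ V) :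
    (E.map (e : V →ₗ[ℝ] V)).map g' = E.map (e : V →ₗ[ℝ] V) ↔ E.map g = E := by
  have h1 : (E.map (e : V →ₗ[ℝ] V)).map g' = (E.map g).map (e : V →ₗ[ℝ] V) := by
    rw [PointedCone.map_map, PointedCone.map_map]
    congr 1
    ext x
    exact h x
  rw [h1]
  refine ⟨fun h2 => ?_, fun h2 => by rw [h2]⟩
  rw [← map_symm_map e (E.map g), h2, map_symm_map]

theorem isFaceOf_map_equiv_iff (e : V ≃ₗ[ℝ] V) (E D : PointedCone ℝ V) :
    (E.map (e : V →ₗ[ℝ] V)).IsFaceOf (D.map (e : V →ₗ[ℝ] V)) ↔ E.IsFaceOf D := by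
  refine ⟨fun h => ?_, fun h => h.map _ e.injective⟩
  have := h.map (e.symm : V →ₗ[ℝ] V) e.symm.injective
  rwa [map_symm_map, map_symm_map] at this

/-- Induction on the dimension, with `e` carrying fixed faces to fixed faces. For `e` the action of
a group element, this provides the compatibility with conjugation required by `evalAt_orbitSum`. -/
theorem gNum_conj {g g' : Module.End ℝ V} (e : V ≃ₗ[ℝ] V)
    (h : ∀ x, g' (e x) = e (g x)) (D : PointedCone ℝ V) (hDg : D.map g = D) :
    gNum g' (D.map (e : V →ₗ[ℝ] V)) = gNum g D := by
  classical
  induction hk : dim D using Nat.strong_induction_on generalizing D with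
  | _ k ih =>
  subst hk
  by_cases hD : D = ⊥
  · subst hD
    have : (⊥ : PointedCone ℝ V).map (e : V →ₗ[ℝ] V) = ⊥ := Submodule.map_bot _
    rw [this, gNum_bot, gNum_bot]
  · have hD' : D.map (e : V →ₗ[ℝ] V) ≠ ⊥ := by
      intro h1
      apply hD
      rw [← map_symm_map e D, h1]
      exact Submodule.map_bot _
    rw [gNum, gNum, if_neg hD, if_neg hD', dim_map_equiv]
    congr 3
    let φ : fixedProperFaces g D ≃ fixedProperFaces g' (D.map (e : V →ₗ[ℝ] V)) :=
      { toFun := fun E => ⟨E.1.map (e : V →ₗ[ℝ] V), ⟨(isFaceOf_map_equiv_iff e _ _).2 E.2.1.1,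
          fun h1 => E.2.1.2 (by rw [← map_symm_map e E.1, h1, map_symm_map])⟩,
          (map_conj_eq_iff e h _).2 E.2.2⟩
        invFun := fun E => ⟨E.1.map (e.symm : V →ₗ[ℝ] V),
          ⟨(isFaceOf_map_equiv_iff e _ _).1 (by rw [map_map_symm]; exact E.2.1.1),
          fun h1 => E.2.1.2 (by rw [← map_map_symm e E.1, h1])⟩,
          (map_conj_eq_iff e h _).1 (by rw [map_map_symm]; exact E.2.2)⟩
        left_inv := fun E => Subtype.ext (map_symm_map e E.1)
        right_inv := fun E => Subtype.ext (map_map_symm e E.1) }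
    refine (finsum_eq_of_bijective φ φ.bijective fun E => ?_).symm
    change _ = (_ /ₘ facePoly g' (linSpan (E.1.map (e : V →ₗ[ℝ] V)))) *
      gNum g' (E.1.map (e : V →ₗ[ℝ] V))
    rw [ih _ (dim_lt_of_isFaceOf E.2.1.1 E.2.1.2) E.1 E.2.2 rfl, linSpan_map, linSpan_map,
      facePoly_conj e h (le_comap_of_map_eq hDg), facePoly_conj e h (le_comap_of_map_eq E.2.2)]

end GNum

end EquivariantCone

namespace EquivariantCone

open Polynomial Module

/-! ### Kazhdan–Lusztig–Stanley duality for the faces of the dual cone -/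

section DualGNum

variable {n : ℕ} {g g' : Module.End ℝ (Fin n → ℝ)} {N : ℕ} {S : Set (Fin n → ℝ)}

theorem facePoly_dualFace_mul (h : g * g' = 1) (hN : 0 < N) (hg : g ^ N = 1) (hS : S.Finite)
    {F : PointedCone ℝ (Fin n → ℝ)} (hF : F.IsFaceOf (PointedCone.hull ℝ S)) (hFg : F.map g = F) :
    facePoly g'.dualMap (linSpan (dualFace (PointedCone.hull ℝ S) F)) * facePoly g (linSpan F) =
      facePoly g ⊤ := by
  rw [linSpan_dualFace hS hF]
  exact facePoly_dualAnnihilator (le_comap_of_map_eq hFg) h hN hg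

theorem dim_dualFace (hS : S.Finite) {F : PointedCone ℝ (Fin n → ℝ)}
    (hF : F.IsFaceOf (PointedCone.hull ℝ S)) :
    dim (dualFace (PointedCone.hull ℝ S) F) = n - dim F := by
  rw [dim, linSpan_dualFace hS hF, dim]
  have := Subspace.finrank_add_finrank_dualAnnihilator_eq (linSpan F)
  rw [finrank_fin_fun] at this
  omega

theorem natDegree_facePoly_top : (facePoly g ⊤).natDegree = n := by
  rw [natDegree_facePoly (W := ⊤) (fun _ _ => Submodule.mem_top), finrank_top, finrank_fin_fun]

/-- This is the functional equation of `facePoly g ⊤` divided by that of `F`. It expresses the sign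
of `F^*` through `F`, so Euler's relation is needed only for the original cone and not for its dual.
-/
theorem reflect_facePoly_dualFace (h : g * g' = 1) (h' : g' * g = 1) (hN : 0 < N) (hg : g ^ N = 1)
    (hS : S.Finite) (hSg : (PointedCone.hull ℝ S).map g = PointedCone.hull ℝ S)
    {F : PointedCone ℝ (Fin n → ℝ)} (hF : F.IsFaceOf (PointedCone.hull ℝ S)) (hFg : F.map g = F) :
    (facePoly g'.dualMap (linSpan (dualFace (PointedCone.hull ℝ S) F))).reflect
      (dim (dualFace (PointedCone.hull ℝ S) F)) =
      C (fixSign g ⊤ * fixSign g (linSpan F)) *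
        facePoly g'.dualMap (linSpan (dualFace (PointedCone.hull ℝ S) F)) := by
  set p' := facePoly g'.dualMap (linSpan (dualFace (PointedCone.hull ℝ S) F)) with hp'
  have hmul := facePoly_dualFace_mul h hN hg hS hF hFg
  have hle := le_comap_of_map_eq hFg
  have hle' := le_comap_of_map_eq ((dualFace_map_eq_iff hS h h' hSg hF).2 hFg)
  have hp'd : p'.natDegree = dim (dualFace (PointedCone.hull ℝ S) F) := natDegree_facePoly hle'
  have hpd : (facePoly g (linSpan F)).natDegree = dim F := natDegree_facePoly hle
  have hdeg : dim (dualFace (PointedCone.hull ℝ S) F) + dim F = n := by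
    have h0 := natDegree_facePoly_top (g := g)
    rwa [← hmul, (facePoly_monic _ _).natDegree_mul (facePoly_monic _ _), ← hp', hp'd, hpd] at h0
  have h1 := reflect_mul p' (facePoly g (linSpan F)) hp'd.le hpd.le
  rw [hp', hmul, hdeg] at h1
  have h2 := reflect_facePoly (g := g) (W := ⊤) (fun _ _ => Submodule.mem_top) hN hg
  rw [finrank_top, finrank_fin_fun, h1] at h2
  have h3 := reflect_facePoly hle hN hg
  change reflect (dim F) _ = _ at h3
  rw [h3, ← hmul] at h2
  have hne : C (fixSign g (linSpan F)) * facePoly g (linSpan F) ≠ 0 :=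
    mul_ne_zero (C_ne_zero.2 (fixSign_ne_zero _ _)) (facePoly_monic _ _).ne_zero
  refine mul_right_cancel₀ hne ?_
  rw [hp', h2, C_mul]
  have h4 : C (fixSign g (linSpan F)) * C (fixSign g (linSpan F)) = 1 := by
    rw [← C_mul, fixSign_mul_self, C_1]
  linear_combination (-C (fixSign g ⊤) * p' * facePoly g (linSpan F)) * h4

theorem exists_fixed_of_isFaceOf_dualFace (h : g * g' = 1) (h' : g' * g = 1) (hS : S.Finite)
    (hSg : (PointedCone.hull ℝ S).map g = PointedCone.hull ℝ S)
    {F : PointedCone ℝ (Fin n → ℝ)} (hF : F.IsFaceOf (PointedCone.hull ℝ S))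
    (E : PointedCone ℝ (Module.Dual ℝ (Fin n → ℝ))) :
    E ∈ fixedProperFaces g'.dualMap (dualFace (PointedCone.hull ℝ S) F) ↔
      ∃ M : PointedCone ℝ (Fin n → ℝ), (M.IsFaceOf (PointedCone.hull ℝ S) ∧ M.map g = M) ∧ F < M ∧
        dualFace (PointedCone.hull ℝ S) M = E := by
  constructor
  · rintro ⟨⟨hE, hne⟩, hEg⟩
    obtain ⟨M, hM, hFM, rfl⟩ := exists_eq_dualFace hS hF hE
    exact ⟨M, ⟨hM, (dualFace_map_eq_iff hS h h' hSg hM).1 hEg⟩,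
      lt_of_le_of_ne hFM fun h1 => hne (by rw [h1]), rfl⟩
  · rintro ⟨M, ⟨hM, hMg⟩, hFM, rfl⟩
    refine ⟨⟨dualFace_isFaceOf hM.le hFM.le, fun h1 => hFM.not_ge ?_⟩,
      (dualFace_map_eq_iff hS h h' hSg hM).2 hMg⟩
    exact (dualFace_le_iff hS hM hF).1 h1.ge

/-- The duality of the `G`-polynomials of the faces of the dual cone. -/
theorem facePoly_mul_reflect_gNum (h : g * g' = 1) (h' : g' * g = 1) (hN : 0 < N) (hg : g ^ N = 1)
    (hgΛ : ∀ x ∈ intLattice n, g x ∈ intLattice n) (hS : S.Finite) (hSΛ : S ⊆ intLattice n)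
    (hSg : (PointedCone.hull ℝ S).map g = PointedCone.hull ℝ S)
    {F : PointedCone ℝ (Fin n → ℝ)} (hF : F.IsFaceOf (PointedCone.hull ℝ S)) (hFg : F.map g = F)
    (T : Finset (PointedCone ℝ (Fin n → ℝ)))
    (hT : ∀ M, M ∈ T ↔ (M.IsFaceOf (PointedCone.hull ℝ S) ∧ M.map g = M) ∧ F ≤ M) :
    (gNum g'.dualMap (dualFace (PointedCone.hull ℝ S) F)).natDegree ≤ n - dim F ∧
    facePoly g (linSpan F) * (gNum g'.dualMap (dualFace (PointedCone.hull ℝ S) F)).reflect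
        (n - dim F) =
      ∑ M ∈ T, facePoly g (linSpan M) * gNum g'.dualMap (dualFace (PointedCone.hull ℝ S) M) := by
  classical
  let β := {M : PointedCone ℝ (Fin n → ℝ) // M.IsFaceOf (PointedCone.hull ℝ S) ∧ M.map g = M}
  have hfin : Finite β := ((finite_faces hS).subset (fun M hM => hM.1) :
    {M : PointedCone ℝ (Fin n → ℝ) | M.IsFaceOf (PointedCone.hull ℝ S) ∧ M.map g = M}.Finite)
  -- Passing to dual faces reverses inclusion, hence the opposite order.
  let α := βᵒᵈ
  have : Finite α := hfin
  have : Fintype α := Fintype.ofFinite α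
  let D : α → PointedCone ℝ (Module.Dual ℝ (Fin n → ℝ)) := fun x =>
    dualFace (PointedCone.hull ℝ S) (OrderDual.ofDual x).1
  have hinj : Function.Injective fun z : α => (OrderDual.ofDual z).1 := fun a b hab =>
    OrderDual.ofDual.injective (Subtype.ext hab)
  have hDface : ∀ x y : α, x ≤ y → (D x).IsFaceOf (D y) := fun x y hxy =>
    dualFace_isFaceOf (OrderDual.ofDual x).2.1.le hxy
  have hDlt : ∀ x y : α, x < y → dim (D x) < dim (D y) := fun x y hxy => by
    refine dim_lt_of_isFaceOf (hDface x y hxy.le) fun h1 => hxy.not_ge ?_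
    exact (dualFace_le_iff hS (OrderDual.ofDual x).2.1 (OrderDual.ofDual y).2.1).1 h1.ge
  have hDg : ∀ x : α, (D x).map g'.dualMap = D x := fun x =>
    (dualFace_map_eq_iff hS h h' hSg (OrderDual.ofDual x).2.1).2 (OrderDual.ofDual x).2.2
  have key := reflect_eq_sum_of_euler (α := α) (fun x => dim (D x))
    (fun x => facePoly g'.dualMap (linSpan (D x))) (fun x => gNum g'.dualMap (D x))
    (fun x => fixSign g ⊤ * fixSign g (linSpan (OrderDual.ofDual x).1))
    (fun x => by
      have h1 := fixSign_mul_self g ⊤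
      have h2 := fixSign_mul_self g (linSpan (OrderDual.ofDual x).1)
      linear_combination (fixSign g (linSpan (OrderDual.ofDual x).1)) ^ 2 * h1 + h2)
    hDlt (fun x => facePoly_monic _ _)
    (fun x => natDegree_facePoly (le_comap_of_map_eq (hDg x)))
    (fun x => reflect_facePoly_dualFace h h' hN hg hS hSg (OrderDual.ofDual x).2.1
      (OrderDual.ofDual x).2.2)
    (fun x y hxy => facePoly_dvd (le_comap_of_map_eq (hDg x)) (le_comap_of_map_eq (hDg y))
      (Submodule.span_mono (hDface x y hxy).le))
    (fun x y U hxy hU => by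
      have hyx : (OrderDual.ofDual y).1 < (OrderDual.ofDual x).1 := hxy
      have h1 := euler_fixed hN hg hgΛ hS hSΛ hSg (OrderDual.ofDual y).2.1 (OrderDual.ofDual y).2.2
        (OrderDual.ofDual x).2.1 (OrderDual.ofDual x).2.2 hyx.le hyx.ne
        (U.image fun z => (OrderDual.ofDual z).1) (fun M => by
          rw [Finset.mem_image]
          constructor
          · rintro ⟨z, hz, rfl⟩
            exact ⟨(OrderDual.ofDual z).2, ((hU z).1 hz).2, ((hU z).1 hz).1⟩
          · rintro ⟨hM, h2, h3⟩
            exact ⟨OrderDual.toDual ⟨M, hM⟩, (hU _).2 ⟨h3, h2⟩, rfl⟩)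
      rw [Finset.sum_image fun (a : α) _ (b : α) _ hab => hinj hab] at h1
      rw [← Finset.mul_sum, h1, mul_zero])
    (fun x hx => by
      have h1 : linSpan (D x) = ⊥ := Submodule.finrank_eq_zero.1 hx
      have : D x = ⊥ := by
        rw [eq_bot_iff]
        intro u hu
        have : u ∈ linSpan (D x) := Submodule.subset_span hu
        rw [h1, Submodule.mem_bot] at this
        exact (Submodule.mem_bot _).2 this
      rw [this, gNum_bot])
    (fun y hy U hU i => by
      have hne : D y ≠ ⊥ := by
        intro h1
        have h2 : dim (D y) = 0 := by
          rw [h1, dim]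
          have : linSpan (⊥ : PointedCone ℝ (Module.Dual ℝ (Fin n → ℝ))) = ⊥ := by
            rw [linSpan, Submodule.bot_coe, Submodule.span_zero_singleton]
          rw [this, finrank_bot]
        omega
      have hinj : Set.InjOn D U := fun a _ b _ hab => Subtype.ext (le_antisymm
        ((dualFace_le_iff hS (OrderDual.ofDual a).2.1 (OrderDual.ofDual b).2.1).1
          (le_of_eq hab.symm))
        ((dualFace_le_iff hS (OrderDual.ofDual b).2.1 (OrderDual.ofDual a).2.1).1
          (le_of_eq hab)))
      rw [coeff_gNum hne (U.image D) fun E => ?_, Finset.sum_image hinj]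
      rw [Finset.mem_image, exists_fixed_of_isFaceOf_dualFace h h' hS hSg (OrderDual.ofDual y).2.1]
      constructor
      · rintro ⟨x, hx, rfl⟩
        exact ⟨_, (OrderDual.ofDual x).2, (hU x).1 hx, rfl⟩
      · rintro ⟨M, hM, hlt, rfl⟩
        exact ⟨OrderDual.toDual ⟨M, hM⟩, (hU _).2 hlt, rfl⟩)
    (OrderDual.toDual ⟨F, hF, hFg⟩)
  obtain ⟨k1, k2⟩ := key
  have hdim := dim_dualFace hS hF
  have hDF : D (OrderDual.toDual ⟨F, hF, hFg⟩) = dualFace (PointedCone.hull ℝ S) F := rfl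
  rw [hDF, hdim] at k1 k2
  refine ⟨k1, ?_⟩
  have hTim : T = (Finset.univ.filter fun x : α => x ≤ OrderDual.toDual ⟨F, hF, hFg⟩).image
      fun z => (OrderDual.ofDual z).1 := by
    ext M
    rw [hT, Finset.mem_image]
    constructor
    · rintro ⟨hM, hFM⟩
      exact ⟨OrderDual.toDual ⟨M, hM⟩, Finset.mem_filter.2 ⟨Finset.mem_univ _, hFM⟩, rfl⟩
    · rintro ⟨z, hz, rfl⟩
      exact ⟨(OrderDual.ofDual z).2, (Finset.mem_filter.1 hz).2⟩
  rw [k2 (Finset.univ.filter fun x : α => x ≤ OrderDual.toDual ⟨F, hF, hFg⟩) (fun x => by simp),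
    hTim, Finset.sum_image fun (a : α) _ (b : α) _ hab => hinj hab, Finset.mul_sum]
  refine Finset.sum_congr rfl fun x hx => ?_
  have hx' := (Finset.mem_filter.1 hx).2
  rw [← mul_assoc]
  congr 1
  -- Since the polynomials of a face and of its dual face have product `facePoly g ⊤`, the kernel
  -- `p_{F^*} / p_{M^*}` times `p_F` is `p_M`.
  have hm : (facePoly g'.dualMap (linSpan (D x))).Monic := facePoly_monic _ _
  refine mul_right_cancel₀ hm.ne_zero ?_
  rw [mul_assoc, divByMonic_mul_self hm, mul_comm (facePoly g (linSpan F)),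
    facePoly_dualFace_mul h hN hg hS hF hFg, mul_comm,
    facePoly_dualFace_mul h hN hg hS (OrderDual.ofDual x).2.1 (OrderDual.ofDual x).2.2]
  exact facePoly_dvd (le_comap_of_map_eq (hDg x)) (le_comap_of_map_eq (hDg (OrderDual.toDual
    ⟨F, hF, hFg⟩))) (Submodule.span_mono (hDface _ _ hx').le)

end DualGNum

end EquivariantCone

namespace EquivariantCone

open Polynomial Module

/-! ### Character values -/

section Values

variable {Γ W : Type*} [Group Γ] [AddCommGroup W] [Module ℝ W]

theorem wedgeChar_apply [FiniteDimensional ℝ W] (σ : Representation ℝ Γ W) {k : ℕ}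
    (hk : k ≤ finrank ℝ W) (γ : Γ) : wedgeChar σ k γ =
      (-1) ^ k * (((σ γ).charpoly.map (algebraMap ℝ ℂ)).coeff (finrank ℝ W - k)) := by
  have h : (extPow σ k).character γ = (-1) ^ k * (σ γ).charpoly.coeff (finrank ℝ W - k) :=
    trace_exteriorPower_map (σ γ) k hk
  rw [wedgeChar, h, coeff_map]
  simp

theorem map_detT [FiniteDimensional ℝ W] (σ : Representation ℝ Γ W) (γ : Γ) :
    (detT σ).map (Pi.evalRingHom (fun _ : Γ => ℂ) γ) = (σ γ).charpoly.map (algebraMap ℝ ℂ) := by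
  have hd : ((σ γ).charpoly.map (algebraMap ℝ ℂ)).natDegree = finrank ℝ W := by
    rw [(LinearMap.charpoly_monic _).natDegree_map, LinearMap.charpoly_natDegree]
  rw [as_sum_range' _ _ (lt_of_eq_of_lt hd (Nat.lt_succ_self _)), detT, Polynomial.map_sum]
  refine Finset.sum_congr rfl fun i hi => ?_
  have hi' : i ≤ finrank ℝ W := Nat.lt_succ_iff.1 (Finset.mem_range.1 hi)
  rw [← C_mul_X_pow_eq_monomial, Polynomial.map_mul, Polynomial.map_C, Polynomial.map_pow,
    Polynomial.map_X]
  congr 2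
  change (-1) ^ (finrank ℝ W - i) * wedgeChar σ (finrank ℝ W - i) γ = _
  rw [wedgeChar_apply σ (Nat.sub_le _ _), ← mul_assoc, ← mul_pow, neg_one_mul, neg_neg, one_pow,
    one_mul, Nat.sub_sub_self hi']

/-- The exterior powers give the coefficients of the characteristic polynomial in the opposite order
from `detT`, hence the reversal. -/
theorem map_detI [FiniteDimensional ℝ W] (σ : Representation ℝ Γ W) (γ : Γ) :
    (detI σ).map (Pi.evalRingHom (fun _ : Γ => ℂ) γ) =
      ((σ γ).charpoly.map (algebraMap ℝ ℂ)).reflect (finrank ℝ W) := by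
  have hd : (((σ γ).charpoly.map (algebraMap ℝ ℂ)).reflect (finrank ℝ W)).natDegree <
      finrank ℝ W + 1 := by
    rw [Nat.lt_succ_iff, natDegree_le_iff_coeff_eq_zero]
    intro i hi
    rw [coeff_reflect, revAt_eq_self_of_lt hi]
    refine coeff_eq_zero_of_natDegree_lt ?_
    rwa [(LinearMap.charpoly_monic _).natDegree_map, LinearMap.charpoly_natDegree]
  rw [as_sum_range' _ _ hd, detI, Polynomial.map_sum]
  refine Finset.sum_congr rfl fun i hi => ?_
  have hi' : i ≤ finrank ℝ W := Nat.lt_succ_iff.1 (Finset.mem_range.1 hi)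
  rw [← C_mul_X_pow_eq_monomial, Polynomial.map_mul, Polynomial.map_C, Polynomial.map_pow,
    Polynomial.map_X]
  congr 2
  change (-1) ^ i * wedgeChar σ i γ = _
  rw [wedgeChar_apply σ hi', ← mul_assoc, ← mul_pow, neg_one_mul, neg_neg, one_pow,
    one_mul, coeff_reflect, revAt_le hi']

theorem evalAt_coe (γ : Γ) (p : Polynomial (Γ → ℂ)) : evalAt γ (p : PowerSeries (Γ → ℂ)) =
    ((p.map (Pi.evalRingHom (fun _ : Γ => ℂ) γ) : ℂ[X]) : PowerSeries ℂ) :=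
  Polynomial.polynomial_map_coe.symm

variable [FiniteDimensional ℝ W]

theorem map_detT_spanRep (ρ : Representation ℝ Γ W) (D : PointedCone ℝ W) (hD : IsInvariant ρ D)
    (γ : Γ) : (detT (spanRep ρ D hD)).map (Pi.evalRingHom (fun _ : Γ => ℂ) γ) =
      facePoly (ρ γ) (linSpan D) := by
  rw [map_detT, facePoly_eq (Submodule.span_le.2 fun x hx => Submodule.subset_span (hD γ x hx))]
  rfl

theorem map_detI_spanRep (ρ : Representation ℝ Γ W) (D : PointedCone ℝ W) (hD : IsInvariant ρ D)
    (γ : Γ) : (detI (spanRep ρ D hD)).map (Pi.evalRingHom (fun _ : Γ => ℂ) γ) =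
      (facePoly (ρ γ) (linSpan D)).reflect (dim D) := by
  rw [map_detI, facePoly_eq (Submodule.span_le.2 fun x hx => Submodule.subset_span (hD γ x hx))]
  rfl

theorem detChar_spanRep (ρ : Representation ℝ Γ W) (D : PointedCone ℝ W) (hD : IsInvariant ρ D)
    (γ : Γ) {N : ℕ} (hN : 0 < N) (hγ : ρ γ ^ N = 1) :
    detChar (spanRep ρ D hD) γ = (-1) ^ dim D * fixSign (ρ γ) (linSpan D) := by
  rw [fixSign_eq (Submodule.span_le.2 fun x hx => Submodule.subset_span (hD γ x hx)) hN hγ,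
    ← mul_assoc]
  have : ((-1 : ℂ)) ^ dim D * (-1) ^ finrank ℝ (linSpan D) = 1 := by
    rw [dim, ← mul_pow]; simp
  rw [this, one_mul]
  rfl

-- The trace of a permutation matrix counts its ones on the diagonal.
omit [FiniteDimensional ℝ W] in
theorem permChar_apply (ρ : Representation ℝ Γ W) (S : Set W) (hS : IsInvariant ρ S)
    (hfin : S.Finite) (γ : Γ) : permChar ρ S hS γ = ((S ∩ {x | ρ γ x = x}).ncard : ℂ) := by
  classical
  let _ := actionOn ρ S hS
  have : Fintype S := hfin.fintype
  let b : Basis S ℂ (MonoidAlgebra ℂ S) := Basis.ofRepr (MonoidAlgebra.coeffLinearEquiv ℂ)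
  have h1 : permChar ρ S hS γ =
      Matrix.trace (LinearMap.toMatrix b b (Representation.ofMulAction ℂ Γ S γ)) :=
    LinearMap.trace_eq_matrix_trace ℂ b _
  have h2 : ∀ x : S, LinearMap.toMatrix b b (Representation.ofMulAction ℂ Γ S γ) x x =
      if ρ γ x = (x : W) then 1 else 0 := by
    intro x
    rw [LinearMap.toMatrix_apply]
    have hb : b x = MonoidAlgebra.single x 1 := rfl
    rw [hb, Representation.ofMulAction_single]
    have h3 : (b.repr (MonoidAlgebra.single (γ • x) 1)) x = Finsupp.single (γ • x) (1 : ℂ) x := rfl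
    rw [h3, Finsupp.single_apply]
    have h4 : γ • x = x ↔ ρ γ x = (x : W) := Subtype.ext_iff
    simp only [h4]
  rw [h1, Matrix.trace]
  simp only [Matrix.diag_apply, h2]
  rw [Finset.sum_boole]
  congr 1
  rw [← Set.ncard_coe_finset, ← Set.ncard_image_of_injective _ Subtype.val_injective]
  congr 1
  ext x
  simp [and_comm]

end Values

/-! ### Sums over orbits -/

section Orbits

variable {Γ V : Type*} [Group Γ] [Finite Γ] [AddCommGroup V] [Module ℝ V]

omit [Finite Γ] in
theorem map_rep_mul (ρ : Representation ℝ Γ V) (F : PointedCone ℝ V) (a b : Γ) :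
    F.map (ρ (a * b)) = (F.map (ρ b)).map (ρ a) := by
  rw [map_mul, Module.End.mul_eq_comp, ← PointedCone.map_map]

omit [Finite Γ] in
theorem map_rep_one (ρ : Representation ℝ Γ V) (F : PointedCone ℝ V) : F.map (ρ 1) = F := by
  rw [map_one]
  exact PointedCone.map_id F

omit [Finite Γ] in
theorem mem_stab {ρ : Representation ℝ Γ V} {F : PointedCone ℝ V} {γ : Γ} :
    γ ∈ stab ρ F ↔ F.map (ρ γ) = F := Iff.rfl

omit [Finite Γ] in
theorem map_rep_eq_iff (ρ : Representation ℝ Γ V) (F F' : PointedCone ℝ V) (x : Γ) :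
    F.map (ρ x) = F' ↔ F = F'.map (ρ x⁻¹) := by
  constructor
  · rintro rfl
    rw [← map_rep_mul, inv_mul_cancel, map_rep_one]
  · rintro rfl
    rw [← map_rep_mul, mul_inv_cancel, map_rep_one]

omit [Finite Γ] in
theorem conj_mem_stab_iff (ρ : Representation ℝ Γ V) (F : PointedCone ℝ V) (x γ : Γ) :
    x⁻¹ * γ * x ∈ stab ρ F ↔ (F.map (ρ x)).map (ρ γ) = F.map (ρ x) := by
  rw [mem_stab, mul_assoc, map_rep_mul, map_rep_mul, ← map_rep_eq_iff ρ _ _ x |>.trans eq_comm]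
  exact eq_comm

omit [Finite Γ] in
theorem evalAt_indSeries (H : Subgroup Γ) [Fintype Γ] (f : PowerSeries (H → ℂ)) (γ : Γ)
    (Ψ : Γ → PowerSeries ℂ) (hΨ : ∀ x, ∀ h : x⁻¹ * γ * x ∈ H, evalAt ⟨_, h⟩ f = Ψ x)
    (hΨ0 : ∀ x, x⁻¹ * γ * x ∉ H → Ψ x = 0) :
    evalAt γ (indSeries H f) = PowerSeries.C ((Nat.card H : ℂ)⁻¹) * ∑ x : Γ, Ψ x := by
  classical
  ext n
  rw [PowerSeries.coeff_C_mul, map_sum]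
  have h1 : PowerSeries.coeff n (evalAt γ (indSeries H f)) = ind H (PowerSeries.coeff n f) γ := by
    rw [evalAt, PowerSeries.coeff_map, indSeries, PowerSeries.coeff_mk]
    rfl
  rw [h1, ind, finsum_eq_sum_of_fintype]
  congr 1
  refine Finset.sum_congr rfl fun x _ => ?_
  split_ifs with h
  · rw [← hΨ x h, evalAt, PowerSeries.coeff_map]
    rfl
  · rw [hΨ0 x h, map_zero]

/-- The group elements carrying `F` to a given member of its orbit form a left coset of the
stabilizer. -/
theorem card_map_eq (ρ : Representation ℝ Γ V) (F : PointedCone ℝ V) (x₀ : Γ) :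
    Nat.card {x : Γ // F.map (ρ x) = F.map (ρ x₀)} = Nat.card (stab ρ F) := by
  refine Nat.card_congr
    { toFun := fun x => ⟨x₀⁻¹ * x.1, ?_⟩
      invFun := fun y => ⟨x₀ * y.1, ?_⟩
      left_inv := fun x => Subtype.ext (by simp)
      right_inv := fun y => Subtype.ext (by simp) }
  · rw [mem_stab, map_rep_mul, x.2, ← map_rep_mul, inv_mul_cancel, map_rep_one]
  · rw [map_rep_mul]
    congr 1
    exact y.2

/-- The value at `γ` of a sum of induced characters over the orbits of a finite family of cones is
a sum over the members of the family that `γ` fixes. -/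
theorem evalAt_orbitSum (ρ : Representation ℝ Γ V) (S : Set (PointedCone ℝ V)) (hS : S.Finite)
    (hinv : ∀ F ∈ S, ∀ x, F.map (ρ x) ∈ S)
    (a : S → PowerSeries (Γ → ℂ)) (f : ∀ F : S, PowerSeries (stab ρ F.1 → ℂ)) (γ : Γ)
    (A : PointedCone ℝ V → PowerSeries ℂ) (hA : ∀ F : S, evalAt γ (a F) = A F.1)
    (hAinv : ∀ F ∈ S, ∀ x, A (F.map (ρ x)) = A F)
    (Φ : PointedCone ℝ V → Γ → PowerSeries ℂ)
    (hΦ : ∀ (F : S) (y : stab ρ F.1), evalAt y (f F) = Φ F.1 y)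
    (hΦinv : ∀ F ∈ S, ∀ x, F.map (ρ (x⁻¹ * γ * x)) = F →
      Φ (F.map (ρ x)) γ = Φ F (x⁻¹ * γ * x))
    (T : Finset (PointedCone ℝ V)) (hT : ∀ F, F ∈ T ↔ F ∈ S ∧ F.map (ρ γ) = F) :
    evalAt γ (orbitSum ρ S fun F => a F * indSeries (stab ρ F.1) (f F)) =
      ∑ F ∈ T, A F * Φ F γ := by
  classical
  have : Fintype Γ := Fintype.ofFinite Γ
  have : Fintype S := hS.fintype
  have : Fintype (Quotient (orbitSetoid ρ S)) := Fintype.ofFinite _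
  let Ψ : PointedCone ℝ V → PowerSeries ℂ := fun F => if F.map (ρ γ) = F then A F * Φ F γ else 0
  -- In Frobenius' formula, `x⁻¹ γ x` lies in the stabilizer of `F` exactly when `γ` fixes the
  -- translate `xF`, and the summand depends only on this translate.
  have h1 : ∀ F : S, evalAt γ (a F * indSeries (stab ρ F.1) (f F)) =
      PowerSeries.C ((Nat.card (stab ρ F.1) : ℂ)⁻¹) * ∑ x : Γ, Ψ (F.1.map (ρ x)) := by
    intro F
    rw [map_mul, evalAt_indSeries (stab ρ F.1) (f F) γ
      (fun x => if (F.1.map (ρ x)).map (ρ γ) = F.1.map (ρ x) then Φ (F.1.map (ρ x)) γ else 0)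
      (fun x h => by
        have h' := (conj_mem_stab_iff ρ F.1 x γ).1 h
        rw [if_pos h', hΦ F ⟨_, h⟩, hΦinv F.1 F.2 x h])
      (fun x h => if_neg fun h' => h ((conj_mem_stab_iff ρ F.1 x γ).2 h')), mul_left_comm]
    congr 1
    rw [Finset.mul_sum]
    refine Finset.sum_congr rfl fun x _ => ?_
    simp only [Ψ, hAinv F.1 F.2 x, ← hA F, mul_ite, mul_zero]
  -- As `x` runs over the group, each member of the orbit is reached as many times as the stabilizer
  -- has elements; this cancels the prefactor.
  have h2 : ∀ q : Quotient (orbitSetoid ρ S), ∑ x : Γ, Ψ (q.out.1.map (ρ x)) =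
      PowerSeries.C (Nat.card (stab ρ q.out.1) : ℂ) *
        ∑ F : S, if (⟦F⟧ : Quotient (orbitSetoid ρ S)) = q then Ψ F.1 else 0 := by
    intro q
    have h3 : ∀ F : S, ∑ x : Γ with (⟨q.out.1.map (ρ x), hinv _ q.out.2 x⟩ : S) = F,
        Ψ (q.out.1.map (ρ x)) = PowerSeries.C (Nat.card (stab ρ q.out.1) : ℂ) *
          if (⟦F⟧ : Quotient (orbitSetoid ρ S)) = q then Ψ F.1 else 0 := by
      intro F
      have h4 : ∀ x : Γ, (⟨q.out.1.map (ρ x), hinv _ q.out.2 x⟩ : S) = F ↔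
          q.out.1.map (ρ x) = F.1 := fun x => Subtype.ext_iff
      split_ifs with hq
      · have : (orbitSetoid ρ S) q.out F := Quotient.exact ((Quotient.out_eq q).trans hq.symm)
        obtain ⟨x₀, hx₀⟩ := this
        rw [Finset.sum_congr rfl (g := fun _ => Ψ F.1) fun x hx => by
          rw [(h4 x).1 (Finset.mem_filter.1 hx).2], Finset.sum_const, nsmul_eq_mul]
        congr 1
        rw [← card_map_eq ρ q.out.1 x₀, Nat.card_eq_fintype_card, Fintype.card_subtype, map_natCast]
        congr 2
        ext x
        simp only [Finset.mem_filter, h4, hx₀]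
      · rw [mul_zero]
        refine Finset.sum_eq_zero fun x hx => absurd ?_ hq
        rw [← Quotient.out_eq q]
        refine Quotient.sound ((orbitSetoid ρ S).symm ⟨x, ?_⟩)
        exact (h4 x).1 (Finset.mem_filter.1 hx).2
    rw [Finset.mul_sum, ← Finset.sum_fiberwise _ fun x : Γ =>
      (⟨q.out.1.map (ρ x), hinv _ q.out.2 x⟩ : S)]
    exact Finset.sum_congr rfl fun F _ => h3 F
  rw [orbitSum, finsum_eq_sum_of_fintype, map_sum]
  simp only [h1, h2]
  have h5 : ∀ q : Quotient (orbitSetoid ρ S), PowerSeries.C ((Nat.card (stab ρ q.out.1) : ℂ)⁻¹) *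
      (PowerSeries.C (Nat.card (stab ρ q.out.1) : ℂ) *
        ∑ F : S, if (⟦F⟧ : Quotient (orbitSetoid ρ S)) = q then Ψ F.1 else 0) =
      ∑ F : S, if (⟦F⟧ : Quotient (orbitSetoid ρ S)) = q then Ψ F.1 else 0 := by
    intro q
    rw [← mul_assoc, ← map_mul, inv_mul_cancel₀, map_one, one_mul]
    exact Nat.cast_ne_zero.2 Nat.card_pos.ne'
  rw [Finset.sum_congr rfl fun q _ => h5 q, Finset.sum_comm]
  simp only [Finset.sum_ite_eq, Finset.mem_univ, if_true, Ψ]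
  rw [← Finset.sum_filter]
  refine Finset.sum_bij (fun F _ => F.1) (fun F hF => (hT _).2 ⟨F.2, (Finset.mem_filter.1 hF).2⟩)
    (fun _ _ _ _ h => Subtype.ext h) (fun F hF => ?_) fun _ _ => rfl
  obtain ⟨h6, h7⟩ := (hT F).1 hF
  exact ⟨⟨F, h6⟩, Finset.mem_filter.2 ⟨Finset.mem_univ _, h7⟩, rfl⟩

end Orbits

end EquivariantCone

namespace EquivariantCone

open Polynomial Module

/-! ### The polynomial `G` at a group element -/

section GPoly

universe u

theorem isUnit_of_evalAt {Γ : Type*} (s : PowerSeries (Γ → ℂ))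
    (h : ∀ γ, PowerSeries.constantCoeff (evalAt γ s) ≠ 0) : IsUnit s := by
  rw [PowerSeries.isUnit_iff_constantCoeff, Pi.isUnit_iff]
  intro γ
  refine isUnit_iff_ne_zero.2 ?_
  have h1 := h γ
  rw [evalAt, ← PowerSeries.coeff_zero_eq_constantCoeff_apply, PowerSeries.coeff_map,
    PowerSeries.coeff_zero_eq_constantCoeff_apply] at h1
  exact h1

theorem evalAt_ringInverse {Γ : Type*} (s : PowerSeries (Γ → ℂ))
    (h : ∀ γ, PowerSeries.constantCoeff (evalAt γ s) ≠ 0) (γ : Γ) :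
    evalAt γ (Ring.inverse s) = (evalAt γ s)⁻¹ := by
  have h1 : evalAt γ (Ring.inverse s) * evalAt γ s = 1 := by
    rw [← map_mul, Ring.inverse_mul_cancel _ (isUnit_of_evalAt s h), map_one]
  rw [PowerSeries.eq_inv_iff_mul_eq_one (h γ)]
  exact h1

variable {V : Type*} [AddCommGroup V] [Module ℝ V]

theorem rep_pow_eq_one {Γ : Type*} [Group Γ] [Finite Γ] (ρ : Representation ℝ Γ V) (γ : Γ) :
    ρ γ ^ Nat.card Γ = 1 := by
  rw [← map_pow, pow_card_eq_one', map_one]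

theorem map_eq_of_isInvariant {Γ : Type*} [Group Γ] {ρ : Representation ℝ Γ V}
    {D : PointedCone ℝ V} (hD : IsInvariant ρ D) (γ : Γ) : D.map (ρ γ) = D := by
  refine le_antisymm ?_ fun x hx => ?_
  · rintro _ ⟨x, hx, rfl⟩
    exact hD γ x hx
  · refine PointedCone.mem_map.2 ⟨ρ γ⁻¹ x, hD _ x hx, ?_⟩
    exact ρ.self_inv_apply γ x

/-- The action of a group element as a linear equivalence. -/
def repEquiv {Γ : Type*} [Group Γ] (ρ : Representation ℝ Γ V) (x : Γ) : V ≃ₗ[ℝ] V :=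
  LinearEquiv.ofLinearMap (ρ x) (ρ x⁻¹) (by rw [← Module.End.mul_eq_comp, ← map_mul]; simp; rfl)
    (by rw [← Module.End.mul_eq_comp, ← map_mul]; simp; rfl)

theorem rep_conj_apply {Γ : Type*} [Group Γ] (ρ : Representation ℝ Γ V) (x γ : Γ) (v : V) :
    ρ γ (repEquiv ρ x v) = repEquiv ρ x (ρ (x⁻¹ * γ * x) v) := by
  change ρ γ (ρ x v) = ρ x (ρ (x⁻¹ * γ * x) v)
  rw [← Module.End.mul_apply, ← Module.End.mul_apply, ← map_mul, ← map_mul]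
  congr 2
  group

variable [FiniteDimensional ℝ V]

/-- By the functional equation the constant coefficient is the leading coefficient up to a sign.
This makes the denominators in `hSum` units at every group element. -/
theorem facePoly_coeff_zero_ne_zero {g : Module.End ℝ V} {W : Submodule ℝ V}
    (hW : W ≤ W.comap g) {N : ℕ} (hN : 0 < N) (hg : g ^ N = 1) : (facePoly g W).coeff 0 ≠ 0 := by
  have h1 := congrArg (fun p => coeff p (finrank ℝ W)) (reflect_facePoly hW hN hg)
  simp only [coeff_reflect, revAt_le le_rfl, Nat.sub_self, coeff_C_mul] at h1
  have h2 : (facePoly g W).coeff (finrank ℝ W) = 1 := by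
    rw [← natDegree_facePoly hW]
    exact facePoly_monic g W
  rw [h1, h2, mul_one]
  exact fixSign_ne_zero _ _

/-- Induction on the dimension for all groups at once, because the recursion passes from `Γ` to the
stabilizers of the faces. -/
theorem map_gPoly {Γ : Type u} [Group Γ] [Finite Γ] (ρ : Representation ℝ Γ V)
    (D : PointedCone ℝ V) (hD : IsInvariant ρ D) (hfin : {F : PointedCone ℝ V | F.IsFaceOf D}.Finite) (γ : Γ) :
    (gPoly ρ D hD).map (Pi.evalRingHom (fun _ : Γ => ℂ) γ) = gNum (ρ γ) D := by
  classical
  induction hk : dim D using Nat.strong_induction_on generalizing Γ D with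
  | _ k ih =>
  subst hk
  by_cases hbot : D = ⊥
  · subst hbot
    rw [gPoly, if_pos rfl, gNum_bot, Polynomial.map_one]
  have hfin' : (properFaces D).Finite := hfin.subset fun F hF => hF.1
  set T : Finset (PointedCone ℝ V) := hfin'.toFinset.filter fun F => F.map (ρ γ) = F with hT
  have hTm : ∀ F, F ∈ T ↔ F ∈ properFaces D ∧ F.map (ρ γ) = F := fun F => by
    rw [hT, Finset.mem_filter, Set.Finite.mem_toFinset]
  let den : PointedCone ℝ V → Γ → PowerSeries ℂ := fun F y =>
    (PowerSeries.X - 1) * (facePoly (ρ y) (linSpan F) : PowerSeries ℂ)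
  have hden0 : ∀ F y, F.map (ρ y) = F → PowerSeries.constantCoeff (den F y) ≠ 0 := by
    intro F y hF
    have := facePoly_coeff_zero_ne_zero (le_comap_of_map_eq hF) Nat.card_pos (rep_pow_eq_one ρ y)
    simpa [den] using this
  have hdenev : ∀ (F : PointedCone ℝ V) (y : stab ρ F), evalAt y ((PowerSeries.X - 1) *
      (detT (faceRep ρ F) : PowerSeries (stab ρ F → ℂ))) = den F y := by
    intro F y
    rw [map_mul, evalAt_coe, map_detT_spanRep, map_sub, map_one, evalAt, PowerSeries.map_X]
    rfl
  let Φ : PointedCone ℝ V → Γ → PowerSeries ℂ := fun F y =>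
    (gNum (ρ y) F : PowerSeries ℂ) * (den F y)⁻¹
  have hsum : evalAt γ (hSum ρ D hD fun F => gPoly (stabRep ρ F.1) F.1 (stab_invariant ρ F.1)) =
      ∑ F ∈ T, (facePoly (ρ γ) (linSpan D) : PowerSeries ℂ) * Φ F γ := by
    refine evalAt_orbitSum ρ (properFaces D) hfin' (fun F hF x => ⟨?_, fun h => hF.2 ?_⟩) _ _ γ
      (fun _ => (facePoly (ρ γ) (linSpan D) : PowerSeries ℂ)) (fun F => ?_) (fun _ _ _ => rfl)
      Φ (fun F y => ?_) (fun F hF x hx => ?_) T hTm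
    · exact isFaceOf_map_of_mul_eq_one (g' := ρ x⁻¹) (by rw [← map_mul]; simp)
        (map_eq_of_isInvariant hD x) hF.1
    · rw [(map_rep_eq_iff ρ F D x).1 h, map_eq_of_isInvariant hD]
    · rw [evalAt_coe, map_detT_spanRep]
    · rw [map_mul, evalAt_ringInverse, hdenev, evalAt_coe,
        ih _ (dim_lt_of_isFaceOf F.2.1 F.2.2) (stabRep ρ F.1) F.1 (stab_invariant ρ F.1)
          (hfin.subset fun E hE => hE.trans F.2.1) y rfl]
      · rfl
      · intro y
        rw [hdenev]
        exact hden0 _ _ y.2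
    · have h1 : gNum (ρ γ) (F.map (ρ x)) = gNum (ρ (x⁻¹ * γ * x)) F :=
        gNum_conj (repEquiv ρ x) (rep_conj_apply ρ x γ) F hx
      have h2 : facePoly (ρ γ) (linSpan (F.map (ρ x))) =
          facePoly (ρ (x⁻¹ * γ * x)) (linSpan F) := by
        rw [linSpan_map]
        exact facePoly_conj (repEquiv ρ x) (rep_conj_apply ρ x γ) (le_comap_of_map_eq hx)
      simp only [Φ, den, h1, h2]
  have hmain : evalAt γ ((1 - PowerSeries.X) *
      hSum ρ D hD fun F => gPoly (stabRep ρ F.1) F.1 (stab_invariant ρ F.1)) =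
      -((∑ F ∈ T, (facePoly (ρ γ) (linSpan D) /ₘ facePoly (ρ γ) (linSpan F)) * gNum (ρ γ) F :
        ℂ[X]) : PowerSeries ℂ) := by
    rw [map_mul, hsum, map_sub, map_one, evalAt, PowerSeries.map_X, Finset.mul_sum]
    refine Eq.trans ?_ (congrArg _ (map_sum Polynomial.coeToPowerSeries.ringHom _ _).symm)
    rw [← Finset.sum_neg_distrib]
    refine Finset.sum_congr rfl fun F hF => ?_
    obtain ⟨⟨hFD, -⟩, hFγ⟩ := (hTm F).1 hF
    have hdvd := facePoly_dvd (le_comap_of_map_eq hFγ)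
      (le_comap_of_map_eq (map_eq_of_isInvariant hD γ)) (Submodule.span_mono hFD.le)
    have h3 := PowerSeries.mul_inv_cancel _ (hden0 F γ hFγ)
    have h4 := divByMonic_mul_self (facePoly_monic (ρ γ) (linSpan F)) hdvd
    rw [Polynomial.coeToPowerSeries.ringHom_apply, Polynomial.coe_mul]
    conv_lhs => rw [← h4, Polynomial.coe_mul]
    simp only [Φ]
    set κ := ((facePoly (ρ γ) (linSpan D) /ₘ facePoly (ρ γ) (linSpan F) : ℂ[X]) : PowerSeries ℂ)
    simp only [den] at h3 ⊢
    linear_combination (-κ * (gNum (ρ γ) F : PowerSeries ℂ)) * h3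
  rw [gPoly, if_neg hbot, ← PowerSeries.trunc_map]
  change PowerSeries.trunc _ (evalAt γ _) = _
  rw [hmain]
  ext i
  rw [coeff_gNum hbot T hTm, PowerSeries.coeff_trunc, map_neg, Polynomial.coeff_coe]

end GPoly

end EquivariantCone

namespace EquivariantCone

open Polynomial Module

/-! ### The height function of a polytope -/

section Height

variable {V : Type*} [AddCommGroup V] [Module ℝ V]

/-- If the span of `P` has larger dimension than `P`, then `P` lies at height one. -/
theorem exists_height [FiniteDimensional ℝ V] {P : Set V}
    (hlt : finrank ℝ (vectorSpan ℝ P) < finrank ℝ (Submodule.span ℝ P)) :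
    ∃ h : V →ₗ[ℝ] ℝ, ∀ p ∈ P, h p = 1 := by
  rcases P.eq_empty_or_nonempty with rfl | ⟨p₀, hp₀⟩
  · exact ⟨0, fun p hp => hp.elim⟩
  -- If `p₀` were in the direction space, all of `P` would be, and the span could not have larger
  -- dimension.
  have hnot : p₀ ∉ vectorSpan ℝ P := by
    intro hmem
    refine absurd (Submodule.finrank_mono (Submodule.span_le.2 fun p hp => ?_)) (not_le.2 hlt)
    have h1 := vsub_mem_vectorSpan ℝ hp hp₀
    rw [vsub_eq_sub] at h1
    simpa using Submodule.add_mem _ h1 hmem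
  obtain ⟨f, hf0, hf⟩ := Submodule.exists_le_ker_of_notMem hnot
  refine ⟨(f p₀)⁻¹ • f, fun p hp => ?_⟩
  have h1 := hf (vsub_mem_vectorSpan ℝ hp hp₀)
  rw [vsub_eq_sub, LinearMap.mem_ker, map_sub, sub_eq_zero] at h1
  rw [LinearMap.smul_apply, h1, smul_eq_mul, inv_mul_cancel₀ hf0]

/-- Convexity gives `aP + bP = (a + b)P` for `a, b ≥ 0`, so the slice of the cone at height `m` is
`mP`. -/
theorem mem_smul_of_mem_coneOver {P : Set V} (hP : Convex ℝ P) (hne : P.Nonempty) {h : V →ₗ[ℝ] ℝ}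
    (hh : ∀ p ∈ P, h p = 1) {x : V} (hx : x ∈ coneOver P) : 0 ≤ h x ∧ x ∈ h x • P := by
  induction hx using Submodule.span_induction with
  | mem x hx => rw [hh x hx, one_smul]; exact ⟨zero_le_one, hx⟩
  | zero => rw [map_zero, Set.zero_smul_set hne]; exact ⟨le_rfl, rfl⟩
  | add x y _ _ hx hy =>
    rw [map_add, hP.add_smul hx.1 hy.1]
    exact ⟨add_nonneg hx.1 hy.1, Set.add_mem_add hx.2 hy.2⟩
  | smul r x _ hx =>
    have h1 : h (r • x) = (r : ℝ) * h x := map_smul h (r : ℝ) x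
    rw [h1, mul_smul]
    exact ⟨mul_nonneg r.2 hx.1, Set.smul_mem_smul_set hx.2⟩

theorem coneOver_convexHull (S : Set V) : coneOver (convexHull ℝ S) = PointedCone.hull ℝ S := by
  apply le_antisymm
  · refine Submodule.span_le.2 (convexHull_min Submodule.subset_span ?_)
    exact (PointedCone.hull ℝ S).convex
  · exact Submodule.span_mono (subset_convexHull ℝ S)

theorem finite_faces_dualFace [FiniteDimensional ℝ V] {S : Set V} (hS : S.Finite)
    {F : PointedCone ℝ V} (hF : F.IsFaceOf (PointedCone.hull ℝ S)) :
    {E : PointedCone ℝ (Module.Dual ℝ V) |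
      E.IsFaceOf (dualFace (PointedCone.hull ℝ S) F)}.Finite := by
  refine ((finite_faces hS).image (dualFace (PointedCone.hull ℝ S))).subset fun E hE => ?_
  obtain ⟨F', hF', -, rfl⟩ := exists_eq_dualFace hS hF hE
  exact ⟨F', hF', rfl⟩

end Height

/-! ### Symmetry of the sum over the fixed faces -/

section Symmetry

variable {n : ℕ} {g g' : Module.End ℝ (Fin n → ℝ)} {N : ℕ} {S : Set (Fin n → ℝ)}

/-- The orbit sums of the generators of height one generate the fixed cone and have height `N`. -/
theorem isGraded_fixCone (hN : 0 < N) (hg : g ^ N = 1)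
    (hgΛ : ∀ x ∈ intLattice n, g x ∈ intLattice n) (hS : S.Finite) (hSΛ : S ⊆ intLattice n)
    (hSg : (PointedCone.hull ℝ S).map g = PointedCone.hull ℝ S) {h : (Fin n → ℝ) →ₗ[ℝ] ℝ}
    (hh : ∀ s ∈ S, h s = 1) (hhg : ∀ x, h (g x) = h x) :
    IsGraded h (intLattice n) (fixCone g (PointedCone.hull ℝ S)) := by
  classical
  have hpow : ∀ (i : ℕ) x, h ((g ^ i) x) = h x := by
    intro i x
    induction i with
    | zero => rfl
    | succ i ih => rw [pow_succ', Module.End.mul_apply, hhg, ih]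
  refine ⟨⟨(hS.image (orbSum g N)).toFinset, ?_, ?_, ?_⟩, fun m => ?_⟩
  · intro x hx
    obtain ⟨s, hs, rfl⟩ := (Set.Finite.mem_toFinset _).1 hx
    exact orbSum_mem_of_mem hgΛ N (hSΛ hs)
  · intro x hx
    obtain ⟨s, hs, rfl⟩ := (Set.Finite.mem_toFinset _).1 hx
    refine ⟨N, hN, ?_⟩
    rw [orbSum_apply, map_sum]
    simp [hpow, hh s hs]
  · rw [Set.Finite.coe_toFinset]
    exact fixCone_hull hN hg hSg
  · refine (finite_intLattice_height hS (h := h) (fun s hs => ?_) m).subset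
      fun x hx => ⟨⟨(mem_fixCone.1 hx.1.1).1, hx.1.2⟩, hx.2⟩
    rw [hh s hs]
    exact one_pos

/-- The symmetry of the sum over the fixed faces that gives the values of `S̃`. -/
theorem exists_expands_invHom_eq (h : g * g' = 1) (h' : g' * g = 1) (hN : 0 < N) (hg : g ^ N = 1)
    (hgΛ : ∀ x ∈ intLattice n, g x ∈ intLattice n) (hS : S.Finite) (hSΛ : S ⊆ intLattice n)
    (hSg : (PointedCone.hull ℝ S).map g = PointedCone.hull ℝ S) {ht : (Fin n → ℝ) →ₗ[ℝ] ℝ}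
    (hgr : IsGraded ht (intLattice n) (fixCone g (PointedCone.hull ℝ S)))
    (T : Finset (PointedCone ℝ (Fin n → ℝ)))
    (hT : ∀ M, M ∈ T ↔ M.IsFaceOf (PointedCone.hull ℝ S) ∧ M.map g = M) :
    ∃ f, Expands (∑ F ∈ T, genFun ht ((fixCone g F : Set _) ∩ intLattice n) *
      ((facePoly g (linSpan F) * gNum g'.dualMap (dualFace (PointedCone.hull ℝ S) F) : ℂ[X]) :
        PowerSeries ℂ)) f ∧ RatFunc.X ^ n * invHom f = f := by
  classical
  set e : PointedCone ℝ (Fin n → ℝ) → RatFunc ℂ := fun F =>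
    toRat (genFun ht ((fixCone g F : Set _) ∩ intLattice n)) with he
  set q : PointedCone ℝ (Fin n → ℝ) → ℂ[X] := fun F => facePoly g (linSpan F) *
    gNum g'.dualMap (dualFace (PointedCone.hull ℝ S) F) with hq
  refine ⟨∑ F ∈ T, e F * algebraMap ℂ[X] (RatFunc ℂ) (q F), Expands.sum T fun F hF =>
    (hgr.face (fixCone_isFaceOf ((hT F).1 hF).1)).expands.mul (Expands.of_polynomial _), ?_⟩
  -- The exponent splits as `n = dim F + (n - dim F)`: the first part reverses `facePoly` and yields
  -- the sign of `F`, the second reverses the `G`-polynomial and yields the sum over `M ≥ F`.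
  have h1 : ∀ F ∈ T, RatFunc.X ^ n * invHom (e F * algebraMap ℂ[X] (RatFunc ℂ) (q F)) =
      ∑ M ∈ T, if F ≤ M then (RatFunc.C (fixSign g (linSpan F)) * invHom (e F)) *
        algebraMap ℂ[X] (RatFunc ℂ) (q M) else 0 := by
    intro F hF
    obtain ⟨hFC, hFg⟩ := (hT F).1 hF
    obtain ⟨k1, k2⟩ := facePoly_mul_reflect_gNum h h' hN hg hgΛ hS hSΛ hSg hFC hFg
      (T.filter (F ≤ ·)) (fun M => by rw [Finset.mem_filter, hT])
    have hle := le_comap_of_map_eq hFg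
    have hdim : dim F ≤ n := (Submodule.finrank_le _).trans (finrank_fin_fun ℝ).le
    have hn : dim F + (n - dim F) = n := by omega
    have hqd : (q F).natDegree ≤ n := by
      refine natDegree_mul_le.trans ?_
      rw [natDegree_facePoly hle]
      change dim F + _ ≤ n
      omega
    have hrefl : (q F).reflect n = C (fixSign g (linSpan F)) * ∑ M ∈ T.filter (F ≤ ·), q M := by
      have h2 : (facePoly g (linSpan F)).reflect (dim F) = C (fixSign g (linSpan F)) *
        facePoly g (linSpan F) := reflect_facePoly hle hN hg
      have h3 : (facePoly g (linSpan F)).natDegree ≤ dim F := (natDegree_facePoly hle).le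
      have h4 := reflect_mul _ _ h3 k1
      rw [hn, h2, mul_assoc, k2] at h4
      exact h4
    rw [map_mul, mul_left_comm, X_pow_mul_invHom _ _ hqd, hrefl, map_mul, map_sum, Finset.mul_sum,
      Finset.mul_sum, Finset.sum_filter]
    refine Finset.sum_congr rfl fun M _ => ?_
    split_ifs
    · rw [RatFunc.algebraMap_C]
      ring
    · rfl
  -- After the exchange of sums, the coefficient of `q M` is the reciprocity sum over the fixed
  -- faces below `M`.
  rw [map_sum, Finset.mul_sum, Finset.sum_congr rfl h1, Finset.sum_comm]
  refine Finset.sum_congr rfl fun M hM => ?_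
  obtain ⟨hMC, hMg⟩ := (hT M).1 hM
  rw [← Finset.sum_filter, ← Finset.sum_mul]
  congr 1
  exact (toRat_fixCone_eq_sum hN hg hgr hMC hMg (T.filter (· ≤ M)) fun F => by
    rw [Finset.mem_filter, hT]).symm

end Symmetry

/-! ### The values of `S̃` -/

section STilde

variable {Γ : Type*} [Group Γ] {n : ℕ} (ρ : Γ →* Matrix.GeneralLinearGroup (Fin n) ℤ)

theorem realRep_mem_intLattice (γ : Γ) {x : Fin n → ℝ} (hx : x ∈ intLattice n) :
    realRep ρ γ x ∈ intLattice n := by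
  obtain ⟨z, rfl⟩ := hx
  exact ⟨_, (realRep_intVec ρ γ z).symm⟩

theorem realRep_mul_inv (γ : Γ) : realRep ρ γ * realRep ρ γ⁻¹ = 1 := by
  rw [← map_mul, mul_inv_cancel, map_one]

theorem realRep_inv_mul (γ : Γ) : realRep ρ γ⁻¹ * realRep ρ γ = 1 := by
  rw [← map_mul, inv_mul_cancel, map_one]

variable {P : Set (Fin n → ℝ)} (hP : IsInvariant (realRep ρ) P)

-- Both `h` and its composite with the action are `1` on `P`, and `P` spans.
include hP in
theorem height_realRep {h : (Fin n → ℝ) →ₗ[ℝ] ℝ} (hh : ∀ p ∈ P, h p = 1)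
    (hspan : Submodule.span ℝ P = ⊤) (γ : Γ) (x : Fin n → ℝ) : h (realRep ρ γ x) = h x := by
  have : h ∘ₗ realRep ρ γ = h := LinearMap.ext_on hspan fun p hp => by
    rw [LinearMap.comp_apply, hh p hp, hh _ (hP γ p hp)]
  exact LinearMap.congr_fun this x

theorem latticePts_eq (hconv : Convex ℝ P) (hne : P.Nonempty) {h : (Fin n → ℝ) →ₗ[ℝ] ℝ}
    (hh : ∀ p ∈ P, h p = 1) {F : PointedCone ℝ (Fin n → ℝ)} (hF : F ≤ coneOver P) (m : ℕ) :
    latticePts P F m = (F : Set (Fin n → ℝ)) ∩ intLattice n ∩ {x | h x = m} := by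
  ext x
  constructor
  · rintro ⟨hx, ⟨p, hp, hpx⟩, z, hz⟩
    refine ⟨⟨hx, z, hz.symm⟩, ?_⟩
    change h x = m
    rw [← hpx]
    change h ((m : ℝ) • p) = m
    rw [map_smul, hh p hp, smul_eq_mul, mul_one]
  · rintro ⟨⟨hx, z, hz⟩, hm⟩
    refine ⟨hx, ?_, z, hz.symm⟩
    have h1 := (mem_smul_of_mem_coneOver hconv hne hh (hF hx)).2
    have hm' : h x = m := hm
    rwa [hm'] at h1

/-- Permutation characters count fixed lattice points, and the reversed characteristic polynomial
from `detI` is the original one up to `fixSign`. -/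
theorem evalAt_phi [Finite Γ] (hconv : Convex ℝ P) (hne : P.Nonempty) {h : (Fin n → ℝ) →ₗ[ℝ] ℝ}
    (hh : ∀ p ∈ P, h p = 1) {F : PointedCone ℝ (Fin n → ℝ)} (hF : F ≤ coneOver P)
    (hfin : ∀ m : ℕ, ((coneOver P : Set (Fin n → ℝ)) ∩ intLattice n ∩ {x | h x = m}).Finite)
    (y : stab (realRep ρ) F) :
    evalAt y (phi ρ P hP F) =
      genFun h ((fixCone (realRep ρ y) F : Set (Fin n → ℝ)) ∩ intLattice n) *
        (PowerSeries.C (fixSign (realRep ρ y) (linSpan F)) *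
          (facePoly (realRep ρ y) (linSpan F) : PowerSeries ℂ)) := by
  rw [phi, map_mul, evalAt_coe, map_detI_spanRep]
  congr 1
  · ext m
    rw [evalAt, PowerSeries.coeff_map, PowerSeries.coeff_mk, coeff_genFun]
    change permChar _ _ _ y = _
    have h1 := latticePts_eq hconv hne hh hF m
    rw [permChar_apply _ _ _ (by
      rw [h1]
      exact (hfin m).subset fun x hx => ⟨⟨hF hx.1.1, hx.1.2⟩, hx.2⟩), h1]
    congr 2
    ext x
    constructor
    · rintro ⟨⟨⟨a, b⟩, c⟩, d⟩
      exact ⟨⟨mem_fixCone.2 ⟨a, d⟩, b⟩, c⟩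
    · rintro ⟨⟨a, b⟩, c⟩
      exact ⟨⟨⟨(mem_fixCone.1 a).1, b⟩, c⟩, (mem_fixCone.1 a).2⟩
  · have h2 := reflect_facePoly (le_comap_of_map_eq (g := realRep ρ y) (D := F) y.2) Nat.card_pos
      (rep_pow_eq_one (realRep ρ) (y : Γ))
    change ((reflect (dim F) (facePoly (realRep ρ y) (linSpan F)) : ℂ[X]) : PowerSeries ℂ) = _
    change reflect (dim F) _ = _ at h2
    rw [h2, Polynomial.coe_mul, Polynomial.coe_C]

/-- The action of `x` is a height-preserving bijection of lattice points that conjugates `x⁻¹ γ x`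
into `γ`. -/
theorem genFun_fixCone_conj {h : (Fin n → ℝ) →ₗ[ℝ] ℝ}
    (hhρ : ∀ (γ : Γ) x, h (realRep ρ γ x) = h x) (F : PointedCone ℝ (Fin n → ℝ)) (x γ : Γ) :
    genFun h ((fixCone (realRep ρ γ) (F.map (realRep ρ x)) : Set (Fin n → ℝ)) ∩ intLattice n) =
      genFun h ((fixCone (realRep ρ (x⁻¹ * γ * x)) F : Set (Fin n → ℝ)) ∩ intLattice n) := by
  have hinv : ∀ v, realRep ρ x⁻¹ (realRep ρ x v) = v := fun v =>
    LinearMap.congr_fun (realRep_inv_mul ρ x) v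
  have hconj : ∀ v, realRep ρ γ (realRep ρ x v) = realRep ρ x (realRep ρ (x⁻¹ * γ * x) v) :=
    rep_conj_apply (realRep ρ) x γ
  have hinj : Function.Injective (realRep ρ x) := Function.LeftInverse.injective hinv
  ext m
  rw [coeff_genFun, coeff_genFun]
  refine congrArg Nat.cast (Eq.trans (congrArg _ ?_) (Set.ncard_image_of_injective _ hinj))
  ext v
  constructor
  · rintro ⟨⟨hv, hvΛ⟩, hm⟩
    obtain ⟨hv1, hv2⟩ := mem_fixCone.1 hv
    obtain ⟨w, hw, rfl⟩ := PointedCone.mem_map.1 hv1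
    refine ⟨w, ⟨⟨mem_fixCone.2 ⟨hw, hinj ?_⟩, ?_⟩, ?_⟩, rfl⟩
    · rw [← hconj, hv2]
    · have := realRep_mem_intLattice ρ x⁻¹ hvΛ
      rwa [hinv] at this
    · exact (hhρ x w).symm.trans hm
  · rintro ⟨w, ⟨⟨hw, hwΛ⟩, hm⟩, rfl⟩
    obtain ⟨hw1, hw2⟩ := mem_fixCone.1 hw
    refine ⟨⟨mem_fixCone.2 ⟨PointedCone.mem_map.2 ⟨w, hw1, rfl⟩, ?_⟩,
      realRep_mem_intLattice ρ x hwΛ⟩, (hhρ x w).trans hm⟩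
    rw [hconj, hw2]

/-- The value of `S̃` at a group element. -/
theorem evalAt_sTilde [Finite Γ] {S : Set (Fin n → ℝ)} (hS : S.Finite) (hPS : P = convexHull ℝ S)
    (hne : P.Nonempty) {h : (Fin n → ℝ) →ₗ[ℝ] ℝ} (hh : ∀ p ∈ P, h p = 1)
    (hspan : Submodule.span ℝ P = ⊤) (γ : Γ) (T : Finset (PointedCone ℝ (Fin n → ℝ)))
    (hT : ∀ F, F ∈ T ↔ F.IsFaceOf (coneOver P) ∧ F.map (realRep ρ γ) = F) :
    evalAt γ (sTilde ρ P hP) = ∑ F ∈ T, PowerSeries.C ((-1) ^ n) *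
      (genFun h ((fixCone (realRep ρ γ) F : Set (Fin n → ℝ)) ∩ intLattice n) *
        ((facePoly (realRep ρ γ) (linSpan F) *
          gNum (realRep ρ γ⁻¹).dualMap (dualFace (coneOver P) F) : ℂ[X]) : PowerSeries ℂ)) := by
  have hC : coneOver P = PointedCone.hull ℝ S := by rw [hPS, coneOver_convexHull]
  have hconv : Convex ℝ P := by rw [hPS]; exact convex_convexHull ℝ S
  have hSP : S ⊆ P := by rw [hPS]; exact subset_convexHull ℝ S
  have hfaces : {F : PointedCone ℝ (Fin n → ℝ) | F.IsFaceOf (coneOver P)}.Finite := by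
    rw [hC]; exact finite_faces hS
  have hfin : ∀ m : ℕ,
      ((coneOver P : Set (Fin n → ℝ)) ∩ intLattice n ∩ {x | h x = m}).Finite := fun m => by
    rw [hC]
    exact finite_intLattice_height hS (fun s hs => by rw [hh s (hSP hs)]; exact one_pos) m
  have hinv := coneOver_invariant (realRep ρ) P hP
  have hhρ := height_realRep ρ hP hh hspan
  let Φ : PointedCone ℝ (Fin n → ℝ) → Γ → PowerSeries ℂ := fun F y =>
    PowerSeries.C ((-1) ^ dim F) *
      (genFun h ((fixCone (realRep ρ y) F : Set (Fin n → ℝ)) ∩ intLattice n) *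
        ((facePoly (realRep ρ y) (linSpan F) *
          gNum (realRep ρ y⁻¹).dualMap (dualFace (coneOver P) F) : ℂ[X]) : PowerSeries ℂ))
  have key := evalAt_orbitSum (realRep ρ) {F | F.IsFaceOf (coneOver P)} hfaces
    (fun F hF x => isFaceOf_map_of_mul_eq_one (realRep_inv_mul ρ x)
      (map_eq_of_isInvariant hinv x) hF)
    (fun F => (-1) ^ (n - dim F.1))
    (fun F => PowerSeries.C (detChar (faceRep (realRep ρ) F.1)) * phi ρ P hP F.1 *
      (gPoly (dualStabRep (realRep ρ) F.1) (dualFace (coneOver P) F.1)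
        (dualFace_invariant (realRep ρ) (coneOver P)
          (coneOver_invariant (realRep ρ) P hP) F.1) : PowerSeries _)) γ
    (fun F => (-1) ^ (n - dim F)) (fun F => by rw [map_pow, map_neg, map_one])
    (fun F _ x => by
      have : dim (F.map (realRep ρ x)) = dim F := dim_map_equiv (repEquiv (realRep ρ) x) F
      rw [this])
    Φ ?_ ?_ T hT
  · refine key.trans (Finset.sum_congr rfl fun F _ => ?_)
    have hdim : dim F ≤ n := (Submodule.finrank_le _).trans (finrank_fin_fun ℝ).le
    have h1 : ((-1 : PowerSeries ℂ)) ^ (n - dim F) = PowerSeries.C ((-1) ^ (n - dim F)) := by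
      rw [map_pow, map_neg, map_one]
    simp only [Φ]
    -- The sign `(-1)^{n - dim F}` of the definition and the `(-1)^{dim F}` from the determinant
    -- combine to a sign independent of `F`.
    rw [h1, ← mul_assoc, ← map_mul, ← pow_add, Nat.sub_add_cancel hdim]
  · rintro ⟨F, hF⟩ y
    have hF' : F.IsFaceOf (PointedCone.hull ℝ S) := by rw [← hC]; exact hF
    have h1 : evalAt y (PowerSeries.C (detChar (faceRep (realRep ρ) F))) =
        PowerSeries.C ((-1) ^ dim F * fixSign (realRep ρ y) (linSpan F)) := by
      rw [evalAt, PowerSeries.map_C]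
      congr 1
      exact detChar_spanRep (stabRep (realRep ρ) F) F (stab_invariant _ F) y Nat.card_pos
        (rep_pow_eq_one (stabRep (realRep ρ) F) y)
    have h2 : (gPoly (dualStabRep (realRep ρ) F) (dualFace (coneOver P) F)
        (dualFace_invariant (realRep ρ) (coneOver P) (coneOver_invariant (realRep ρ) P hP) F)).map
        (Pi.evalRingHom (fun _ => ℂ) y) =
        gNum (realRep ρ (y : Γ)⁻¹).dualMap (dualFace (coneOver P) F) :=
      map_gPoly (dualStabRep (realRep ρ) F) (dualFace (coneOver P) F) _
        (by rw [hC]; exact finite_faces_dualFace hS hF') y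
    rw [map_mul, map_mul, h1, evalAt_phi ρ hP hconv hne hh hF.le hfin, evalAt_coe, h2]
    simp only [Φ, Polynomial.coe_mul, map_mul]
    -- One factor `fixSign` comes from `det ρ_F` and one from `φ_F`; they cancel.
    have h3 : PowerSeries.C (fixSign (realRep ρ y) (linSpan F)) *
        PowerSeries.C (fixSign (realRep ρ y) (linSpan F)) = 1 := by
      rw [← map_mul, fixSign_mul_self, map_one]
    linear_combination (PowerSeries.C ((-1) ^ dim F) *
      genFun h ((fixCone (realRep ρ y) F : Set (Fin n → ℝ)) ∩ intLattice n) *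
      (facePoly (realRep ρ y) (linSpan F) : PowerSeries ℂ) *
      (gNum (realRep ρ (y : Γ)⁻¹).dualMap (dualFace (coneOver P) F) : PowerSeries ℂ)) * h3
  · intro F hF x hx
    have h1 : dim (F.map (realRep ρ x)) = dim F := dim_map_equiv (repEquiv (realRep ρ) x) F
    have h2 : facePoly (realRep ρ γ) (linSpan (F.map (realRep ρ x))) =
        facePoly (realRep ρ (x⁻¹ * γ * x)) (linSpan F) := by
      rw [linSpan_map]
      exact facePoly_conj (repEquiv (realRep ρ) x) (rep_conj_apply (realRep ρ) x γ)
        (le_comap_of_map_eq hx)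
    have hdual : ∀ (y : Γ) (E : PointedCone ℝ (Fin n → ℝ)),
        dualFace (coneOver P) (E.map (realRep ρ y)) =
          (dualFace (coneOver P) E).map ((realRep ρ).dual y) := fun y E =>
      (dualFace_map (realRep_mul_inv ρ y) (realRep_inv_mul ρ y)
        (map_eq_of_isInvariant hinv y)).symm
    have h3 : gNum (realRep ρ γ⁻¹).dualMap (dualFace (coneOver P) (F.map (realRep ρ x))) =
        gNum (realRep ρ (x⁻¹ * γ * x)⁻¹).dualMap (dualFace (coneOver P) F) := by
      rw [hdual]
      exact gNum_conj (repEquiv (realRep ρ).dual x) (rep_conj_apply (realRep ρ).dual x γ) _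
        (by rw [← hdual, hx])
    simp only [Φ]
    rw [h1, h2, h3, genFun_fixCone_conj ρ hhρ]

end STilde

end EquivariantCone

end

/-! ### The functional equation of `S̃` -/

theorem lemmal {Γ : Type*} [Group Γ] [Finite Γ] (d : ℕ)
    (ρ : Γ →* Matrix.GeneralLinearGroup (Fin (d + 1)) ℤ)
    (P : Set (Fin (d + 1) → ℝ))
    (hlattice : EquivariantCone.IsLatticePolytope P)
    (hdimP : Module.finrank ℝ (vectorSpan ℝ P) = d)
    (hdimC : EquivariantCone.dim (EquivariantCone.coneOver P) = d + 1)
    (hP : EquivariantCone.IsInvariant (EquivariantCone.realRep ρ) P) :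
    ∀ γ : Γ, ∃ f : RatFunc ℂ,
      EquivariantCone.IsExpansionOf
        (EquivariantCone.evalAt γ (EquivariantCone.sTilde ρ P hP)) f ∧
      f = RatFunc.X ^ (d + 1) * EquivariantCone.invertVar f := by
  classical
  intro γ
  obtain ⟨S₀, hPS⟩ := hlattice
  set S : Set (Fin (d + 1) → ℝ) := EquivariantCone.intVec '' (S₀ : Set (Fin (d + 1) → ℤ)) with hS₀
  have hS : S.Finite := S₀.finite_toSet.image _
  have hSΛ : S ⊆ EquivariantCone.intLattice (d + 1) := by
    rintro _ ⟨z, -, rfl⟩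
    exact ⟨z, rfl⟩
  have hspan : Submodule.span ℝ P = ⊤ := by
    apply Submodule.eq_top_of_finrank_eq
    rw [Module.finrank_fin_fun, ← EquivariantCone.linSpan_hull]
    exact hdimC
  -- As `P` has dimension `d` and spans a space of dimension `d + 1`, it lies in an affine
  -- hyperplane off the origin.
  obtain ⟨h, hh⟩ := EquivariantCone.exists_height (P := P) (by
    rw [hdimP, hspan, finrank_top, Module.finrank_fin_fun]
    exact Nat.lt_succ_self d)
  have hne : P.Nonempty := by
    rw [Set.nonempty_iff_ne_empty]
    rintro rfl
    rw [Submodule.span_empty] at hspan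
    exact bot_ne_top hspan
  have hC : EquivariantCone.coneOver P = PointedCone.hull ℝ S := by
    rw [hPS, EquivariantCone.coneOver_convexHull]
  have hSP : S ⊆ P := by rw [hPS]; exact subset_convexHull ℝ S
  have hSg : (PointedCone.hull ℝ S).map (EquivariantCone.realRep ρ γ) = PointedCone.hull ℝ S := by
    rw [← hC]
    exact EquivariantCone.map_eq_of_isInvariant (EquivariantCone.coneOver_invariant _ P hP) γ
  have hgΛ : ∀ x ∈ EquivariantCone.intLattice (d + 1), EquivariantCone.realRep ρ γ x ∈
      EquivariantCone.intLattice (d + 1) := fun x hx =>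
    EquivariantCone.realRep_mem_intLattice ρ γ hx
  have hg := EquivariantCone.rep_pow_eq_one (EquivariantCone.realRep ρ) γ
  have hgr := EquivariantCone.isGraded_fixCone Nat.card_pos hg hgΛ hS hSΛ hSg
    (fun s hs => hh s (hSP hs)) (EquivariantCone.height_realRep ρ hP hh hspan γ)
  set T : Finset (PointedCone ℝ (Fin (d + 1) → ℝ)) :=
    (EquivariantCone.finite_faces hS).toFinset.filter fun F => F.map (EquivariantCone.realRep ρ γ) = F with hTdef
  have hT : ∀ F, F ∈ T ↔ F.IsFaceOf (PointedCone.hull ℝ S) ∧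
      F.map (EquivariantCone.realRep ρ γ) = F := fun F => by
    rw [hTdef, Finset.mem_filter, Set.Finite.mem_toFinset, Set.mem_ofPred_eq]
  obtain ⟨f, hf, hsym⟩ := EquivariantCone.exists_expands_invHom_eq
    (EquivariantCone.realRep_mul_inv ρ γ) (EquivariantCone.realRep_inv_mul ρ γ) Nat.card_pos hg hgΛ
    hS hSΛ hSg hgr T hT
  -- The global sign `(-1)^{d+1}` from `evalAt_sTilde` is a constant and hence unaffected by `t ↦
  -- t⁻¹`.
  refine ⟨algebraMap (Polynomial ℂ) (RatFunc ℂ) (Polynomial.C ((-1) ^ (d + 1))) * f, ?_, ?_⟩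
  · apply EquivariantCone.Expands.isExpansionOf
    rw [EquivariantCone.evalAt_sTilde ρ hP hS hPS hne hh hspan γ T (by rw [hC]; exact hT),
      ← Finset.mul_sum, ← Polynomial.coe_C, hC]
    exact (EquivariantCone.Expands.of_polynomial _).mul hf
  · rw [EquivariantCone.invertVar_eq, map_mul, mul_left_comm, hsym, map_pow, map_pow, map_pow,
      map_neg, map_neg, map_neg, map_one, map_one, map_one]
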